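/- **Setting.** Let $\Omega\subset\mathbb R^3$ be a bounded domain with smooth boundary, $A=-\Delta$ with homogeneous Dirichlet boundary condition, and $\lambda_1>0$ the first eigenvalue of $A$. Write $H=L^2(\Omega)$ with norm $\|\cdot\|$; $H^1=H^1_0(\Omega)$ with $\langle u,v\rangle_1=\int_\Omega\nabla u\cdot\nabla v$, $\|u\|_1=\|\nabla u\|$; and $H^{-1}=H^{-1}(\Omega)$, the dual of $H^1$, with the dual norm $\|\cdot\|_{-1}$. The kernel $(t,s)\mapsto\mu_t(s)$, $\mathbb R\times(0,\infty)\to(0,\infty)$, satisfies (dot $=\partial_t$, prime $=\partial_s$): * for every $t$, $s\mapsto\mu_t(s)$ is nonincreasing, (locally) absolutely continuous and summable on $(0,\infty)$; * for every $\tau$ there is $K_\tau:[\tau,\infty)\to(0,\infty)$, summable on each $[\tau,T]$, with $\mu_t(s)\le K_\tau(t)\mu_\tau(s)$ for all $t\ge\tau$, $s>0$; * for almost every $s>0$, $t\mapsto\mu_t(s)$ is differentiable on $\mathbb R$, and $\mu_t(s)$, $\dot\mu_t(s)$ belong to $L^\infty(\mathcal K)$ for every compact $\mathcal K\subset\mathbb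 R\times(0,\infty)$; * there is $M:\mathbb R\to(0,\infty)$, bounded on bounded intervals, with $\dot\mu_t(s)+\mu_t'(s)\le M(t)\mu_t(s)$ for every $t$ and almost every $s>0$. Let $g\in H$, and let $f\in C^1(\mathbb R)$ satisfy $f(0)=0$, $|f'(u)|\le c(1+|u|^2)$ for some $c\ge0$, and $\liminf_{|u|\to\infty}f(u)/u>-\lambda_1$. Put $$\mathcal H_t=H^1\times H\times L^2_{\mu_t}(\mathbb R^+;H^1),\qquad \|(u,v,\eta)\|_{\mathcal H_t}^2=\|u\|_1^2+\|v\|^2+\int_0^\infty\mu_t(s)\|\eta(s)\|_1^2\,ds,$$ $$\mathcal H_t^{-1}=H\times H^{-1}\times L^2_{\mu_t}(\mathbb R^+;H),\qquad \|(u,v,\eta)\|_{\mathcal H_t^{-1}}^2=\|u\|^2+\|v\|_{-1}^2+\int_0^\infty\mu_t(s)\|\eta(s)\|^2\,ds.$$ Let $\tau<T$. A *solution* on $[\tau,T]$ with initial datum $z_\tau=(u_\tau,v_\tau,\eta_\tau)\in\mathcal H_\tau$ is a function $z(t)=(u(t),\partial_tu(t),\eta^t)$, with $z(t)\in\mathcal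 H_t$ for a.e. $t\in[\tau,T]$, such that * $u\in L^\infty(\tau,T;H^1)$, $\partial_tu\in L^\infty(\tau,T;H)$, $\partial_{tt}u\in L^1(\tau,T;H^{-1})$ (so that $u$ and $\partial_tu$ are identified with their representatives continuous from $[\tau,T]$ into $H$ and $H^{-1}$, respectively); * $u(\tau)=u_\tau$ and $\partial_tu(\tau)=v_\tau$; * for every $t\in[\tau,T]$ and a.e. $s>0$, $\eta^t(s)=u(t)-u(t-s)$ if $s\le t-\tau$, and $\eta^t(s)=\eta_\tau(s-t+\tau)+u(t)-u_\tau$ if $s>t-\tau$; * for every $\varphi\in H^1$ and a.e. $t\in[\tau,T]$, $$\langle\partial_{tt}u(t),\varphi\rangle+\langle u(t),\varphi\rangle_1+\int_0^\infty\mu_t(s)\langle\eta^t(s),\varphi\rangle_1\,ds+\langle f(u(t)),\varphi\rangle=\langle g,\varphi\rangle.$$ **Proposition.** For every $\tau<T$ and every $R$ there is a constant $C>0$, depending (besides on $\Omega,\mu,f,g$) only on $T,\tau$ and $R$, such that for any two solutions $z_1,z_2$ on $[\tau,T]$ whose initial data have norm at most $R$ in $\mathcal H_\tau$, and for every $t\in[\tau,T]$,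 the difference $z_1(t)-z_2(t)$ belongs to $\mathcal H_t^{-1}$ and $$\|z_1(t)-z_2(t)\|_{\mathcal H_t^{-1}}\le C\,\|z_1(\tau)-z_2(\tau)\|_{\mathcal H_\tau}.$$ In particular, two solutions on $[\tau,T]$ with the same initial datum in $\mathcal H_\tau$ coincide at every $t\in[\tau,T]$. -/

import Mathlib

open MeasureTheory Set Filter Topology
open scoped ENNReal ContDiff InnerProductSpace

noncomputable section

namespace AgingMemory

/-- Three-dimensional Euclidean space. -/
abbrev E3 : Type := EuclideanSpace ℝ (Fin 3)

/-- The open set `Ω` lies locally on one side of its boundary, which is a smooth hypersurface: near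
each boundary point, `Ω` is the sublevel set of a smooth function with nonzero differential there. -/
def HasSmoothBoundary (Ω : Set E3) : Prop :=
  ∀ x ∈ frontier Ω, ∃ U : Set E3, IsOpen U ∧ x ∈ U ∧ ∃ ρ : E3 → ℝ,
    ContDiffOn ℝ ∞ ρ U ∧ fderiv ℝ ρ x ≠ 0 ∧ Ω ∩ U = {y ∈ U | ρ y < 0}

/-! ### Function spaces on `Ω` -/

/-- `L²(Ω)`. -/
abbrev L2 (Ω : Set E3) : Type := Lp ℝ 2 (volume.restrict Ω)

/-- `L²(Ω; ℝ³)`. -/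
abbrev L2vec (Ω : Set E3) : Type := Lp E3 2 (volume.restrict Ω)

/-- The pairs `(φ, ∇φ)` in `L²(Ω) × L²(Ω; ℝ³)`, for `φ` smooth with compact support in `Ω`. -/
def testGraph (Ω : Set E3) : Submodule ℝ (WithLp 2 (L2 Ω × L2vec Ω)) where
  carrier := {p | ∃ φ : E3 → ℝ, ContDiff ℝ ∞ φ ∧ HasCompactSupport φ ∧ tsupport φ ⊆ Ω ∧
    p.fst =ᵐ[volume.restrict Ω] φ ∧ p.snd =ᵐ[volume.restrict Ω] gradient φ}
  zero_mem' := by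
    refine ⟨fun _ => 0, contDiff_const, HasCompactSupport.zero, ?_, ?_, ?_⟩
    · simp [tsupport, Function.support]
    · exact Lp.coeFn_zero _ _ _
    · filter_upwards [Lp.coeFn_zero E3 2 (volume.restrict Ω)] with x hx
      simpa using hx
  add_mem' := by
    rintro p q ⟨φ, h1, h2, h3, h4, h5⟩ ⟨ψ, k1, k2, k3, k4, k5⟩
    refine ⟨φ + ψ, h1.add k1, h2.add k2, ?_, ?_, ?_⟩
    · exact (tsupport_add φ ψ).trans (union_subset h3 k3)
    · filter_upwards [Lp.coeFn_add p.fst q.fst, h4, k4] with x hx ha hb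
      rw [WithLp.add_fst, hx]
      simp [ha, hb]
    · filter_upwards [Lp.coeFn_add p.snd q.snd, h5, k5] with x hx ha hb
      rw [WithLp.add_snd, hx]
      have d1 : DifferentiableAt ℝ φ x := (h1.differentiable (by simp)) x
      have d2 : DifferentiableAt ℝ ψ x := (k1.differentiable (by simp)) x
      simp [ha, hb, gradient, fderiv_add d1 d2]
  smul_mem' := by
    rintro c p ⟨φ, h1, h2, h3, h4, h5⟩
    refine ⟨c • φ, h1.const_smul c, ?_, ?_, ?_, ?_⟩
    · exact h2.smul_left (f := fun _ => c)
    · exact (tsupport_smul_subset_right (fun _ => c) φ).trans h3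
    · filter_upwards [Lp.coeFn_smul c p.fst, h4] with x hx ha
      rw [WithLp.smul_fst, hx]
      simp [ha]
    · filter_upwards [Lp.coeFn_smul c p.snd, h5] with x hx ha
      rw [WithLp.smul_snd, hx]
      have d1 : DifferentiableAt ℝ φ x := (h1.differentiable (by simp)) x
      simp [ha, gradient, fderiv_const_smul d1 c]

/-- `H¹₀(Ω)`: the closure in `H¹` of the smooth functions with compact support in `Ω`. An element is
carried as the pair of a function and its weak gradient; the inherited norm is the full `H¹` norm,
equivalent to the gradient norm `normOne` when `Ω` is bounded. -/
def H10 (Ω : Set E3) : Type := ↥(testGraph Ω).topologicalClosure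

instance (Ω : Set E3) : NormedAddCommGroup (H10 Ω) :=
  inferInstanceAs (NormedAddCommGroup ↥(testGraph Ω).topologicalClosure)

instance (Ω : Set E3) : InnerProductSpace ℝ (H10 Ω) :=
  inferInstanceAs (InnerProductSpace ℝ ↥(testGraph Ω).topologicalClosure)

instance (Ω : Set E3) : CompleteSpace (H10 Ω) :=
  inferInstanceAs (CompleteSpace ↥(testGraph Ω).topologicalClosure)

/-- The inclusion `H¹₀(Ω) ⊂ L²(Ω)`. -/
def toL2 {Ω : Set E3} : H10 Ω →L[ℝ] L2 Ω :=
  ((WithLp.fstL 2 ℝ (L2 Ω) (L2vec Ω)).comp (testGraph Ω).topologicalClosure.subtypeL :)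

/-- The weak gradient. -/
def grad {Ω : Set E3} : H10 Ω →L[ℝ] L2vec Ω :=
  ((WithLp.sndL 2 ℝ (L2 Ω) (L2vec Ω)).comp (testGraph Ω).topologicalClosure.subtypeL :)

/-- The inner product `⟨u, v⟩₁ = ∫_Ω ∇u · ∇v` of `H¹₀(Ω)`. -/
def innerOne {Ω : Set E3} (u v : H10 Ω) : ℝ := ⟪grad u, grad v⟫_ℝ

/-- The norm `‖u‖₁ = ‖∇u‖_{L²}` of `H¹₀(Ω)`. -/
def normOne {Ω : Set E3} (u : H10 Ω) : ℝ := ‖grad u‖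

/-- `H⁻¹(Ω)`, the dual space of `H¹₀(Ω)`. -/
abbrev Hneg (Ω : Set E3) : Type := StrongDual ℝ (H10 Ω)

/-- The inclusion `L²(Ω) ⊂ H⁻¹(Ω)`, `v ↦ (φ ↦ ∫_Ω v φ)`. -/
def toHneg {Ω : Set E3} (v : L2 Ω) : Hneg Ω :=
  (innerSL ℝ v).comp toL2

/-- The norm of `H⁻¹(Ω)` dual to `normOne`. -/
def normNegOne {Ω : Set E3} (l : Hneg Ω) : ℝ :=
  sSup {r | ∃ φ : H10 Ω, normOne φ ≤ 1 ∧ r = |l φ|}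

/-- `lam` is an eigenvalue of `A = -Δ` with homogeneous Dirichlet boundary condition:
`A e = lam e` for some `e ≠ 0`, i.e. `⟨e, φ⟩₁ = lam ⟨e, φ⟩` for all `φ ∈ H¹₀(Ω)`. -/
def IsDirichletEigenvalue (Ω : Set E3) (lam : ℝ) : Prop :=
  ∃ e : H10 Ω, e ≠ 0 ∧ ∀ φ : H10 Ω, innerOne e φ = lam * ⟪toL2 e, toL2 φ⟫_ℝ

/-- The first eigenvalue of `A`. -/
def firstEigenvalue (Ω : Set E3) : ℝ := sInf {lam | IsDirichletEigenvalue Ω lam}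

/-! ### The memory kernel -/

/-- The assumptions on the time-dependent memory kernel `(t, s) ↦ μ_t(s)`, `t ∈ ℝ`, `s > 0`;
the values `μ t s` with `s ≤ 0` play no role. -/
structure IsMemoryKernel (μ : ℝ → ℝ → ℝ) : Prop where
  pos : ∀ t, ∀ s > 0, 0 < μ t s
  antitone : ∀ t, AntitoneOn (μ t) (Ioi 0)
  /-- Absolute continuity on `(0, ∞)` is local, since `μ_t` may be unbounded near zero. -/
  absCont : ∀ t a b, 0 < a → a ≤ b → AbsolutelyContinuousOnInterval (μ t) a b
  summable : ∀ t, IntegrableOn (μ t) (Ioi 0)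
  domination : ∀ τ, ∃ K : ℝ → ℝ, (∀ t ≥ τ, 0 < K t) ∧ (∀ T ≥ τ, IntegrableOn K (Icc τ T)) ∧
    ∀ t ≥ τ, ∀ s > 0, μ t s ≤ K t * μ τ s
  differentiable : ∀ᵐ s ∂volume.restrict (Ioi (0 : ℝ)), Differentiable ℝ (fun t => μ t s)
  locBdd : ∀ Q : Set (ℝ × ℝ), IsCompact Q → Q ⊆ univ ×ˢ Ioi 0 →
    MemLp (fun p : ℝ × ℝ => μ p.1 p.2) ∞ (volume.restrict Q)
  locBdd_deriv : ∀ Q : Set (ℝ × ℝ), IsCompact Q → Q ⊆ univ ×ˢ Ioi 0 →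
    MemLp (fun p : ℝ × ℝ => deriv (fun t => μ t p.2) p.1) ∞ (volume.restrict Q)
  growth : ∃ M : ℝ → ℝ, (∀ t, 0 < M t) ∧ (∀ a b, BddAbove (M '' Icc a b)) ∧
    ∀ t, ∀ᵐ s ∂volume.restrict (Ioi (0 : ℝ)),
      deriv (fun r => μ r s) t + deriv (μ t) s ≤ M t * μ t s

/-- The measure `μ_t(s) ds` on `(0, ∞)`. -/
def memMeasure (μ : ℝ → ℝ → ℝ) (t : ℝ) : Measure ℝ :=
  (volume.restrict (Ioi 0)).withDensity fun s => ENNReal.ofReal (μ t s)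

/-! ### The extended memory spaces -/

/-- Triples `(u, v, η)` with `u ∈ H¹₀(Ω)`, `v ∈ L²(Ω)` and `η : (0, ∞) → H¹₀(Ω)`
(the values of `η` at `s ≤ 0` play no role). -/
abbrev State (Ω : Set E3) : Type := H10 Ω × L2 Ω × (ℝ → H10 Ω)

/-- `z ∈ 𝓗_t = H¹₀ × L² × L²_{μ_t}(ℝ⁺; H¹₀)`. -/
def MemH {Ω : Set E3} (μ : ℝ → ℝ → ℝ) (t : ℝ) (z : State Ω) : Prop :=
  MemLp z.2.2 2 (memMeasure μ t)

/-- The norm of `𝓗_t`. -/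
def normH {Ω : Set E3} (μ : ℝ → ℝ → ℝ) (t : ℝ) (z : State Ω) : ℝ :=
  √(normOne z.1 ^ 2 + ‖z.2.1‖ ^ 2 + ∫ s in Ioi (0 : ℝ), μ t s * normOne (z.2.2 s) ^ 2)

/-- `z ∈ 𝓗_t⁻¹ = L² × H⁻¹ × L²_{μ_t}(ℝ⁺; L²)`. -/
def MemHneg {Ω : Set E3} (μ : ℝ → ℝ → ℝ) (t : ℝ) (z : State Ω) : Prop :=
  MemLp (fun s => toL2 (z.2.2 s)) 2 (memMeasure μ t)

/-- The norm of `𝓗_t⁻¹`. -/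
def normHneg {Ω : Set E3} (μ : ℝ → ℝ → ℝ) (t : ℝ) (z : State Ω) : ℝ :=
  √(‖toL2 z.1‖ ^ 2 + normNegOne (toHneg z.2.1) ^ 2 +
    ∫ s in Ioi (0 : ℝ), μ t s * ‖toL2 (z.2.2 s)‖ ^ 2)

/-! ### Solutions -/

/-- `w` is the weak (distributional) derivative of `u` on `(a, b)`. -/
def HasWeakTimeDeriv {X : Type*} [NormedAddCommGroup X] [NormedSpace ℝ X] (a b : ℝ)
    (u w : ℝ → X) : Prop :=
  IntegrableOn u (Ioo a b) ∧ IntegrableOn w (Ioo a b) ∧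
    ∀ ζ : ℝ → ℝ, ContDiff ℝ ∞ ζ → HasCompactSupport ζ → tsupport ζ ⊆ Ioo a b →
      ∫ t in Ioo a b, deriv ζ t • u t = -∫ t in Ioo a b, ζ t • w t

/-- The past history `η^t(s)` generated by `u` on `[τ, t]` and by the initial datum `z₀`. -/
def history {Ω : Set E3} (τ : ℝ) (z₀ : State Ω) (u : ℝ → H10 Ω) (t s : ℝ) : H10 Ω :=
  if s ≤ t - τ then u t - u (t - s) else z₀.2.2 (s - t + τ) + u t - z₀.1

/-- `z(t) = (u(t), ∂ₜu(t), η^t)` is a solution on `[τ, T]` with initial datum `z₀`. The functions `u`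
and `∂ₜu` are given by their representatives that are continuous into `L²(Ω)` and `H⁻¹(Ω)`; these
take all their values in `H¹₀(Ω)` and `L²(Ω)`. -/
structure IsSolution {Ω : Set E3} (μ : ℝ → ℝ → ℝ) (f : ℝ → ℝ) (g : L2 Ω) (τ T : ℝ)
    (z₀ : State Ω) (z : ℝ → State Ω) : Prop where
  memH : ∀ᵐ t ∂volume.restrict (Icc τ T), MemH μ t (z t)
  u_bdd : MemLp (fun t => (z t).1) ∞ (volume.restrict (Icc τ T))
  v_bdd : MemLp (fun t => (z t).2.1) ∞ (volume.restrict (Icc τ T))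
  u_cont : ContinuousOn (fun t => toL2 (z t).1) (Icc τ T)
  v_cont : ContinuousOn (fun t => toHneg (z t).2.1) (Icc τ T)
  u_deriv : HasWeakTimeDeriv τ T (fun t => toL2 (z t).1) (fun t => (z t).2.1)
  u_init : (z τ).1 = z₀.1
  v_init : (z τ).2.1 = z₀.2.1
  eta_repr : ∀ t ∈ Icc τ T, ∀ᵐ s ∂volume.restrict (Ioi (0 : ℝ)),
    (z t).2.2 s = history τ z₀ (fun r => (z r).1) t s
  /-- There is `∂ₜₜu ∈ L¹(τ, T; H⁻¹)`, and it satisfies the equation. -/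
  equation : ∃ w : ℝ → Hneg Ω, IntegrableOn w (Icc τ T) ∧
    HasWeakTimeDeriv τ T (fun t => toHneg (z t).2.1) w ∧
    ∀ φ : H10 Ω, ∀ᵐ t ∂volume.restrict (Icc τ T),
      w t φ + innerOne (z t).1 φ + (∫ s in Ioi (0 : ℝ), μ t s * innerOne ((z t).2.2 s) φ)
        + (∫ x in Ω, f (toL2 (z t).1 x) * toL2 φ x) = ⟪g, toL2 φ⟫_ℝ

end AgingMemory

end

noncomputable section

namespace AgingMemory

/-! ### The space `H¹₀(Ω)` -/

section

variable {Ω : Set E3}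

theorem inner_H10 (u v : H10 Ω) : ⟪u, v⟫_ℝ = ⟪toL2 u, toL2 v⟫_ℝ + innerOne u v := by
  change ⟪u.1, v.1⟫_ℝ = _
  rw [WithLp.prod_inner_apply]
  rfl

theorem norm_sq_H10 (u : H10 Ω) : ‖u‖ ^ 2 = ‖toL2 u‖ ^ 2 + normOne u ^ 2 := by
  rw [← real_inner_self_eq_norm_sq, inner_H10, innerOne, normOne, real_inner_self_eq_norm_sq,
    real_inner_self_eq_norm_sq]

theorem H10.ext_pair {u v : H10 Ω} (h : toL2 u = toL2 v) (h' : grad u = grad v) : u = v := by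
  have : ‖u - v‖ ^ 2 = 0 := by
    rw [norm_sq_H10, normOne, map_sub, map_sub, h, h']
    simp
  exact sub_eq_zero.1 (norm_eq_zero.1 (pow_eq_zero_iff (two_ne_zero)|>.1 this))

/-- `u ∈ H¹₀(Ω)` is the class of the test function `φ`. -/
structure IsTest (u : H10 Ω) (φ : E3 → ℝ) : Prop where
  smooth : ContDiff ℝ ∞ φ
  compact : HasCompactSupport φ
  supp : tsupport φ ⊆ Ω
  toL2_eq : toL2 u =ᵐ[volume.restrict Ω] φ
  grad_eq : grad u =ᵐ[volume.restrict Ω] gradient φ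

theorem H10.induction {P : H10 Ω → Prop} (hc : IsClosed {u | P u})
    (ht : ∀ u φ, IsTest u φ → P u) (u : H10 Ω) : P u := by
  have hu : u.1 ∈ closure (testGraph Ω : Set (WithLp 2 (L2 Ω × L2vec Ω))) := u.2
  obtain ⟨p, hp, hpu⟩ := mem_closure_iff_seq_limit.1 hu
  let q : ℕ → H10 Ω := fun n => ⟨p n, (testGraph Ω).le_topologicalClosure (hp n)⟩
  have hq : Tendsto q atTop (𝓝 u) := tendsto_subtype_rng.2 hpu
  refine hc.mem_of_tendsto hq (Eventually.of_forall fun n => ?_)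
  obtain ⟨φ, h1, h2, h3, h4, h5⟩ := hp n
  exact ht (q n) φ ⟨h1, h2, h3, h4, h5⟩

theorem exists_isTest {φ : E3 → ℝ} (h1 : ContDiff ℝ ∞ φ) (h2 : HasCompactSupport φ)
    (h3 : tsupport φ ⊆ Ω) : ∃ u : H10 Ω, IsTest u φ := by
  have hg : Continuous (gradient φ) := by
    unfold gradient
    exact (InnerProductSpace.toDual ℝ E3).symm.continuous.comp
      (h1.continuous_fderiv (by simp))
  have hgs : HasCompactSupport (gradient φ) := by
    refine (h2.fderiv (𝕜 := ℝ)).mono fun x hx => ?_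
    simp only [gradient, Function.mem_support, ne_eq] at hx ⊢
    intro h
    exact hx (by rw [h, map_zero])
  have m1 : MemLp φ 2 (volume.restrict Ω) :=
    (h1.continuous.memLp_of_hasCompactSupport h2).restrict _
  have m2 : MemLp (gradient φ) 2 (volume.restrict Ω) :=
    (hg.memLp_of_hasCompactSupport hgs).restrict _
  refine ⟨⟨WithLp.toLp 2 (m1.toLp φ, m2.toLp _),
    (testGraph Ω).le_topologicalClosure ⟨φ, h1, h2, h3, m1.coeFn_toLp, m2.coeFn_toLp⟩⟩,
    h1, h2, h3, m1.coeFn_toLp, m2.coeFn_toLp⟩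

theorem gradient_inner (φ : E3 → ℝ) (x e : E3) : ⟪gradient φ x, e⟫_ℝ = fderiv ℝ φ x e := by
  simp [gradient]

/-- Integration by parts in `H¹₀(Ω)`. -/
theorem integral_by_parts (u : H10 Ω) {ψ : E3 → ℝ} (h1 : ContDiff ℝ ∞ ψ)
    (h2 : HasCompactSupport ψ) (e : E3) :
    ∫ x in Ω, toL2 u x * fderiv ℝ ψ x e = - ∫ x in Ω, ⟪grad u x, e⟫_ℝ * ψ x := by
  have hd : Continuous fun x => fderiv ℝ ψ x e :=
    (h1.continuous_fderiv (by simp)).clm_apply continuous_const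
  have hds : HasCompactSupport fun x => fderiv ℝ ψ x e := h2.fderiv_apply (𝕜 := ℝ) e
  have m1 : MemLp (fun x => fderiv ℝ ψ x e) 2 (volume.restrict Ω) :=
    (hd.memLp_of_hasCompactSupport hds).restrict _
  have m2 : MemLp (fun x => ψ x • e) 2 (volume.restrict Ω) :=
    ((h1.continuous.smul continuous_const).memLp_of_hasCompactSupport h2.smul_right).restrict _
  have e1 : ∀ u : H10 Ω, ∫ x in Ω, toL2 u x * fderiv ℝ ψ x e = ⟪m1.toLp _, toL2 u⟫_ℝ := by
    intro u
    rw [L2.inner_def]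
    refine integral_congr_ae ?_
    filter_upwards [m1.coeFn_toLp] with x hx
    rw [hx]; simp 
  have e2 : ∀ u : H10 Ω, ∫ x in Ω, ⟪grad u x, e⟫_ℝ * ψ x = ⟪m2.toLp _, grad u⟫_ℝ := by
    intro u
    rw [L2.inner_def]
    refine integral_congr_ae ?_
    filter_upwards [m2.coeFn_toLp] with x hx
    rw [hx, real_inner_smul_left, real_inner_comm, mul_comm]
  refine H10.induction (P := fun u => ∫ x in Ω, toL2 u x * fderiv ℝ ψ x e
    = - ∫ x in Ω, ⟪grad u x, e⟫_ℝ * ψ x) ?_ ?_ u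
  · simp_rw [e1, e2]
    exact isClosed_eq (by fun_prop) (by fun_prop)
  · intro u φ hφ
    have a1 : ∫ x in Ω, toL2 u x * fderiv ℝ ψ x e = ∫ x, φ x * fderiv ℝ ψ x e := by
      rw [← setIntegral_eq_integral_of_forall_compl_eq_zero (s := Ω) (f :=
          fun x => φ x * fderiv ℝ ψ x e)]
      · refine integral_congr_ae ?_
        filter_upwards [hφ.toL2_eq] with x hx
        rw [hx]
      · intro x hx
        rw [image_eq_zero_of_notMem_tsupport fun h => hx (hφ.supp h), zero_mul]
    have a2 : ∫ x in Ω, ⟪grad u x, e⟫_ℝ * ψ x = ∫ x, fderiv ℝ φ x e * ψ x := by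
      rw [← setIntegral_eq_integral_of_forall_compl_eq_zero (s := Ω) (f :=
          fun x => fderiv ℝ φ x e * ψ x)]
      · refine integral_congr_ae ?_
        filter_upwards [hφ.grad_eq] with x hx
        rw [hx, gradient_inner]
      · intro x hx
        have : x ∉ tsupport (fderiv ℝ φ) := fun h => hx (hφ.supp (tsupport_fderiv_subset (𝕜 := ℝ)
            (f := φ) h))
        rw [image_eq_zero_of_notMem_tsupport this]
        simp
    have hdφ : Continuous fun x => fderiv ℝ φ x e :=
      (hφ.smooth.continuous_fderiv (by simp)).clm_apply continuous_const
    rw [a1, a2]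
    refine integral_mul_fderiv_eq_neg_fderiv_mul_of_integrable ?_ ?_ ?_ ?_ ?_
    · exact (hdφ.mul h1.continuous).integrable_of_hasCompactSupport h2.mul_left
    · exact (hφ.smooth.continuous.mul hd).integrable_of_hasCompactSupport hds.mul_left
    · exact (hφ.smooth.continuous.mul h1.continuous).integrable_of_hasCompactSupport h2.mul_left
    · exact fun x _ => hφ.smooth.differentiable (by simp) x
    · exact fun x _ => h1.differentiable (by simp) x

theorem ae_eq_zero_of_integral_test (hΩ : IsOpen Ω) {w : E3 → ℝ}
    (hw : MemLp w 2 (volume.restrict Ω))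
    (h : ∀ ψ : E3 → ℝ, ContDiff ℝ ∞ ψ → HasCompactSupport ψ → tsupport ψ ⊆ Ω →
      ∫ x in Ω, w x * ψ x = 0) : ∀ᵐ x ∂volume.restrict Ω, w x = 0 := by
  rw [ae_restrict_iff' hΩ.measurableSet]
  refine hΩ.ae_eq_zero_of_integral_contDiff_smul_eq_zero
    (locallyIntegrableOn_of_locallyIntegrable_restrict
      (hw.locallyIntegrable (by norm_num))) fun ψ h1 h2 h3 => ?_
  rw [← h ψ h1 h2 h3, ← setIntegral_eq_integral_of_forall_compl_eq_zero (s := Ω)]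
  · simp [mul_comm]
  · intro x hx
    rw [image_eq_zero_of_notMem_tsupport fun h => hx (h3 h), zero_smul]

theorem toL2_injective (hΩ : IsOpen Ω) : Function.Injective (toL2 : H10 Ω → L2 Ω) := by
  refine (injective_iff_map_eq_zero (toL2 (Ω := Ω))).2 fun u hu => H10.ext_pair (by simp [hu]) ?_
  rw [map_zero]
  have key : ∀ e : E3, ∀ᵐ x ∂volume.restrict Ω, ⟪grad u x, e⟫_ℝ = 0 := by
    intro e
    refine ae_eq_zero_of_integral_test hΩ ((Lp.memLp (grad u)).inner_const (𝕜 := ℝ) e)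
      fun ψ h1 h2 h3 => ?_
    have h4 := integral_by_parts u h1 h2 e
    have h5 : ∫ x in Ω, toL2 u x * fderiv ℝ ψ x e = 0 := by
      rw [hu]
      refine integral_eq_zero_of_ae ?_
      filter_upwards [Lp.coeFn_zero ℝ 2 (volume.restrict Ω)] with x hx
      rw [hx]; simp
    linarith
  have key' : ∀ᵐ x ∂volume.restrict Ω, ∀ i : Fin 3,
      ⟪grad u x, EuclideanSpace.single i (1 : ℝ)⟫_ℝ = 0 := ae_all_iff.2 fun i => key _
  rw [Lp.eq_zero_iff_ae_eq_zero]
  filter_upwards [key'] with x hx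
  ext i
  simpa [EuclideanSpace.inner_single_right] using hx i

theorem toL2_denseRange (hΩ : IsOpen Ω) : DenseRange (toL2 : H10 Ω → L2 Ω) := by
  have h : (LinearMap.range (toL2 (Ω := Ω)).toLinearMap).topologicalClosure = ⊤ := by
    rw [Submodule.topologicalClosure_eq_top_iff, Submodule.eq_bot_iff]
    intro w hw
    rw [Lp.eq_zero_iff_ae_eq_zero]
    refine ae_eq_zero_of_integral_test hΩ (Lp.memLp w) fun ψ h1 h2 h3 => ?_
    obtain ⟨u, hu⟩ := exists_isTest h1 h2 h3
    have h4 := (Submodule.mem_orthogonal _ _).1 hw (toL2 u) ⟨u, rfl⟩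
    rw [L2.inner_def] at h4
    rw [← h4]
    refine integral_congr_ae ?_
    filter_upwards [hu.toL2_eq] with x hx
    rw [hx]; simp
  rw [DenseRange, dense_iff_closure_eq]
  exact congrArg (fun S : Submodule ℝ (L2 Ω) => (S : Set (L2 Ω))) h

theorem toHneg_apply (v : L2 Ω) (φ : H10 Ω) : toHneg v φ = ⟪v, toL2 φ⟫_ℝ := rfl

theorem eq_zero_of_toHneg_eq_zero (hΩ : IsOpen Ω) {v : L2 Ω} (h : ∀ φ : H10 Ω, toHneg v φ = 0) :
    v = 0 := by
  exact (toL2_denseRange hΩ).eq_zero_of_inner_left (𝕜 := ℝ) h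

theorem norm_gradient (φ : E3 → ℝ) (x : E3) : ‖gradient φ x‖ = ‖fderiv ℝ φ x‖ := by
  simp [gradient]

/-- The Sobolev inequality `‖u‖_{L⁶} ≤ C ‖∇u‖_{L²}` in `H¹₀(Ω)`. -/
theorem exists_sobolev (Ω : Set E3) : ∃ C > 0, ∀ u : H10 Ω,
    eLpNorm (toL2 u) 6 (volume.restrict Ω) ≤ ENNReal.ofReal (C * normOne u) := by
  let C : ℝ := SNormLESNormFDerivOfEqConst ℝ (volume : Measure E3) 2
  refine ⟨C + 1, by positivity, fun u => ?_⟩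
  refine H10.induction (P := fun u => eLpNorm (toL2 u) 6 (volume.restrict Ω) ≤
    ENNReal.ofReal ((C + 1) * normOne u)) ?_ ?_ u
  · refine IsSeqClosed.isClosed fun v u hv hu => ?_
    have h1 : Tendsto (fun n => toL2 (v n)) atTop (𝓝 (toL2 u)) :=
        (toL2.continuous.tendsto u).comp hu
    obtain ⟨ns, hns, hlim⟩ := (tendstoInMeasure_of_tendsto_Lp h1).exists_seq_tendsto_ae
    have h2 := Lp.eLpNorm_lim_le_liminf_eLpNorm (p := 6)
      (fun n => (Lp.aestronglyMeasurable (toL2 (v (ns n))))) _ hlim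
    refine h2.trans ?_
    have h3 : Tendsto (fun n => ENNReal.ofReal ((C + 1) * normOne (v (ns n)))) atTop
        (𝓝 (ENNReal.ofReal ((C + 1) * normOne u))) := by
      refine ENNReal.tendsto_ofReal (Tendsto.const_mul _ ?_)
      have : Continuous (fun u : H10 Ω => normOne u) := by unfold normOne; fun_prop
      exact ((this.tendsto u).comp hu).comp hns.tendsto_atTop
    rw [← h3.liminf_eq]
    exact liminf_le_liminf (Eventually.of_forall fun n => hv (ns n))
  · intro u φ hφ
    have h := eLpNorm_le_eLpNorm_fderiv_of_eq (F := ℝ) (volume : Measure E3) (u := φ)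
      (hφ.smooth.of_le (by simp)) hφ.compact (p := 2) (p' := 6) (by norm_num)
      (by simp) (by simp; norm_num)
    have h1 : eLpNorm (toL2 u) 6 (volume.restrict Ω) = eLpNorm φ 6 volume := by
      rw [eLpNorm_congr_ae hφ.toL2_eq, eLpNorm_restrict_eq_of_support_subset]
      exact (subset_tsupport φ).trans hφ.supp
    have h2 : eLpNorm (fderiv ℝ φ) 2 volume = ENNReal.ofReal (normOne u) := by
      rw [normOne, Lp.norm_def, ENNReal.ofReal_toReal (Lp.eLpNorm_ne_top _),
        eLpNorm_congr_ae hφ.grad_eq, ← eLpNorm_restrict_eq_of_support_subset (s := Ω)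
          (f := fderiv ℝ φ)]
      · exact eLpNorm_congr_norm_ae (Eventually.of_forall fun x => (norm_gradient φ x).symm)
      · exact (subset_tsupport _).trans ((tsupport_fderiv_subset ℝ).trans hφ.supp)
    rw [h1]
    refine h.trans ?_
    push_cast
    rw [h2, ENNReal.ofReal_mul (by positivity)]
    gcongr
    rw [ENNReal.ofReal_add (by positivity) zero_le_one]
    simp [C]

theorem normOne_nonneg (u : H10 Ω) : 0 ≤ normOne u := norm_nonneg _

/-- The Poincaré inequality. -/
theorem exists_poincare (hb : Bornology.IsBounded Ω) : ∃ C > 0, ∀ u : H10 Ω,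
    ‖toL2 u‖ ≤ C * normOne u := by
  obtain ⟨C, hC, h⟩ := exists_sobolev Ω
  have hfin : volume Ω ≠ ⊤ := hb.measure_lt_top.ne
  set m : ℝ≥0∞ := volume Ω ^ (1 / (2 : ℝ≥0∞).toReal - 1 / (6 : ℝ≥0∞).toReal) with hm
  have hmt : m ≠ ⊤ := by
    rw [hm]; exact ENNReal.rpow_ne_top_of_nonneg (by norm_num) hfin
  refine ⟨C * (m.toReal + 1), by positivity, fun u => ?_⟩
  have h1 := eLpNorm_le_eLpNorm_mul_rpow_measure_univ (p := 2) (q := 6) (μ := volume.restrict Ω)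
    (by norm_num) (Lp.aestronglyMeasurable (toL2 u))
  rw [Measure.restrict_apply_univ, ← hm] at h1
  rw [Lp.norm_def]
  have h2 := h1.trans (mul_le_mul_left (h u) m)
  have h3 := ENNReal.toReal_mono (ENNReal.mul_ne_top ENNReal.ofReal_ne_top hmt) h2
  refine h3.trans ?_
  have := normOne_nonneg u
  rw [ENNReal.toReal_mul, ENNReal.toReal_ofReal (by positivity)]
  nlinarith [mul_nonneg hC.le this]

end

/-! ### The Rellich theorem and the first eigenvalue -/

section

variable {Ω : Set E3}

theorem sq_intervalIntegral_le {a : ℝ → ℝ} (ha : Continuous a) :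
    (∫ t in (0 : ℝ)..1, a t) ^ 2 ≤ ∫ t in (0 : ℝ)..1, a t ^ 2 := by
  set A := ∫ t in (0 : ℝ)..1, a t with hA
  have h : 0 ≤ ∫ t in (0 : ℝ)..1, (a t - A) ^ 2 :=
    intervalIntegral.integral_nonneg zero_le_one fun t _ => sq_nonneg _
  have e : ∫ t in (0 : ℝ)..1, (a t - A) ^ 2 = (∫ t in (0 : ℝ)..1, a t ^ 2) - A ^ 2 := by
    have : ∀ t, (a t - A) ^ 2 = (a t ^ 2 - 2 * A * a t) + A ^ 2 := fun t => by ring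
    simp_rw [this]
    rw [intervalIntegral.integral_add, intervalIntegral.integral_sub,
      intervalIntegral.integral_const_mul, ← hA]
    · simp; ring
    all_goals exact Continuous.intervalIntegrable (by fun_prop) _ _
  linarith

theorem sq_translate_sub_le {φ : E3 → ℝ} (hφ : ContDiff ℝ 1 φ) (x h : E3) :
    (φ (x + h) - φ x) ^ 2 ≤ ‖h‖ ^ 2 * ∫ t in (0 : ℝ)..1, ‖fderiv ℝ φ (x + t • h)‖ ^ 2 := by
  have hc : Continuous (fderiv ℝ φ) := hφ.continuous_fderiv (by simp)
  have hd : ∀ t : ℝ, HasDerivAt (fun t : ℝ => φ (x + t • h)) (fderiv ℝ φ (x + t • h) h) t := by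
    intro t
    have h1 : HasDerivAt (fun t : ℝ => x + t • h) h t := by
      simpa using ((hasDerivAt_id t).smul_const h).const_add x
    exact ((hφ.differentiable (by simp)) _).hasFDerivAt.comp_hasDerivAt t h1
  have hcont : Continuous fun t : ℝ => fderiv ℝ φ (x + t • h) := hc.comp (by fun_prop)
  have e := intervalIntegral.integral_eq_sub_of_hasDerivAt (a := 0) (b := 1) (fun t _ => hd t)
    ((hcont.clm_apply continuous_const).intervalIntegrable _ _)
  simp only [one_smul, zero_smul, add_zero] at e
  rw [← e, ← intervalIntegral.integral_const_mul]
  refine (sq_intervalIntegral_le (hcont.clm_apply continuous_const)).trans ?_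
  refine intervalIntegral.integral_mono_on zero_le_one
    (Continuous.intervalIntegrable (by fun_prop) _ _)
    (Continuous.intervalIntegrable (by fun_prop) _ _) fun t _ => ?_
  rw [← mul_pow, ← sq_abs, mul_comm]
  have := (fderiv ℝ φ (x + t • h)).le_opNorm h
  rw [Real.norm_eq_abs] at this
  gcongr

theorem lintegral_sq_translate_sub_le {φ : E3 → ℝ} (hφ : ContDiff ℝ 1 φ) (h : E3) :
    ∫⁻ x, ENNReal.ofReal ((φ (x + h) - φ x) ^ 2) ≤
      ENNReal.ofReal (‖h‖ ^ 2) * ∫⁻ x, ENNReal.ofReal (‖fderiv ℝ φ x‖ ^ 2) := by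
  have hc : Continuous (fderiv ℝ φ) := hφ.continuous_fderiv (by simp)
  calc ∫⁻ x, ENNReal.ofReal ((φ (x + h) - φ x) ^ 2)
      ≤ ∫⁻ x, ENNReal.ofReal (‖h‖ ^ 2) *
          ∫⁻ t in Ioc (0 : ℝ) 1, ENNReal.ofReal (‖fderiv ℝ φ (x + t • h)‖ ^ 2) := by
        refine lintegral_mono fun x => ?_
        have hcont : Continuous fun t : ℝ => ‖fderiv ℝ φ (x + t • h)‖ ^ 2 := by fun_prop
        rw [← ofReal_integral_eq_lintegral_ofReal
          ((intervalIntegrable_iff_integrableOn_Ioc_of_le zero_le_one).1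
            (hcont.intervalIntegrable _ _)) (Eventually.of_forall fun t => by positivity),
          ← ENNReal.ofReal_mul (by positivity), ← intervalIntegral.integral_of_le zero_le_one]
        exact ENNReal.ofReal_le_ofReal (sq_translate_sub_le hφ x h)
    _ = ENNReal.ofReal (‖h‖ ^ 2) * ∫⁻ t in Ioc (0 : ℝ) 1, ∫⁻ x,
          ENNReal.ofReal (‖fderiv ℝ φ (x + t • h)‖ ^ 2) := by
        have hm : Measurable fun p : E3 × ℝ => ENNReal.ofReal (‖fderiv ℝ φ (p.1 + p.2 • h)‖ ^ 2) :=
          ENNReal.measurable_ofReal.comp (Continuous.measurable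
            (f := fun p : E3 × ℝ => ‖fderiv ℝ φ (p.1 + p.2 • h)‖ ^ 2) (by fun_prop))
        rw [lintegral_const_mul _ hm.lintegral_prod_right', lintegral_lintegral_swap]
        exact hm.aemeasurable
    _ = _ := by
        congr 1
        have : ∀ t : ℝ, ∫⁻ x, ENNReal.ofReal (‖fderiv ℝ φ (x + t • h)‖ ^ 2) =
            ∫⁻ x, ENNReal.ofReal (‖fderiv ℝ φ x‖ ^ 2) := fun t =>
          lintegral_add_right_eq_self (fun x => ENNReal.ofReal (‖fderiv ℝ φ x‖ ^ 2)) (t • h)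
        simp_rw [this]
        simp

theorem integral_integral_sub_sq {α : Type*} [MeasurableSpace α] {ν : Measure α}
    [IsFiniteMeasure ν] {φ : α → ℝ} (h1 : Integrable φ ν) (h2 : Integrable (fun x => φ x ^ 2) ν) :
    ∫ x, ∫ y, (φ x - φ y) ^ 2 ∂ν ∂ν =
      2 * ν.real univ * (∫ x, φ x ^ 2 ∂ν) - 2 * (∫ x, φ x ∂ν) ^ 2 := by
  have e : ∀ x, ∫ y, (φ x - φ y) ^ 2 ∂ν =
      ν.real univ * φ x ^ 2 - 2 * (∫ y, φ y ∂ν) * φ x + ∫ y, φ y ^ 2 ∂ν := by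
    intro x
    have : ∀ y, (φ x - φ y) ^ 2 = φ x ^ 2 - 2 * φ x * φ y + φ y ^ 2 := fun y => by ring
    simp_rw [this]
    rw [integral_add (f := fun y => φ x ^ 2 - 2 * φ x * φ y)
        ((integrable_const _).sub (h1.const_mul _)) h2,
      integral_sub (integrable_const _) (h1.const_mul _), integral_const_mul, integral_const]
    simp; ring
  simp_rw [e]
  rw [integral_add (f := fun x => ν.real univ * φ x ^ 2 - 2 * (∫ y, φ y ∂ν) * φ x)
      ((h2.const_mul _).sub (h1.const_mul _)) (integrable_const _),
    integral_sub (h2.const_mul _) (h1.const_mul _), integral_const_mul, integral_const_mul,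
    integral_const]
  simp; ring

theorem ofReal_integral_le_lintegral_ofReal {α : Type*} [MeasurableSpace α] {ν : Measure α}
    {a : α → ℝ} (ha : ∀ x, 0 ≤ a x) :
    ENNReal.ofReal (∫ x, a x ∂ν) ≤ ∫⁻ x, ENNReal.ofReal (a x) ∂ν := by
  by_cases h : Integrable a ν
  · exact (ofReal_integral_eq_lintegral_ofReal h (Eventually.of_forall ha)).le
  · simp [integral_undef h]

theorem sum_cells_sub_sq_le {ι : Type*} (J : Finset ι) (Q : ι → Set E3)
    (hQm : ∀ j, MeasurableSet (Q j)) (hQd : Pairwise fun i j => Disjoint (Q i) (Q j)) {r : ℝ}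
    (hQr : ∀ j, ∀ x ∈ Q j, ∀ y ∈ Q j, dist x y < r)
    {φ : E3 → ℝ} (hφ : ContDiff ℝ 1 φ) (hφc : Continuous φ)
    (i3 : Integrable fun x => ‖fderiv ℝ φ x‖ ^ 2) :
    ∑ j ∈ J, ∫ x in Q j, ∫ y in Q j, (φ x - φ y) ^ 2 ≤
      (volume : Measure E3).real (Metric.ball 0 r) * r ^ 2 * ∫ x, ‖fderiv ℝ φ x‖ ^ 2 := by
  have k0 : 0 ≤ (volume : Measure E3).real (Metric.ball 0 r) * r ^ 2 *
      ∫ x, ‖fderiv ℝ φ x‖ ^ 2 :=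
    mul_nonneg (by positivity) (integral_nonneg fun x => by positivity)
  refine (ENNReal.ofReal_le_ofReal_iff k0).1 ?_
  rw [ENNReal.ofReal_sum_of_nonneg fun j _ => integral_nonneg fun x =>
    integral_nonneg fun y => sq_nonneg _]
  have hcm : Measurable fun p : E3 × E3 => ENNReal.ofReal ((φ (p.1 + p.2) - φ p.1) ^ 2) :=
    ENNReal.measurable_ofReal.comp (Continuous.measurable
      (f := fun p : E3 × E3 => (φ (p.1 + p.2) - φ p.1) ^ 2) (by fun_prop))
  have step : ∀ j ∈ J, ENNReal.ofReal (∫ x in Q j, ∫ y in Q j, (φ x - φ y) ^ 2) ≤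
      ∫⁻ x in Q j, ∫⁻ h in Metric.ball (0 : E3) r,
        ENNReal.ofReal ((φ (x + h) - φ x) ^ 2) := by
    intro j _
    refine (ofReal_integral_le_lintegral_ofReal fun x => integral_nonneg fun y =>
      sq_nonneg _).trans (setLIntegral_mono' (hQm j) fun x hx => ?_)
    refine (ofReal_integral_le_lintegral_ofReal fun y => sq_nonneg _).trans ?_
    have hsubset : Q j ⊆ (fun y => y - x) ⁻¹' Metric.ball (0 : E3) r := fun y hy => by
      simpa [dist_eq_norm] using hQr j y hy x hx
    refine (lintegral_mono_set hsubset).trans_eq ?_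
    have := (measurePreserving_sub_right (volume : Measure E3) x).setLIntegral_comp_preimage
      (s := Metric.ball (0 : E3) r) measurableSet_ball
      (f := fun h => ENNReal.ofReal ((φ (x + h) - φ x) ^ 2))
      (hcm.comp measurable_prodMk_left)
    rw [← this]
    refine lintegral_congr fun y => ?_
    rw [add_sub_cancel, ← neg_sub, neg_sq]
  refine (Finset.sum_le_sum step).trans ?_
  rw [← lintegral_biUnion_finset (fun i _ j _ h => hQd h) (fun j _ => hQm j)]
  refine (setLIntegral_le_lintegral _ _).trans ?_
  rw [lintegral_lintegral_swap hcm.aemeasurable]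
  calc ∫⁻ h in Metric.ball (0 : E3) r, ∫⁻ x, ENNReal.ofReal ((φ (x + h) - φ x) ^ 2)
      ≤ ∫⁻ h in Metric.ball (0 : E3) r, ENNReal.ofReal (r ^ 2) *
          ∫⁻ x, ENNReal.ofReal (‖fderiv ℝ φ x‖ ^ 2) := by
        refine setLIntegral_mono' measurableSet_ball fun h hh => ?_
        refine (lintegral_sq_translate_sub_le hφ h).trans ?_
        have : ‖h‖ ≤ r := (mem_ball_zero_iff.1 hh).le
        gcongr
    _ = _ := by
        rw [setLIntegral_const, ← ofReal_integral_eq_lintegral_ofReal i3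
          (Eventually.of_forall fun x => by positivity), ENNReal.ofReal_mul (by positivity),
          ENNReal.ofReal_mul (by positivity), ofReal_measureReal]
        ring

theorem cells_inequality {ι : Type*} (J : Finset ι) (Q : ι → Set E3)
    (hQm : ∀ j, MeasurableSet (Q j)) (hQd : Pairwise fun i j => Disjoint (Q i) (Q j))
    {m r : ℝ} (hQv : ∀ j, volume (Q j) = ENNReal.ofReal m) (hm : 0 ≤ m)
    (hQr : ∀ j, ∀ x ∈ Q j, ∀ y ∈ Q j, dist x y < r)
    {φ : E3 → ℝ} (hφ : ContDiff ℝ 1 φ) (hc : HasCompactSupport φ)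
    (hsub : Function.support φ ⊆ ⋃ j ∈ J, Q j) :
    2 * m * ∫ x, φ x ^ 2 ≤ 2 * ∑ j ∈ J, (∫ x in Q j, φ x) ^ 2 +
      (volume : Measure E3).real (Metric.ball 0 r) * r ^ 2 * ∫ x, ‖fderiv ℝ φ x‖ ^ 2 := by
  have hφc : Continuous φ := hφ.continuous
  have i1 : Integrable φ := hφc.integrable_of_hasCompactSupport hc
  have i2 : Integrable fun x => φ x ^ 2 := by
    simp_rw [sq]
    exact (hφc.mul hφc).integrable_of_hasCompactSupport hc.mul_left
  have hdc : Continuous (fderiv ℝ φ) := hφ.continuous_fderiv (by simp)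
  have i3 : Integrable fun x => ‖fderiv ℝ φ x‖ ^ 2 := by
    have hn : HasCompactSupport fun x => ‖fderiv ℝ φ x‖ := (hc.fderiv (𝕜 := ℝ)).norm
    simp_rw [sq]
    exact (hdc.norm.mul hdc.norm).integrable_of_hasCompactSupport hn.mul_left
  have e1 : ∫ x, φ x ^ 2 = ∑ j ∈ J, ∫ x in Q j, φ x ^ 2 := by
    rw [← integral_biUnion_finset J (fun j _ => hQm j) (fun i _ j _ h => hQd h)
      (fun j _ => i2.integrableOn)]
    refine (setIntegral_eq_integral_of_forall_compl_eq_zero fun x hx => ?_).symm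
    have : φ x = 0 := by
      by_contra h; exact hx (hsub h)
    simp [this]
  have hfin : ∀ j, IsFiniteMeasure (volume.restrict (Q j)) := fun j =>
    ⟨by rw [Measure.restrict_apply_univ, hQv]; exact ENNReal.ofReal_lt_top⟩
  have e2 : ∀ j, 2 * m * ∫ x in Q j, φ x ^ 2 = 2 * (∫ x in Q j, φ x) ^ 2 +
      ∫ x in Q j, ∫ y in Q j, (φ x - φ y) ^ 2 := by
    intro j
    have := hfin j
    rw [integral_integral_sub_sq i1.integrableOn i2.integrableOn]
    simp [Measure.real, hQv, ENNReal.toReal_ofReal hm]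
  have key := sum_cells_sub_sq_le J Q hQm hQd hQr hφ hφc i3
  have e3 : 2 * m * ∫ x, φ x ^ 2 = ∑ j ∈ J, (2 * (∫ x in Q j, φ x) ^ 2 +
      ∫ x in Q j, ∫ y in Q j, (φ x - φ y) ^ 2) := by
    rw [e1, Finset.mul_sum]
    exact Finset.sum_congr rfl fun j _ => e2 j
  rw [e3, Finset.sum_add_distrib, ← Finset.mul_sum]
  exact add_le_add_right key _

/-- The half-open cube of side `δ` with corner `δ j`. -/
def cube (δ : ℝ) (j : Fin 3 → ℤ) : Set E3 :=
  {x | ∀ i, x i ∈ Ico (δ * j i) (δ * (j i + 1))}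

theorem cube_eq (δ : ℝ) (j : Fin 3 → ℤ) :
    cube δ j = (WithLp.ofLp : E3 → Fin 3 → ℝ) ⁻¹'
      (pi univ fun i => Ico (δ * j i) (δ * (j i + 1))) := by
  ext x; simp [cube]

theorem measurableSet_cube (δ : ℝ) (j : Fin 3 → ℤ) : MeasurableSet (cube δ j) := by
  rw [cube_eq]
  exact (PiLp.volume_preserving_ofLp (Fin 3)).measurable
    (MeasurableSet.univ_pi fun i => measurableSet_Ico)

theorem volume_cube {δ : ℝ} (hδ : 0 ≤ δ) (j : Fin 3 → ℤ) :
    volume (cube δ j) = ENNReal.ofReal (δ ^ 3) := by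
  rw [cube_eq, (PiLp.volume_preserving_ofLp (Fin 3)).measure_preimage
    (MeasurableSet.univ_pi fun i => measurableSet_Ico).nullMeasurableSet, Real.volume_pi_Ico]
  have : ∀ i, δ * ((j i : ℝ) + 1) - δ * j i = δ := fun i => by ring
  simp_rw [this]
  simp [ENNReal.ofReal_pow hδ]

theorem mem_cube_iff {δ : ℝ} (hδ : 0 < δ) {j : Fin 3 → ℤ} {x : E3} :
    x ∈ cube δ j ↔ ∀ i, ⌊x i / δ⌋ = j i := by
  refine forall_congr' fun i => ?_
  rw [Int.floor_eq_iff, le_div_iff₀ hδ, div_lt_iff₀ hδ, mem_Ico, mul_comm, mul_comm (_ + _)]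

theorem pairwise_disjoint_cube {δ : ℝ} (hδ : 0 < δ) :
    Pairwise fun i j => Disjoint (cube δ i) (cube δ j) := by
  intro i j hij
  refine Set.disjoint_left.2 fun x hx hy => hij (funext fun k => ?_)
  rw [← (mem_cube_iff hδ).1 hx k, (mem_cube_iff hδ).1 hy k]

theorem dist_lt_of_mem_cube {δ : ℝ} (hδ : 0 < δ) (j : Fin 3 → ℤ) (x : E3) (hx : x ∈ cube δ j)
    (y : E3) (hy : y ∈ cube δ j) : dist x y < 2 * δ := by
  rw [EuclideanSpace.dist_eq, Real.sqrt_lt' (by positivity)]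
  have h : ∀ i, dist (x i) (y i) ^ 2 ≤ δ ^ 2 := by
    intro i
    have h1 := hx i
    have h2 := hy i
    rw [Real.dist_eq, sq_abs]
    simp only [mem_Ico, mul_add, mul_one] at h1 h2
    refine sq_le_sq' ?_ ?_ <;> linarith
  calc ∑ i, dist (x i) (y i) ^ 2 ≤ ∑ _i : Fin 3, δ ^ 2 := Finset.sum_le_sum fun i _ => h i
    _ < (2 * δ) ^ 2 := by simp; nlinarith [sq_pos_of_pos hδ]

theorem exists_finset_cubes (hb : Bornology.IsBounded Ω) {δ : ℝ} (hδ : 0 < δ) :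
    ∃ J : Finset (Fin 3 → ℤ), Ω ⊆ ⋃ j ∈ J, cube δ j := by
  obtain ⟨R, hR⟩ := hb.exists_norm_le
  set N : ℤ := ⌈R / δ⌉ + 1
  refine ⟨Fintype.piFinset fun _ => Finset.Icc (-N) N, fun x hx => ?_⟩
  refine mem_iUnion₂.2 ⟨fun i => ⌊x i / δ⌋, ?_, (mem_cube_iff hδ).2 fun i => rfl⟩
  rw [Fintype.mem_piFinset]
  intro i
  have h1 : |x i| ≤ R := by
    have := (PiLp.norm_apply_le x i).trans (hR x hx)
    rwa [Real.norm_eq_abs] at this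
  have h2 := abs_le.1 h1
  have h3 : x i / δ ≤ R / δ := by gcongr; exact h2.2
  have h4 : -(R / δ) ≤ x i / δ := by rw [← neg_div]; gcongr; exact h2.1
  have h5 := Int.le_ceil (R / δ)
  rw [Finset.mem_Icc]
  constructor
  · rw [Int.le_floor]
    push_cast [N]
    linarith
  · have : (⌊x i / δ⌋ : ℝ) ≤ N := by
      push_cast [N]
      linarith [Int.floor_le (x i / δ)]
    exact_mod_cast this

/-- Up to a small multiple of the gradient norm, the `L²` norm on `H¹₀(Ω)` is controlled by finitely
many averages. -/
theorem exists_averages (hb : Bornology.IsBounded Ω) : ∃ C ≥ 0, ∀ δ > 0,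
    ∃ (J : Finset (Fin 3 → ℤ)) (l : (Fin 3 → ℤ) → L2 Ω) (K : ℝ), 0 ≤ K ∧ ∀ u : H10 Ω,
      ‖toL2 u‖ ^ 2 ≤ K * ∑ j ∈ J, ⟪l j, toL2 u⟫_ℝ ^ 2 + C * δ ^ 2 * normOne u ^ 2 := by
  refine ⟨2 * (volume : Measure E3).real (Metric.ball 0 2), by positivity, fun δ hδ => ?_⟩
  obtain ⟨J, hJ⟩ := exists_finset_cubes hb hδ
  have hfin : ∀ j, (volume.restrict Ω) (cube δ j) ≠ ⊤ := fun j =>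
    ((Measure.restrict_apply_le _ _).trans_lt
      ((volume_cube hδ.le j).trans_lt ENNReal.ofReal_lt_top)).ne
  refine ⟨J, fun j => indicatorConstLp 2 (measurableSet_cube δ j) (hfin j) 1, (δ ^ 3)⁻¹,
    by positivity, fun u => ?_⟩
  refine H10.induction (P := fun u => ‖toL2 u‖ ^ 2 ≤ (δ ^ 3)⁻¹ * ∑ j ∈ J,
    ⟪indicatorConstLp 2 (measurableSet_cube δ j) (hfin j) (1 : ℝ), toL2 u⟫_ℝ ^ 2 +
      2 * (volume : Measure E3).real (Metric.ball 0 2) * δ ^ 2 * normOne u ^ 2)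
    (isClosed_le ?_ ?_) (fun u φ hφ => ?_) u
  · fun_prop
  · unfold normOne; fun_prop
  have key := cells_inequality J (cube δ) (measurableSet_cube δ) (pairwise_disjoint_cube hδ)
    (volume_cube hδ.le) (by positivity) (dist_lt_of_mem_cube hδ) (hφ.smooth.of_le (by simp))
    hφ.compact ((subset_tsupport φ).trans (hφ.supp.trans hJ))
  have z : ∀ x, x ∉ Ω → φ x = 0 := fun x hx =>
    image_eq_zero_of_notMem_tsupport fun h => hx (hφ.supp h)
  have e1 : ‖toL2 u‖ ^ 2 = ∫ x, φ x ^ 2 := by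
    rw [← real_inner_self_eq_norm_sq, L2.inner_def,
      ← setIntegral_eq_integral_of_forall_compl_eq_zero (s := Ω) (f := fun x => φ x ^ 2)]
    · refine integral_congr_ae ?_
      filter_upwards [hφ.toL2_eq] with x hx
      rw [hx]; simp [sq]
    · intro x hx
      simp [z x hx]
  have e2 : normOne u ^ 2 = ∫ x, ‖fderiv ℝ φ x‖ ^ 2 := by
    rw [normOne, ← real_inner_self_eq_norm_sq, L2.inner_def,
      ← setIntegral_eq_integral_of_forall_compl_eq_zero (s := Ω)
        (f := fun x => ‖fderiv ℝ φ x‖ ^ 2)]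
    · refine integral_congr_ae ?_
      filter_upwards [hφ.grad_eq] with x hx
      rw [hx, real_inner_self_eq_norm_sq, norm_gradient]
    · intro x hx
      have : x ∉ tsupport (fderiv ℝ φ) := fun h =>
        hx (hφ.supp (tsupport_fderiv_subset (𝕜 := ℝ) (f := φ) h))
      rw [image_eq_zero_of_notMem_tsupport this]
      simp
  have e3 : ∀ j, ⟪indicatorConstLp 2 (measurableSet_cube δ j) (hfin j) (1 : ℝ), toL2 u⟫_ℝ =
      ∫ x in cube δ j, φ x := by
    intro j
    rw [L2.inner_indicatorConstLp_one]
    rw [integral_congr_ae (ae_restrict_of_ae hφ.toL2_eq),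
      Measure.restrict_restrict (measurableSet_cube δ j)]
    rw [setIntegral_eq_of_subset_of_forall_sdiff_eq_zero (measurableSet_cube δ j)
      inter_subset_left]
    intro x hx
    exact z x fun h => hx.2 ⟨hx.1, h⟩
  have e4 : (volume : Measure E3).real (Metric.ball 0 (2 * δ)) =
      δ ^ 3 * (volume : Measure E3).real (Metric.ball 0 2) := by
    have := Measure.addHaar_ball_mul_of_pos (volume : Measure E3) 0 hδ 2
    rw [mul_comm, Measure.real, this]
    simp [Measure.real, hδ.le]
  simp_rw [e3]
  rw [e1, e2]
  rw [e4] at key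
  have hδ3 : 0 < δ ^ 3 := by positivity
  rw [← mul_le_mul_iff_right₀ hδ3]
  field_simp
  nlinarith [key]

/-- The Rellich theorem: the inclusion `H¹₀(Ω) ⊂ L²(Ω)` is compact. -/
theorem totallyBounded_toL2_closedBall (hb : Bornology.IsBounded Ω) (r : ℝ) :
    TotallyBounded (toL2 '' Metric.closedBall (0 : H10 Ω) r) := by
  obtain ⟨C, hC, h⟩ := exists_averages hb
  refine Metric.totallyBounded_iff.2 fun ε hε => ?_
  obtain ⟨δ, hδ, hδε⟩ : ∃ δ > 0, C * δ ^ 2 * (2 * r) ^ 2 < ε ^ 2 / 2 := by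
    have : Tendsto (fun δ : ℝ => C * δ ^ 2 * (2 * r) ^ 2) (𝓝[>] 0) (𝓝 (C * 0 ^ 2 * (2 * r) ^ 2)) :=
      (Continuous.tendsto (by fun_prop) 0).mono_left nhdsWithin_le_nhds
    have h2 := this.eventually_lt_const (u := ε ^ 2 / 2)
      (by have := pow_pos hε 2; rw [zero_pow two_ne_zero]; linarith)
    obtain ⟨δ, h3, h4⟩ := (h2.and self_mem_nhdsWithin).exists
    exact ⟨δ, h4, h3⟩
  obtain ⟨J, l, K, hK, hu⟩ := h δ hδ
  let Λ : H10 Ω →L[ℝ] (J → ℝ) := ContinuousLinearMap.pi fun j => (innerSL ℝ (l j)).comp toL2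
  have hΛ : TotallyBounded (Λ '' Metric.closedBall (0 : H10 Ω) r) := by
    have h1 : Bornology.IsBounded (Λ '' Metric.closedBall (0 : H10 Ω) r) :=
      Λ.lipschitz.isBounded_image Metric.isBounded_closedBall
    exact h1.isCompact_closure.totallyBounded.subset subset_closure
  obtain ⟨η, hη, hηε⟩ : ∃ η > 0, K * (J.card * η ^ 2) < ε ^ 2 / 2 := by
    have : Tendsto (fun δ : ℝ => K * (J.card * δ ^ 2)) (𝓝[>] 0) (𝓝 (K * (J.card * 0 ^ 2))) :=
      (Continuous.tendsto (by fun_prop) 0).mono_left nhdsWithin_le_nhds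
    have h2 := this.eventually_lt_const (u := ε ^ 2 / 2)
      (by have := pow_pos hε 2; rw [zero_pow two_ne_zero]; linarith)
    obtain ⟨δ, h3, h4⟩ := (h2.and self_mem_nhdsWithin).exists
    exact ⟨δ, h4, h3⟩
  obtain ⟨t, hts, ht, hcov⟩ := Metric.finite_approx_of_totallyBounded hΛ η hη
  have hts' : ∀ y ∈ t, ∃ v ∈ Metric.closedBall (0 : H10 Ω) r, Λ v = y := fun y hy => hts hy
  choose! p hp hpe using hts'
  refine ⟨(fun y => toL2 (p y)) '' t, ht.image _, ?_⟩
  rintro _ ⟨u, hur, rfl⟩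
  obtain ⟨y, hy, hyu⟩ := mem_iUnion₂.1 (hcov ⟨u, hur, rfl⟩)
  refine mem_iUnion₂.2 ⟨toL2 (p y), ⟨y, hy, rfl⟩, ?_⟩
  rw [Metric.mem_ball, dist_eq_norm, ← map_sub]
  have h1 := hu (u - p y)
  have h2 : normOne (u - p y) ^ 2 ≤ (2 * r) ^ 2 := by
    have h3 : ‖u - p y‖ ≤ 2 * r := by
      have a := mem_closedBall_zero_iff.1 hur
      have b := mem_closedBall_zero_iff.1 (hp y hy)
      linarith [norm_sub_le u (p y)]
    have h4 := norm_sq_H10 (u - p y)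
    have h5 : ‖u - p y‖ ^ 2 ≤ (2 * r) ^ 2 := by gcongr
    nlinarith [sq_nonneg ‖toL2 (u - p y)‖]
  have h3 : ∑ j ∈ J, ⟪l j, toL2 (u - p y)⟫_ℝ ^ 2 ≤ J.card * η ^ 2 := by
    rw [← nsmul_eq_mul]
    refine Finset.sum_le_card_nsmul _ _ _ fun j hj => ?_
    have h4 : dist (Λ u ⟨j, hj⟩) (y ⟨j, hj⟩) < η := (dist_le_pi_dist _ _ _).trans_lt hyu
    rw [← hpe y hy, Real.dist_eq] at h4
    have h5 : ⟪l j, toL2 (u - p y)⟫_ℝ = Λ u ⟨j, hj⟩ - Λ (p y) ⟨j, hj⟩ := by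
      simp [Λ, inner_sub_right]
    rw [h5, ← sq_abs]
    gcongr
  refine lt_of_pow_lt_pow_left₀ 2 hε.le ?_
  calc ‖toL2 (u - p y)‖ ^ 2 ≤ _ := h1
    _ ≤ K * (J.card * η ^ 2) + C * δ ^ 2 * (2 * r) ^ 2 := by gcongr
    _ < ε ^ 2 := by linarith

theorem innerOne_comm (u v : H10 Ω) : innerOne u v = innerOne v u := real_inner_comm _ _

theorem innerOne_self (u : H10 Ω) : innerOne u u = normOne u ^ 2 := real_inner_self_eq_norm_sq _

theorem normOne_smul (c : ℝ) (u : H10 Ω) : normOne (c • u) = |c| * normOne u := by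
  simp [normOne, norm_smul]

theorem normOne_add_sq (u v : H10 Ω) :
    normOne (u + v) ^ 2 = normOne u ^ 2 + 2 * innerOne u v + normOne v ^ 2 := by
  rw [normOne, map_add, norm_add_sq_real]; rfl

theorem continuous_normOne : Continuous (normOne : H10 Ω → ℝ) := by
  unfold normOne; fun_prop

/-- A minimizer of the Rayleigh quotient is an eigenfunction. -/
theorem isDirichletEigenvalue_of_minimizer {m : ℝ} {e : H10 Ω} (he : e ≠ 0)
    (hm : ∀ u : H10 Ω, m * ‖toL2 u‖ ^ 2 ≤ normOne u ^ 2)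
    (hem : normOne e ^ 2 ≤ m * ‖toL2 e‖ ^ 2) : IsDirichletEigenvalue Ω m := by
  refine ⟨e, he, fun φ => ?_⟩
  set B := innerOne e φ - m * ⟪toL2 e, toL2 φ⟫_ℝ with hB
  set A := normOne φ ^ 2 - m * ‖toL2 φ‖ ^ 2 with hA
  have hA0 : 0 ≤ A := sub_nonneg.2 (hm φ)
  have key : ∀ t : ℝ, 0 ≤ 2 * t * B + t ^ 2 * A := by
    intro t
    have h := hm (e + t • φ)
    have e1 : innerOne e (t • φ) = t * innerOne e φ := by simp [innerOne, inner_smul_right]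
    rw [normOne_add_sq, e1, map_add, norm_add_sq_real, map_smul, inner_smul_right, normOne_smul,
      norm_smul, mul_pow, mul_pow, Real.norm_eq_abs, sq_abs] at h
    nlinarith
  have hk := key (-B / (A + 1))
  have e2 : 2 * (-B / (A + 1)) * B + (-B / (A + 1)) ^ 2 * A = -(B ^ 2 * (A + 2)) / (A + 1) ^ 2 := by
    field_simp; ring
  rw [e2, le_div_iff₀ (by positivity), zero_mul] at hk
  have : B ^ 2 = 0 := by nlinarith [sq_nonneg B, mul_nonneg (sq_nonneg B) hA0]
  have hB0 : B = 0 := by simpa using this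
  linarith

theorem bddBelow_eigenvalues (hΩ : IsOpen Ω) : BddBelow {lam | IsDirichletEigenvalue Ω lam} := by
  refine ⟨0, ?_⟩
  rintro lam ⟨e, he, h⟩
  have h1 := h e
  rw [innerOne_self, real_inner_self_eq_norm_sq] at h1
  have h2 : 0 < ‖toL2 e‖ ^ 2 := by
    have : toL2 e ≠ 0 := fun h0 => he (toL2_injective hΩ (by rw [h0, map_zero]))
    positivity
  by_contra h3
  push Not at h3
  nlinarith [sq_nonneg (normOne e)]

/-- The Poincaré inequality with the best constant. -/
theorem firstEigenvalue_mul_le (hΩ : IsOpen Ω) (hb : Bornology.IsBounded Ω) (u : H10 Ω) :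
    firstEigenvalue Ω * ‖toL2 u‖ ^ 2 ≤ normOne u ^ 2 := by
  by_cases hu : toL2 u = 0
  · rw [hu]; simp; positivity
  set S : Set ℝ := {r | ∃ v : H10 Ω, ‖toL2 v‖ = 1 ∧ r = normOne v ^ 2} with hS
  have normalize : ∀ v : H10 Ω, toL2 v ≠ 0 → normOne v ^ 2 / ‖toL2 v‖ ^ 2 ∈ S := by
    intro v hv
    have hv' : ‖toL2 v‖ ≠ 0 := norm_ne_zero_iff.2 hv
    refine ⟨‖toL2 v‖⁻¹ • v, by rw [map_smul, norm_smul]; simp [hv'], ?_⟩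
    rw [normOne_smul, mul_pow, sq_abs]
    field_simp
  have hSne : S.Nonempty := ⟨_, normalize u hu⟩
  have hSb : BddBelow S := ⟨0, by rintro _ ⟨v, _, rfl⟩; positivity⟩
  set m := sInf S with hm
  have hm0 : 0 ≤ m := le_csInf hSne (by rintro _ ⟨v, _, rfl⟩; positivity)
  have hmin : ∀ v : H10 Ω, m * ‖toL2 v‖ ^ 2 ≤ normOne v ^ 2 := by
    intro v
    by_cases hv : toL2 v = 0
    · rw [hv]; simp; positivity
    have hv' : 0 < ‖toL2 v‖ := norm_pos_iff.2 hv
    have := csInf_le hSb (normalize v hv)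
    rwa [le_div_iff₀ (by positivity)] at this
  have hseq : ∀ n : ℕ, ∃ v : H10 Ω, ‖toL2 v‖ = 1 ∧ normOne v ^ 2 < m + 1 / ((n : ℝ) + 1) := by
    intro n
    obtain ⟨r, ⟨v, hv, rfl⟩, hr⟩ := exists_lt_of_csInf_lt hSne
      (show m < m + 1 / ((n : ℝ) + 1) by have : (0 : ℝ) < 1 / ((n : ℝ) + 1) := by positivity
                                         linarith)
    exact ⟨v, hv, hr⟩
  choose v hv1 hv2 using hseq
  have hbd : ∀ n, toL2 (v n) ∈ closure (toL2 '' Metric.closedBall (0 : H10 Ω) (m + 2)) := by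
    intro n
    refine subset_closure ⟨v n, ?_, rfl⟩
    rw [mem_closedBall_zero_iff]
    have h1 := norm_sq_H10 (v n)
    rw [hv1] at h1
    have h2 : 1 / ((n : ℝ) + 1) ≤ 1 := by
      rw [div_le_one (by positivity)]; linarith [(Nat.cast_nonneg n : (0 : ℝ) ≤ n)]
    refine le_of_sq_le_sq ?_ (by linarith)
    nlinarith [hv2 n]
  have hcomp : IsCompact (closure (toL2 '' Metric.closedBall (0 : H10 Ω) (m + 2))) :=
    (totallyBounded_toL2_closedBall hb _).closure.isCompact_of_isClosed isClosed_closure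
  obtain ⟨w, -, ns, hns, hlim⟩ := hcomp.tendsto_subseq hbd
  have hpar : ∀ a b, normOne (v a - v b) ^ 2 ≤ 2 * (1 / ((a : ℝ) + 1)) + 2 * (1 / ((b : ℝ) + 1)) +
      m * ‖toL2 (v a - v b)‖ ^ 2 := by
    intro a b
    have h1 := parallelogram_law_with_norm ℝ (grad (v a)) (grad (v b))
    have h2 := parallelogram_law_with_norm ℝ (toL2 (v a)) (toL2 (v b))
    have h3 := hmin (v a + v b)
    rw [hv1, hv1, ← map_add, ← map_sub] at h2
    rw [← map_add, ← map_sub] at h1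
    have h4 := hv2 a
    have h5 := hv2 b
    simp only [normOne] at h3 h4 h5 ⊢
    nlinarith
  have hz : Tendsto (fun n : ℕ => 1 / ((ns n : ℝ) + 1)) atTop (𝓝 0) :=
    (tendsto_one_div_add_atTop_nhds_zero_nat (𝕜 := ℝ)).comp hns.tendsto_atTop
  have hcau : CauchySeq (v ∘ ns) := by
    rw [Metric.cauchySeq_iff]
    intro ε hε
    have hη : 0 < ε / (2 * (m + 1)) := by positivity
    obtain ⟨N₁, hN₁⟩ := Metric.cauchySeq_iff.1 hlim.cauchySeq _ hη
    obtain ⟨N₂, hN₂⟩ := eventually_atTop.1 (hz.eventually_lt_const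
      (show (0 : ℝ) < ε ^ 2 / 8 by positivity))
    refine ⟨max N₁ N₂, fun a ha b hb' => ?_⟩
    have h1 := hN₁ a (le_of_max_le_left ha) b (le_of_max_le_left hb')
    have h2 := hN₂ a (le_of_max_le_right ha)
    have h3 := hN₂ b (le_of_max_le_right hb')
    have h4 := hpar (ns a) (ns b)
    have h5 := norm_sq_H10 (v (ns a) - v (ns b))
    simp only [Function.comp_apply, dist_eq_norm] at h1 ⊢
    rw [← map_sub] at h1
    have h6 : (m + 1) * ‖toL2 (v (ns a) - v (ns b))‖ ^ 2 ≤ ε ^ 2 / 4 := by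
      have : ‖toL2 (v (ns a) - v (ns b))‖ ^ 2 ≤ (ε / (2 * (m + 1))) ^ 2 := by gcongr
      calc _ ≤ (m + 1) * (ε / (2 * (m + 1))) ^ 2 := by gcongr
        _ = ε ^ 2 / 4 / (m + 1) := by field_simp; ring
        _ ≤ ε ^ 2 / 4 := div_le_self (by positivity) (by linarith)
    refine lt_of_pow_lt_pow_left₀ 2 hε.le ?_
    nlinarith
  obtain ⟨e, he⟩ := cauchySeq_tendsto_of_complete hcau
  have he1 : ‖toL2 e‖ = 1 := by
    have h1 : Tendsto (fun n => ‖toL2 (v (ns n))‖) atTop (𝓝 ‖toL2 e‖) :=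
      ((by fun_prop : Continuous fun u : H10 Ω => ‖toL2 u‖).tendsto e).comp he
    simp_rw [hv1] at h1
    exact (tendsto_nhds_unique h1 tendsto_const_nhds)
  have he2 : normOne e ^ 2 ≤ m * ‖toL2 e‖ ^ 2 := by
    rw [he1]
    have h1 : Tendsto (fun n => normOne (v (ns n)) ^ 2) atTop (𝓝 (normOne e ^ 2)) :=
      ((continuous_normOne.pow 2).tendsto e).comp he
    have h2 := hz.const_add m
    rw [add_zero] at h2
    simpa using le_of_tendsto_of_tendsto' h1 h2 fun n => (hv2 (ns n)).le
  have hene : e ≠ 0 := by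
    rintro rfl
    simp at he1
  have := csInf_le (bddBelow_eigenvalues hΩ) (isDirichletEigenvalue_of_minimizer hene hmin he2)
  exact (mul_le_mul_of_nonneg_right this (by positivity)).trans (hmin u)

end

/-! ### Resolvents of the Dirichlet Laplacian -/

section

variable {Ω : Set E3}

/-- The inclusion `L²(Ω) ⊂ H⁻¹(Ω)` as a continuous linear map. -/
def toHnegL : L2 Ω →L[ℝ] Hneg Ω :=
  ((ContinuousLinearMap.compL ℝ (H10 Ω) (L2 Ω) ℝ).flip toL2).comp (innerSL ℝ)

theorem toHnegL_apply (v : L2 Ω) (φ : H10 Ω) : toHnegL v φ = ⟪v, toL2 φ⟫_ℝ := rfl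

/-- The form `⟨u, v⟩₁` as a continuous bilinear map. -/
def innerOneL : H10 Ω →L[ℝ] H10 Ω →L[ℝ] ℝ :=
  ((innerSL ℝ).bilinearComp (grad (Ω := Ω)) (grad (Ω := Ω)) :)

theorem innerOneL_apply (u v : H10 Ω) : innerOneL u v = innerOne u v := rfl

/-- The form `⟨u, v⟩` as a continuous bilinear map on `H¹₀(Ω)`. -/
def innerZeroL : H10 Ω →L[ℝ] H10 Ω →L[ℝ] ℝ :=
  ((innerSL ℝ).bilinearComp (toL2 (Ω := Ω)) (toL2 (Ω := Ω)) :)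

theorem innerZeroL_apply (u v : H10 Ω) : innerZeroL u v = ⟪toL2 u, toL2 v⟫_ℝ := rfl

/-- `J` is the solution operator of the problem `α u + β A u = l`. -/
def IsResolvent (α β : ℝ) (J : Hneg Ω →L[ℝ] H10 Ω) : Prop :=
  ∀ (l : Hneg Ω) (φ : H10 Ω), α * ⟪toL2 (J l), toL2 φ⟫_ℝ + β * innerOne (J l) φ = l φ

/-- The Riesz representation `H⁻¹(Ω) → H¹₀(Ω)`. -/
def riesz : Hneg Ω →L[ℝ] H10 Ω where
  toFun l := (InnerProductSpace.toDual ℝ (H10 Ω)).symm l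
  map_add' := map_add _
  map_smul' c l := by simp
  cont := (InnerProductSpace.toDual ℝ (H10 Ω)).symm.continuous

theorem inner_riesz (l : Hneg Ω) (φ : H10 Ω) : ⟪riesz l, φ⟫_ℝ = l φ :=
  InnerProductSpace.toDual_symm_apply

theorem exists_resolvent (hb : Bornology.IsBounded Ω) {α β : ℝ} (hα : 0 ≤ α) (hβ : 0 < β) :
    ∃ J : Hneg Ω →L[ℝ] H10 Ω, IsResolvent α β J := by
  let B : H10 Ω →L[ℝ] H10 Ω →L[ℝ] ℝ := α • innerZeroL + β • innerOneL
  have hB : ∀ u v, B u v = α * ⟪toL2 u, toL2 v⟫_ℝ + β * innerOne u v := fun u v => by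
    simp [B, innerZeroL_apply, innerOneL_apply]
  have hco : IsCoercive B := by
    obtain ⟨C, hC, hP⟩ := exists_poincare hb
    refine ⟨β / (C ^ 2 + 1), by positivity, fun u => ?_⟩
    rw [hB, innerOne_self, real_inner_self_eq_norm_sq, mul_assoc, ← sq, norm_sq_H10,
      div_mul_eq_mul_div, div_le_iff₀ (by positivity)]
    have h1 : ‖toL2 u‖ ^ 2 ≤ (C * normOne u) ^ 2 := by gcongr; exact hP u
    have h2 : 0 ≤ α * ‖toL2 u‖ ^ 2 * (C ^ 2 + 1) := by positivity
    nlinarith [mul_le_mul_of_nonneg_left h1 hβ.le]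
  refine ⟨(hco.continuousLinearEquivOfBilin.symm : H10 Ω →L[ℝ] H10 Ω).comp
    riesz, fun l φ => ?_⟩
  rw [← hB, ← hco.continuousLinearEquivOfBilin_apply]
  simp [inner_riesz]

/-- A continuous operator `J : H⁻¹(Ω) → H¹₀(Ω)` that is symmetric and nonnegative, together with
the form `⟨A u, J φ⟩`, extended to `L²(Ω)` as the form of a symmetric nonnegative operator `P`. -/
structure IsEnergyPair (J : Hneg Ω →L[ℝ] H10 Ω) (P : L2 Ω →L[ℝ] L2 Ω) : Prop where
  symm : ∀ l m : Hneg Ω, l (J m) = m (J l)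
  nonneg : ∀ l : Hneg Ω, 0 ≤ l (J l)
  P_symm : ∀ x y : L2 Ω, ⟪P x, y⟫_ℝ = ⟪P y, x⟫_ℝ
  P_nonneg : ∀ x : L2 Ω, 0 ≤ ⟪P x, x⟫_ℝ
  P_eq : ∀ (u : H10 Ω) (φ : L2 Ω), ⟪P (toL2 u), φ⟫_ℝ = innerOne u (J (toHnegL φ))

namespace IsResolvent

variable {α β : ℝ} {J : Hneg Ω →L[ℝ] H10 Ω}

theorem symm (h : IsResolvent α β J) (l m : Hneg Ω) : l (J m) = m (J l) := by
  rw [← h l, ← h m, real_inner_comm, innerOne_comm]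

theorem apply_self (h : IsResolvent α β J) (l : Hneg Ω) :
    l (J l) = α * ‖toL2 (J l)‖ ^ 2 + β * normOne (J l) ^ 2 := by
  rw [← h l (J l), real_inner_self_eq_norm_sq, innerOne_self]

/-- The operator `(1 - α J) / β`. -/
def yosida (α β : ℝ) (J : Hneg Ω →L[ℝ] H10 Ω) : L2 Ω →L[ℝ] L2 Ω :=
  β⁻¹ • (ContinuousLinearMap.id ℝ (L2 Ω) - α • toL2.comp (J.comp toHnegL))

theorem yosida_apply (x y : L2 Ω) :
    ⟪yosida α β J x, y⟫_ℝ = β⁻¹ * (⟪x, y⟫_ℝ - α * toHnegL y (J (toHnegL x))) := by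
  simp only [yosida, smul_apply, sub_apply,
    ContinuousLinearMap.id_apply, ContinuousLinearMap.comp_apply, real_inner_smul_left,
    inner_sub_left, toHnegL_apply]
  rw [real_inner_comm y (toL2 _)]

theorem mul_norm_le (h : IsResolvent α β J) (hα : 0 ≤ α) (hβ : 0 < β) (x : L2 Ω) :
    α * ‖toL2 (J (toHnegL x))‖ ≤ ‖x‖ := by
  have h1 := h.apply_self (toHnegL x)
  rw [toHnegL_apply] at h1
  have h2 := real_inner_le_norm x (toL2 (J (toHnegL x)))
  by_contra! h3
  have h4 : 0 ≤ β * normOne (J (toHnegL x)) ^ 2 := by positivity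
  have h5 := norm_nonneg (toL2 (J (toHnegL x)))
  have h6 := norm_nonneg x
  have h7 : 0 < ‖toL2 (J (toHnegL x))‖ := by
    by_contra h8
    have : ‖toL2 (J (toHnegL x))‖ = 0 := le_antisymm (not_lt.1 h8) h5
    rw [this] at h3; linarith
  nlinarith

theorem mul_apply_le (h : IsResolvent α β J) (hα : 0 ≤ α) (hβ : 0 < β) (x : L2 Ω) :
    α * toHnegL x (J (toHnegL x)) ≤ ‖x‖ ^ 2 := by
  rw [toHnegL_apply]
  have h2 := real_inner_le_norm x (toL2 (J (toHnegL x)))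
  have h3 := h.mul_norm_le hα hβ x
  nlinarith [mul_le_mul_of_nonneg_left h2 hα, mul_le_mul_of_nonneg_left h3 (norm_nonneg x)]

theorem isEnergyPair (h : IsResolvent α β J) (hα : 0 ≤ α) (hβ : 0 < β) :
    IsEnergyPair J (yosida α β J) where
  symm := h.symm
  nonneg l := by rw [h.apply_self]; positivity
  P_symm x y := by rw [yosida_apply, yosida_apply, h.symm, real_inner_comm]
  P_nonneg x := by
    rw [yosida_apply, real_inner_self_eq_norm_sq]
    have := h.mul_apply_le hα hβ x
    exact mul_nonneg (by positivity) (by linarith)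
  P_eq u φ := by
    rw [yosida_apply, h.symm, toHnegL_apply (toL2 u)]
    have h1 := h (toHnegL φ) u
    rw [toHnegL_apply φ u, real_inner_comm (toL2 u) φ] at h1
    rw [innerOne_comm, ← h1, real_inner_comm (toL2 (J _))]
    field_simp
    ring

theorem yosida_zero_one : yosida 0 1 J = ContinuousLinearMap.id ℝ (L2 Ω) := by
  simp [yosida]

variable {ε : ℝ}

theorem norm_le (h : IsResolvent 1 ε J) (hε : 0 < ε) (x : L2 Ω) :
    ‖toL2 (J (toHnegL x))‖ ≤ ‖x‖ := by
  simpa using h.mul_norm_le zero_le_one hε x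

theorem norm_sub_sq (h : IsResolvent 1 ε J) (u : H10 Ω) :
    ‖toL2 u - toL2 (J (toHnegL (toL2 u)))‖ ^ 2 =
      ε * (innerOne u (J (toHnegL (toL2 u))) - normOne (J (toHnegL (toL2 u))) ^ 2) := by
  set y := J (toHnegL (toL2 u)) with hy
  have h1 := h (toHnegL (toL2 u)) (u - y)
  rw [toHnegL_apply, ← hy, one_mul, map_sub, innerOne, map_sub, inner_sub_right (grad y)] at h1
  rw [← real_inner_self_eq_norm_sq, inner_sub_left, ← h1, ← innerOne_self, innerOne, innerOne,
    real_inner_comm (grad y) (grad u)]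
  ring

theorem sq_normOne_le (h : IsResolvent 1 ε J) (hε : 0 < ε) (u : H10 Ω) :
    normOne (J (toHnegL (toL2 u))) ^ 2 ≤ ⟪yosida 1 ε J (toL2 u), toL2 u⟫_ℝ := by
  rw [(h.isEnergyPair zero_le_one hε).P_eq]
  have h1 := h.norm_sub_sq u
  have h2 : 0 ≤ ε * (innerOne u (J (toHnegL (toL2 u))) - normOne (J (toHnegL (toL2 u))) ^ 2) := by
    rw [← h1]; positivity
  linarith [nonneg_of_mul_nonneg_right h2 hε]

theorem yosida_le (h : IsResolvent 1 ε J) (hε : 0 < ε) (u : H10 Ω) :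
    ⟪yosida 1 ε J (toL2 u), toL2 u⟫_ℝ ≤ normOne u ^ 2 := by
  have h1 := h.sq_normOne_le hε u
  rw [(h.isEnergyPair zero_le_one hε).P_eq] at h1 ⊢
  have h2 : innerOne u (J (toHnegL (toL2 u))) ≤ normOne u * normOne (J (toHnegL (toL2 u))) :=
    real_inner_le_norm _ _
  have := normOne_nonneg u
  have := normOne_nonneg (J (toHnegL (toL2 u)))
  nlinarith [sq_nonneg (normOne u - normOne (J (toHnegL (toL2 u))))]

theorem norm_sub_sq_le (h : IsResolvent 1 ε J) (hε : 0 < ε) (u : H10 Ω) :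
    ‖toL2 u - toL2 (J (toHnegL (toL2 u)))‖ ^ 2 ≤ ε * normOne u ^ 2 := by
  rw [h.norm_sub_sq]
  have h1 := h.yosida_le hε u
  rw [(h.isEnergyPair zero_le_one hε).P_eq] at h1
  gcongr
  nlinarith [sq_nonneg (normOne (J (toHnegL (toL2 u))))]

theorem apply_le (h : IsResolvent 1 ε J) (hε : 0 < ε) (x : L2 Ω) :
    toHnegL x (J (toHnegL x)) ≤ ‖x‖ ^ 2 := by
  simpa using h.mul_apply_le zero_le_one hε x

end IsResolvent

theorem tendsto_resolvent (hΩ : IsOpen Ω) {ε : ℕ → ℝ} (hε : ∀ n, 0 < ε n)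
    (hε0 : Tendsto ε atTop (𝓝 0)) {J : ℕ → Hneg Ω →L[ℝ] H10 Ω}
    (hJ : ∀ n, IsResolvent 1 (ε n) (J n)) (x : L2 Ω) :
    Tendsto (fun n => toL2 (J n (toHnegL x))) atTop (𝓝 x) := by
  rw [Metric.tendsto_atTop]
  intro δ hδ
  obtain ⟨u, hu⟩ := (toL2_denseRange hΩ).exists_dist_lt x (show 0 < δ / 3 by positivity)
  have h1 : Tendsto (fun n => ε n * normOne u ^ 2) atTop (𝓝 0) := by
    simpa using hε0.mul_const (normOne u ^ 2)
  obtain ⟨N, hN⟩ := eventually_atTop.1 (h1.eventually_lt_const (u := (δ / 3) ^ 2) (by positivity))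
  refine ⟨N, fun n hn => ?_⟩
  have h2 : ‖toL2 u - toL2 (J n (toHnegL (toL2 u)))‖ < δ / 3 :=
    lt_of_pow_lt_pow_left₀ 2 (by positivity) (((hJ n).norm_sub_sq_le (hε n) u).trans_lt (hN n hn))
  have h3 : ‖toL2 (J n (toHnegL (x - toL2 u)))‖ ≤ ‖x - toL2 u‖ := (hJ n).norm_le (hε n) _
  rw [dist_eq_norm] at hu ⊢
  have e : toL2 (J n (toHnegL x)) - x = toL2 (J n (toHnegL (x - toL2 u))) -
      (toL2 u - toL2 (J n (toHnegL (toL2 u)))) - (x - toL2 u) := by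
    simp only [map_sub]; abel
  rw [e]
  linarith [norm_sub_le (toL2 (J n (toHnegL (x - toL2 u))) -
      (toL2 u - toL2 (J n (toHnegL (toL2 u))))) (x - toL2 u),
    norm_sub_le (toL2 (J n (toHnegL (x - toL2 u)))) (toL2 u - toL2 (J n (toHnegL (toL2 u))))]

theorem dense_riesz (hΩ : IsOpen Ω) :
    DenseRange fun h : L2 Ω => riesz (toHnegL h) := by
  let R : L2 Ω →L[ℝ] H10 Ω := riesz.comp toHnegL
  have h : (LinearMap.range R.toLinearMap).topologicalClosure = ⊤ := by
    rw [Submodule.topologicalClosure_eq_top_iff, Submodule.eq_bot_iff]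
    intro ψ hψ
    apply toL2_injective hΩ
    rw [map_zero, ← inner_self_eq_zero (𝕜 := ℝ)]
    have h4 := (Submodule.mem_orthogonal _ _).1 hψ (R (toL2 ψ)) ⟨_, rfl⟩
    rw [← h4, ← toHnegL_apply]
    simp [R, inner_riesz]
  rw [DenseRange, dense_iff_closure_eq]
  exact congrArg (fun S : Submodule ℝ (H10 Ω) => (S : Set (H10 Ω))) h

/-- Weak lower semicontinuity of the gradient norm under convergence in `L²(Ω)`. -/
theorem sq_normOne_le_of_tendsto (hΩ : IsOpen Ω) {y : ℕ → H10 Ω} {u : H10 Ω} {Q : ℝ}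
    (hQ : ∀ n, normOne (y n) ^ 2 ≤ Q) (hy : Tendsto (fun n => toL2 (y n)) atTop (𝓝 (toL2 u))) :
    normOne u ^ 2 ≤ Q := by
  have hQ0 : 0 ≤ Q := (sq_nonneg _).trans (hQ 0)
  have key : ∀ φ : H10 Ω, |innerOne φ u| ≤ √Q * normOne φ := by
    refine fun φ => (dense_riesz hΩ).induction_on φ (isClosed_le ?_ ?_) fun h => ?_
    · unfold innerOne; fun_prop
    · unfold normOne; fun_prop
    set φ := riesz (toHnegL h)
    have e : ∀ v, innerOne φ v = ⟪h, toL2 v⟫_ℝ - ⟪toL2 φ, toL2 v⟫_ℝ := by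
      intro v
      have h1 := inner_H10 φ v
      rw [inner_riesz, toHnegL_apply] at h1
      linarith
    have h1 : Tendsto (fun n => |innerOne φ (y n)|) atTop (𝓝 |innerOne φ u|) := by
      simp_rw [e]
      exact ((tendsto_const_nhds.inner hy).sub (tendsto_const_nhds.inner hy)).abs
    refine le_of_tendsto' h1 fun n => ?_
    have h2 : |innerOne φ (y n)| ≤ normOne φ * normOne (y n) := abs_real_inner_le_norm _ _
    have h3 : normOne (y n) ≤ √Q := Real.le_sqrt_of_sq_le (hQ n)
    nlinarith [normOne_nonneg φ]
  have h1 := key u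
  rw [innerOne_self, abs_of_nonneg (sq_nonneg _)] at h1
  have h2 := normOne_nonneg u
  have h3 := Real.sq_sqrt hQ0
  have h4 := Real.sqrt_nonneg Q
  have h5 : normOne u ≤ √Q := by
    by_contra! h6
    nlinarith
  nlinarith

end

/-! ### The memory kernel along the characteristics -/

section

/-- The integral of `m` over the square of side `ε` with corner `(p, q)`. -/
def squareIntegral (m : ℝ → ℝ → ℝ) (ε p q : ℝ) : ℝ :=
  ∫ a in p..p + ε, ∫ b in q..q + ε, m a b

section Square

variable {m : ℝ → ℝ → ℝ}

theorem continuous_integral_snd (hm : Continuous m.uncurry) (ε : ℝ) :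
    Continuous fun z : ℝ × ℝ => ∫ b in z.2..z.2 + ε, m z.1 b := by
  have e : ∀ z : ℝ × ℝ, ∫ b in z.2..z.2 + ε, m z.1 b =
      (∫ b in (0 : ℝ)..z.2 + ε, m z.1 b) - ∫ b in (0 : ℝ)..z.2, m z.1 b := by
    intro z
    have hc : Continuous (m z.1) := hm.comp (by fun_prop : Continuous fun b => (z.1, b))
    rw [intervalIntegral.integral_interval_sub_left (hc.intervalIntegrable _ _)
      (hc.intervalIntegrable _ _)]
  simp_rw [e]
  have hc : Continuous (fun (z : ℝ × ℝ) (b : ℝ) => m z.1 b).uncurry :=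
    hm.comp (by fun_prop : Continuous fun w : (ℝ × ℝ) × ℝ => (w.1.1, w.2))
  exact (intervalIntegral.continuous_parametric_intervalIntegral_of_continuous hc
    (s := fun z : ℝ × ℝ => z.2 + ε) (by fun_prop)).sub
    (intervalIntegral.continuous_parametric_intervalIntegral_of_continuous hc
    (s := fun z : ℝ × ℝ => z.2) (by fun_prop))

theorem hasDerivAt_integral_window {G : ℝ → ℝ} (hG : Continuous G) (ε p : ℝ) :
    HasDerivAt (fun p => ∫ a in p..p + ε, G a) (G (p + ε) - G p) p := by
  have e : (fun p => ∫ a in p..p + ε, G a) =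
      fun p => (∫ a in (0 : ℝ)..p + ε, G a) - ∫ a in (0 : ℝ)..p, G a := by
    funext p
    rw [intervalIntegral.integral_interval_sub_left (hG.intervalIntegrable _ _)
      (hG.intervalIntegrable _ _)]
  rw [e]
  have h1 : ∀ x, HasDerivAt (fun p => ∫ a in (0 : ℝ)..p, G a) (G x) x := fun x =>
    intervalIntegral.integral_hasDerivAt_right (hG.intervalIntegrable _ _)
      (hG.stronglyMeasurableAtFilter _ _) hG.continuousAt
  exact ((h1 (p + ε)).comp_add_const p ε).sub (h1 p)

theorem squareIntegral_swap (hm : Continuous m.uncurry) (ε p q : ℝ) :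
    squareIntegral m ε p q = squareIntegral (fun a b => m b a) ε q p := by
  unfold squareIntegral
  refine intervalIntegral_intervalIntegral_swap (F := m) ?_
  exact (hm.continuousOn.integrableOn_compact (isCompact_uIcc.prod isCompact_uIcc)).mono_set
    (prod_mono uIoc_subset_uIcc uIoc_subset_uIcc)

theorem hasDerivAt_squareIntegral (hm : Continuous m.uncurry) (ε p q h : ℝ) :
    HasDerivAt (fun h => squareIntegral m ε (p + h) (q + h))
      (((∫ b in q + h..q + h + ε, m (p + h + ε) b) - ∫ b in q + h..q + h + ε, m (p + h) b) +
      ((∫ a in p + h..p + h + ε, m a (q + h + ε)) - ∫ a in p + h..p + h + ε, m a (q + h))) h := by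
  have hm' : Continuous (fun a b => m b a).uncurry := hm.comp continuous_swap
  have c1 := continuous_integral_snd hm ε
  have c2 := continuous_integral_snd hm' ε
  let f₁ : ℝ → ℝ → ℝ := fun p q => (∫ b in q..q + ε, m (p + ε) b) - ∫ b in q..q + ε, m p b
  let f₂ : ℝ → ℝ → ℝ := fun p q => (∫ a in p..p + ε, m a (q + ε)) - ∫ a in p..p + ε, m a q
  have d1 : ∀ z : ℝ × ℝ, HasDerivAt (fun p => squareIntegral m ε p z.2) (f₁ z.1 z.2) z.1 := by
    intro z
    exact hasDerivAt_integral_window (G := fun a => ∫ b in z.2..z.2 + ε, m a b)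
      (c1.comp (by fun_prop : Continuous fun a => (a, z.2))) ε z.1
  have d2 : ∀ z : ℝ × ℝ, HasDerivAt (fun q => squareIntegral m ε z.1 q) (f₂ z.1 z.2) z.2 := by
    intro z
    simp_rw [squareIntegral_swap hm]
    exact hasDerivAt_integral_window (G := fun b => ∫ a in z.1..z.1 + ε, m a b)
      (c2.comp (by fun_prop : Continuous fun a => (a, z.1))) ε z.2
  have cf₁ : Continuous (↿f₁) :=
    (c1.comp (by fun_prop : Continuous fun z : ℝ × ℝ => (z.1 + ε, z.2))).sub c1
  have cf₂ : Continuous (↿f₂) :=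
    (c2.comp (by fun_prop : Continuous fun z : ℝ × ℝ => (z.2 + ε, z.1))).sub
      (c2.comp (by fun_prop : Continuous fun z : ℝ × ℝ => (z.2, z.1)))
  have hS := hasStrictFDerivAt_uncurry_coprod (𝕜 := ℝ) (u := (p + h, q + h))
    (f := squareIntegral m ε) (f₁ := fun p q => ContinuousLinearMap.toSpanSingleton ℝ (f₁ p q))
    (f₂ := fun p q => ContinuousLinearMap.toSpanSingleton ℝ (f₂ p q))
    (Eventually.of_forall fun z => (d1 z).hasFDerivAt)
    (Eventually.of_forall fun z => (d2 z).hasFDerivAt)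
    ((ContinuousLinearMap.toSpanSingletonCLE.continuous.comp cf₁).continuousAt)
    ((ContinuousLinearMap.toSpanSingletonCLE.continuous.comp cf₂).continuousAt)
  have hl : HasDerivAt (fun h : ℝ => (p + h, q + h)) ((1 : ℝ), (1 : ℝ)) h :=
    ((hasDerivAt_id h).const_add p).prodMk ((hasDerivAt_id h).const_add q)
  have := hS.hasFDerivAt.comp_hasDerivAt h hl
  convert! this using 1
  simp [f₁, f₂, Function.HasUncurry.uncurry]

theorem abs_squareIntegral_sub_le (hm : Continuous m.uncurry) {ε p q η : ℝ} (hε : 0 ≤ ε)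
    (h : ∀ a ∈ Icc p (p + ε), ∀ b ∈ Icc q (q + ε), |m a b - m p q| ≤ η) :
    |squareIntegral m ε p q - ε ^ 2 * m p q| ≤ η * ε ^ 2 := by
  have c1 := continuous_integral_snd hm ε
  have cm : ∀ a, Continuous (m a) := fun a => hm.comp (by fun_prop : Continuous fun b => (a, b))
  have e : squareIntegral m ε p q - ε ^ 2 * m p q =
      ∫ a in p..p + ε, ∫ b in q..q + ε, (m a b - m p q) := by
    have e1 : ∀ a, ∫ b in q..q + ε, (m a b - m p q) = (∫ b in q..q + ε, m a b) - ε * m p q := by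
      intro a
      rw [intervalIntegral.integral_sub ((cm a).intervalIntegrable _ _) (by simp)]
      simp
    simp_rw [e1]
    have c3 : Continuous fun a => ∫ b in q..q + ε, m a b :=
      c1.comp (by fun_prop : Continuous fun a => (a, q))
    rw [intervalIntegral.integral_sub (c3.intervalIntegrable _ _) intervalIntegrable_const]
    simp [squareIntegral]
    ring
  rw [e, ← Real.norm_eq_abs]
  have h1 : ∀ a ∈ uIoc p (p + ε), ‖∫ b in q..q + ε, (m a b - m p q)‖ ≤ η * |q + ε - q| := by
    intro a ha
    rw [uIoc_of_le (by linarith)] at ha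
    refine intervalIntegral.norm_integral_le_of_norm_le_const fun b hb => ?_
    rw [uIoc_of_le (by linarith)] at hb
    exact h a (Ioc_subset_Icc_self ha) b (Ioc_subset_Icc_self hb)
  refine (intervalIntegral.norm_integral_le_of_norm_le_const h1).trans_eq ?_
  simp only [add_sub_cancel_left, abs_of_nonneg hε]
  ring

/-- A continuous function whose square averages decrease along the diagonal at all small scales
decreases along the diagonal. -/
theorem le_of_squareIntegral_le (hm : Continuous m.uncurry) {p q p' q' c : ℝ} (hc : 0 ≤ c)
    (h : ∀ ε ∈ Ioo (0 : ℝ) 1, squareIntegral m ε p' q' ≤ c * squareIntegral m ε p q) :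
    m p' q' ≤ c * m p q := by
  have near : ∀ p q η : ℝ, 0 < η → ∀ᶠ ε in 𝓝[>] (0 : ℝ),
      |squareIntegral m ε p q - ε ^ 2 * m p q| ≤ η * ε ^ 2 := by
    intro p q η hη
    obtain ⟨δ, hδ, hd⟩ := Metric.continuousAt_iff.1 (hm.continuousAt (x := (p, q))) η hη
    filter_upwards [Ioo_mem_nhdsGT hδ] with ε hε
    refine abs_squareIntegral_sub_le hm hε.1.le fun a ha b hb => ?_
    have : dist (a, b) (p, q) < δ := by
      rw [Prod.dist_eq, max_lt_iff, Real.dist_eq, Real.dist_eq, abs_lt, abs_lt]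
      simp only [mem_Icc, mem_Ioo] at ha hb hε
      refine ⟨⟨?_, ?_⟩, ?_, ?_⟩ <;> linarith
    exact (hd this).le
  refine le_of_forall_pos_le_add fun η hη => ?_
  have hη' : 0 < η / (1 + c) := by positivity
  obtain ⟨ε, ⟨h1, h2⟩, h3⟩ := ((near p q _ hη').and (near p' q' _ hη')).and
    (Ioo_mem_nhdsGT (zero_lt_one' ℝ)) |>.exists
  have h4 := h ε h3
  have h5 := (abs_le.1 h1).2
  have h6 := (abs_le.1 h2).1
  have hε2 : 0 < ε ^ 2 := pow_pos h3.1 2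
  have h7 := mul_le_mul_of_nonneg_left h5 hc
  have e : η = η / (1 + c) * (1 + c) := by field_simp
  refine le_of_mul_le_mul_left ?_ hε2
  rw [e]
  nlinarith

end Square

section Kernel

variable {μ : ℝ → ℝ → ℝ}

theorem IsMemoryKernel.continuousAt_right (hμ : IsMemoryKernel μ) (t : ℝ) {s : ℝ} (hs : 0 < s) :
    ContinuousAt (μ t) s := by
  have h := (hμ.absCont t (s / 2) (s + 1) (by positivity) (by linarith)).continuousOn
  rw [uIcc_of_le (by linarith)] at h
  exact h.continuousAt (Icc_mem_nhds (by linarith) (by linarith))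

theorem IsMemoryKernel.dense_differentiable (hμ : IsMemoryKernel μ) {a b : ℝ} (ha : 0 ≤ a)
    (hab : a < b) : ∃ s ∈ Ioo a b, Continuous fun t => μ t s := by
  have h : ∀ᵐ s ∂volume.restrict (Ioo a b), Differentiable ℝ fun t => μ t s :=
    ae_restrict_of_ae_restrict_of_subset (fun x hx => ha.trans_lt hx.1) hμ.differentiable
  have : NeBot (ae (volume.restrict (Ioo a b))) := by
    rw [ae_neBot]
    simp [hab]
  obtain ⟨s, h1, h2⟩ := (h.and (ae_restrict_mem measurableSet_Ioo)).exists
  exact ⟨s, h2, h1.continuous⟩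

theorem IsMemoryKernel.continuousAt (hμ : IsMemoryKernel μ) {t s : ℝ} (hs : 0 < s) :
    ContinuousAt μ.uncurry (t, s) := by
  rw [Metric.continuousAt_iff]
  intro ε hε
  obtain ⟨δ, hδ, hd⟩ := Metric.continuousAt_iff.1 (hμ.continuousAt_right t hs) (ε / 2)
      (by positivity)
  obtain ⟨s₁, h1, c1⟩ := hμ.dense_differentiable (a := max (s - δ) 0) (b := s) (le_max_right _ _)
    (max_lt (by linarith) hs)
  obtain ⟨s₂, h2, c2⟩ := hμ.dense_differentiable (a := s) (b := s + δ) hs.le (by linarith)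
  obtain ⟨η₁, hη₁, e1⟩ := Metric.continuousAt_iff.1 (c1.continuousAt (x := t)) (ε / 2)
      (by positivity)
  obtain ⟨η₂, hη₂, e2⟩ := Metric.continuousAt_iff.1 (c2.continuousAt (x := t)) (ε / 2)
      (by positivity)
  have h10 : 0 < s₁ := (le_max_right _ _).trans_lt h1.1
  have h11 : s - δ < s₁ := (le_max_left _ _).trans_lt h1.1
  refine ⟨min (min η₁ η₂) (min (s - s₁) (s₂ - s)),
    lt_min (lt_min hη₁ hη₂) (lt_min (by linarith [h1.2]) (by linarith [h2.1])), ?_⟩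
  rintro ⟨t', s'⟩ hts
  rw [Prod.dist_eq, max_lt_iff] at hts
  obtain ⟨ht, hs'⟩ := hts
  simp only [lt_min_iff] at ht hs'
  simp only [Real.dist_eq] at hs' ht hd e1 e2
  have f1 := e1 ht.1.1
  have f2 := e2 ht.1.2
  have g1 := @hd s₁ (abs_lt.2 ⟨by linarith, by linarith [h1.2]⟩)
  have g2 := @hd s₂ (abs_lt.2 ⟨by linarith [h2.1], by linarith [h2.2]⟩)
  have a1 := (abs_lt.1 hs'.2.1).1
  have a2 := (abs_lt.1 hs'.2.2).2
  have m1 : μ t' s' ≤ μ t' s₁ := hμ.antitone t' h10 (show 0 < s' by linarith) (by linarith)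
  have m2 : μ t' s₂ ≤ μ t' s' := hμ.antitone t' (show 0 < s' by linarith) (show 0 < s₂ by linarith)
    (by linarith)
  simp only [Function.uncurry, Real.dist_eq]
  rw [abs_lt] at f1 f2 g1 g2 ⊢
  constructor <;> linarith

/-- A continuous extension of the kernel from `s ≥ c`. -/
theorem IsMemoryKernel.continuous_extend (hμ : IsMemoryKernel μ) {c : ℝ} (hc : 0 < c) :
    Continuous (fun p q => μ p (max q c)).uncurry := by
  rw [continuous_iff_continuousAt]
  intro z
  exact (hμ.continuousAt (t := z.1) (s := max z.2 c) (lt_max_of_lt_right hc)).comp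
    (f := fun z : ℝ × ℝ => (z.1, max z.2 c)) (by fun_prop)

theorem IsMemoryKernel.continuousOn (hμ : IsMemoryKernel μ) :
    ContinuousOn μ.uncurry (univ ×ˢ Ioi 0) :=
  fun z hz => (hμ.continuousAt (t := z.1) (s := z.2) hz.2).continuousWithinAt

/-- The flux of the kernel through the boundary of a square. -/
theorem IsMemoryKernel.flux_le (hμ : IsMemoryKernel μ) {M : ℝ → ℝ} {M₀ : ℝ}
    (hM : ∀ t, ∀ᵐ s ∂volume.restrict (Ioi (0 : ℝ)),
      deriv (fun r => μ r s) t + deriv (μ t) s ≤ M t * μ t s)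
    {p q ε : ℝ} (hq : 0 < q) (hε : 0 ≤ ε) (hM₀ : ∀ r ∈ Icc p (p + ε), M r ≤ M₀) :
    ((∫ b in q..q + ε, μ (p + ε) b) - ∫ b in q..q + ε, μ p b) +
      ((∫ a in p..p + ε, μ a (q + ε)) - ∫ a in p..p + ε, μ a q) ≤
      M₀ * ∫ a in p..p + ε, ∫ b in q..q + ε, μ a b := by
  have hpp : p ≤ p + ε := by linarith
  have hqq : q ≤ q + ε := by linarith
  have hq' : 0 < q + ε := by linarith
  set D : ℝ → ℝ → ℝ := fun a b => deriv (fun r => μ r b) a with hD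
  have hpos : ∀ᵐ b ∂volume.restrict (Ioc q (q + ε)), 0 < b := by
    filter_upwards [ae_restrict_mem measurableSet_Ioc] with b hb using hq.trans hb.1
  have hsub : Ioc q (q + ε) ⊆ Ioi 0 := fun b hb => hq.trans hb.1
  have intD : Integrable (fun z : ℝ × ℝ => D z.1 z.2)
      ((volume.restrict (Ioc p (p + ε))).prod (volume.restrict (Ioc q (q + ε)))) := by
    rw [Measure.prod_restrict, ← Measure.volume_eq_prod]
    have h := hμ.locBdd_deriv (Icc p (p + ε) ×ˢ Icc q (q + ε)) (isCompact_Icc.prod isCompact_Icc)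
      (prod_mono (subset_univ _) fun b hb => hq.trans_le hb.1)
    have hfin : IsFiniteMeasure (volume.restrict (Icc p (p + ε) ×ˢ Icc q (q + ε))) :=
      ⟨by rw [Measure.restrict_apply_univ]
          exact (isCompact_Icc.prod isCompact_Icc).measure_lt_top⟩
    exact (h.integrable le_top).mono_measure
      (Measure.restrict_mono (Set.prod_mono Ioc_subset_Icc_self Ioc_subset_Icc_self) le_rfl)
  have cL : ∀ b, 0 < b → Continuous fun a => μ a b := fun b hb =>
    continuous_iff_continuousAt.2 fun a => (hμ.continuousAt (t := a) hb).comp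
      (f := fun a => (a, b)) (by fun_prop)
  have iR : ∀ a, IntervalIntegrable (μ a) volume q (q + ε) := fun a => by
    refine ContinuousOn.intervalIntegrable fun b hb => ?_
    rw [uIcc_of_le hqq] at hb
    exact (hμ.continuousAt_right a (hq.trans_le hb.1)).continuousWithinAt
  have cI : Continuous fun a => ∫ b in q..q + ε, μ a b := by
    have h1 : Continuous fun a => ∫ b in q..q + ε, μ a (max b q) :=
      (continuous_integral_snd (hμ.continuous_extend hq) ε).comp
        (by fun_prop : Continuous fun a => (a, q))
    convert! h1 using 2 with a
    refine intervalIntegral.integral_congr fun b hb => ?_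
    rw [uIcc_of_le hqq] at hb
    simp [max_eq_left hb.1]
  have first : ((∫ b in q..q + ε, μ (p + ε) b) - ∫ b in q..q + ε, μ p b) =
      ∫ a in Ioc p (p + ε), ∫ b in Ioc q (q + ε), D a b := by
    rw [← intervalIntegral.integral_sub (iR _) (iR _), intervalIntegral.integral_of_le hqq,
      integral_integral_swap intD]
    refine integral_congr_ae ?_
    filter_upwards [intD.prod_left_ae,
      ae_restrict_of_ae_restrict_of_subset hsub hμ.differentiable] with b h1 h2
    rw [← intervalIntegral.integral_of_le hpp]
    exact (intervalIntegral.integral_eq_sub_of_hasDerivAt (fun a _ => (h2 a).hasDerivAt)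
      ((intervalIntegrable_iff_integrableOn_Ioc_of_le hpp).2 h1)).symm
  have second : ((∫ a in p..p + ε, μ a (q + ε)) - ∫ a in p..p + ε, μ a q) =
      ∫ a in Ioc p (p + ε), (μ a (q + ε) - μ a q) := by
    rw [← intervalIntegral.integral_sub ((cL _ hq').intervalIntegrable _ _)
      ((cL _ hq).intervalIntegrable _ _), intervalIntegral.integral_of_le hpp]
  have i2 : IntegrableOn (fun a => μ a (q + ε) - μ a q) (Ioc p (p + ε)) :=
    (intervalIntegrable_iff_integrableOn_Ioc_of_le hpp).1
      (((cL _ hq').sub (cL _ hq)).intervalIntegrable _ _)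
  rw [first, second, ← integral_add intD.integral_prod_left i2,
      ← intervalIntegral.integral_const_mul,
    intervalIntegral.integral_of_le hpp]
  refine integral_mono_ae (intD.integral_prod_left.add i2)
    ((intervalIntegrable_iff_integrableOn_Ioc_of_le hpp).1
      ((cI.const_mul M₀).intervalIntegrable _ _)) ?_
  filter_upwards [intD.prod_right_ae, ae_restrict_mem measurableSet_Ioc] with a h1 ha
  have ac := hμ.absCont a q (q + ε) hq hqq
  have h2 : IntervalIntegrable (deriv (μ a)) volume q (q + ε) := ac.intervalIntegrable_deriv
  have h3 : IntervalIntegrable (D a) volume q (q + ε) :=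
    (intervalIntegrable_iff_integrableOn_Ioc_of_le hqq).2 h1
  rw [← ac.integral_deriv_eq_sub, ← intervalIntegral.integral_of_le hqq,
    ← intervalIntegral.integral_add h3 h2, ← intervalIntegral.integral_const_mul]
  refine intervalIntegral.integral_mono_ae_restrict hqq (h3.add h2) ((iR a).const_mul M₀) ?_
  have hsub' : Icc q (q + ε) ⊆ Ioi 0 := fun b hb => hq.trans_le hb.1
  filter_upwards [ae_restrict_of_ae_restrict_of_subset hsub' (hM a),
    ae_restrict_mem measurableSet_Icc] with b h4 hb
  refine h4.trans (mul_le_mul_of_nonneg_right (hM₀ a (Ioc_subset_Icc_self ha)) ?_)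
  exact (hμ.pos a b (hq.trans_le hb.1)).le

/-- The kernel grows at most exponentially along the characteristics. -/
theorem IsMemoryKernel.exists_growth (hμ : IsMemoryKernel μ) (τ T : ℝ) : ∃ M₀ ≥ 0,
    ∀ t ∈ Icc τ T, ∀ h ≥ 0, t + h ≤ T → ∀ s > 0, μ (t + h) (s + h) ≤ Real.exp (M₀ * h) * μ t s := by
  obtain ⟨M, hMpos, hMb, hM⟩ := hμ.growth
  obtain ⟨M₁, hM₁⟩ := hMb τ (T + 1)
  refine ⟨max M₁ 0, le_max_right _ _, fun t ht h hh hhT s hs => ?_⟩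
  set M₀ := max M₁ 0
  set m : ℝ → ℝ → ℝ := fun p q => μ p (max q s) with hm
  have hmc : Continuous m.uncurry := hμ.continuous_extend hs
  have em : ∀ p q, s ≤ q → m p q = μ p q := fun p q hq => by simp [hm, hq]
  rw [← em (t + h) (s + h) (by linarith), ← em t s le_rfl]
  refine le_of_squareIntegral_le hmc (Real.exp_pos _).le fun ε hε => ?_
  have hd := fun h => hasDerivAt_squareIntegral hmc ε t s h
  have hanti : AntitoneOn (fun h => Real.exp (-(M₀ * h)) * squareIntegral m ε (t + h) (s + h))
      (Icc 0 h) := by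
    have hd' : ∀ h, HasDerivAt
        (fun h => Real.exp (-(M₀ * h)) * squareIntegral m ε (t + h) (s + h)) _ h := fun h =>
      (((hasDerivAt_id h).const_mul M₀).neg.exp).mul (hd h)
    refine antitoneOn_of_deriv_nonpos (convex_Icc _ _)
      (fun x _ => (hd' x).continuousAt.continuousWithinAt)
      (fun x _ => (hd' x).differentiableAt.differentiableWithinAt) fun x hx => ?_
    rw [interior_Icc] at hx
    rw [(hd' x).deriv]
    have key := hμ.flux_le hM (p := t + x) (q := s + x) (ε := ε) (M₀ := M₀)
      (by linarith [hx.1]) hε.1.le (fun r hr => (hM₁ ⟨r, ⟨by linarith [hr.1, hx.1, ht.1], by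
        linarith [hr.2, hx.2, hε.2]⟩, rfl⟩).trans (le_max_left _ _))
    have i1 : ∀ p, ∫ b in s + x..s + x + ε, m p b = ∫ b in s + x..s + x + ε, μ p b := fun p =>
      intervalIntegral.integral_congr fun b hb => by
        rw [uIcc_of_le (by linarith [hε.1])] at hb
        exact em p b (by linarith [hb.1, hx.1])
    have i2 : squareIntegral m ε (t + x) (s + x) =
        ∫ a in t + x..t + x + ε, ∫ b in s + x..s + x + ε, μ a b := by
      unfold squareIntegral
      simp_rw [i1]
    simp only [i1, em _ (s + x + ε) (by linarith [hx.1, hε.1]), em _ (s + x) (by linarith [hx.1]),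
      i2, id, Pi.neg_apply]
    have := mul_le_mul_of_nonneg_left key (Real.exp_pos (-(M₀ * x))).le
    linarith
  have := hanti (left_mem_Icc.2 hh) (right_mem_Icc.2 hh) hh
  simp only [mul_zero, neg_zero, Real.exp_zero, one_mul, add_zero, Real.exp_neg] at this
  rwa [inv_mul_le_iff₀ (Real.exp_pos _)] at this

end Kernel

end

/-! ### Calculus of curves and quadratic forms -/

section

/-- A function whose increments are bounded by the product of the increments of two monotone
functions, one of them continuous, is nonincreasing. -/
theorem le_of_increment_le {Q θ p : ℝ → ℝ} {a b : ℝ} (hab : a ≤ b)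
    (hθ : ContinuousOn θ (Icc a b)) (hp : MonotoneOn p (Icc a b))
    (h : ∀ s ∈ Icc a b, ∀ t ∈ Icc a b, s ≤ t → Q t - Q s ≤ (θ t - θ s) * (p t - p s)) :
    Q b ≤ Q a := by
  rcases hab.eq_or_lt with rfl | hab'
  · exact le_rfl
  refine le_of_forall_pos_le_add fun η hη => ?_
  have ha : a ∈ Icc a b := left_mem_Icc.2 hab
  have hpab : 0 ≤ p b - p a := sub_nonneg.2 (hp ha (right_mem_Icc.2 hab) hab)
  set ε := η / (p b - p a + 1) with hε
  have hε0 : 0 < ε := by positivity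
  obtain ⟨δ, hδ, hd⟩ := Metric.uniformContinuousOn_iff.1
    (isCompact_Icc.uniformContinuousOn_of_continuous hθ) ε hε0
  obtain ⟨n, hn⟩ := exists_nat_gt ((b - a) / δ)
  have hn0 : (0 : ℝ) < n := lt_of_le_of_lt (by have := sub_pos.2 hab'; positivity) hn
  set d := (b - a) / n with hd'
  have hd0 : 0 < d := div_pos (sub_pos.2 hab') hn0
  have hdδ : d < δ := by
    rw [hd', div_lt_iff₀ hn0, mul_comm]
    rwa [div_lt_iff₀ hδ] at hn
  have hdn : n * d = b - a := by rw [hd']; field_simp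
  have mem : ∀ i : ℕ, i ≤ n → a + i * d ∈ Icc a b := by
    intro i hi
    have h1 : (i : ℝ) * d ≤ n * d := by gcongr
    have h2 : 0 ≤ (i : ℝ) * d := by positivity
    exact ⟨by linarith, by linarith⟩
  have key : ∀ i : ℕ, i ≤ n → Q (a + i * d) ≤ Q a + ε * (p (a + i * d) - p a) := by
    intro i
    induction i with
    | zero => intro _; simp
    | succ i ih =>
      intro hi
      have h1 := ih (by omega)
      have m1 := mem i (by omega)
      have m2 := mem (i + 1) hi
      have hle : a + (i : ℝ) * d ≤ a + ((i + 1 : ℕ) : ℝ) * d := by push_cast; linarith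
      have h2 := h _ m1 _ m2 hle
      have h3 := hd _ m2 _ m1 (by
        rw [Real.dist_eq]; push_cast
        rw [show a + ((i : ℝ) + 1) * d - (a + i * d) = d by ring, abs_of_pos hd0]; exact hdδ)
      rw [Real.dist_eq] at h3
      have h4 := hp m1 m2 hle
      have h5 : (θ (a + ((i + 1 : ℕ) : ℝ) * d) - θ (a + i * d)) *
          (p (a + ((i + 1 : ℕ) : ℝ) * d) - p (a + i * d)) ≤
          ε * (p (a + ((i + 1 : ℕ) : ℝ) * d) - p (a + i * d)) :=
        mul_le_mul_of_nonneg_right ((le_abs_self _).trans h3.le) (sub_nonneg.2 h4)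
      linarith
  have h1 := key n le_rfl
  rw [hdn, add_sub_cancel] at h1
  have h2 : ε * (p b - p a) ≤ η := by
    rw [hε, div_mul_eq_mul_div, div_le_iff₀ (by positivity)]
    nlinarith
  linarith

section Quadratic

variable {X : Type*} [NormedAddCommGroup X] [NormedSpace ℝ X]

theorem sub_eq_integral {x w : ℝ → X} {a b : ℝ} (hw : IntervalIntegrable w volume a b)
    (hx : ∀ t ∈ Icc a b, x t = x a + ∫ r in a..t, w r) {s t : ℝ} (hs : s ∈ Icc a b)
    (ht : t ∈ Icc a b) : x t - x s = ∫ r in s..t, w r := by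
  have hm : ∀ t ∈ Icc a b, IntervalIntegrable w volume a t := fun t ht =>
    hw.mono_set (by rw [uIcc_of_le ht.1, uIcc_of_le (ht.1.trans ht.2)]
                    exact Icc_subset_Icc le_rfl ht.2)
  rw [hx t ht, hx s hs, add_sub_add_left_eq_sub,
    intervalIntegral.integral_interval_sub_left (hm t ht) (hm s hs)]

theorem intervalIntegrable_sub {E : Type*} [NormedAddCommGroup E] {w : ℝ → E} {a b : ℝ}
    (hw : IntervalIntegrable w volume a b) {s t : ℝ} (hs : s ∈ Icc a b) (ht : t ∈ Icc a b) :
    IntervalIntegrable w volume s t :=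
  hw.mono_set (by
    rw [uIcc_of_le (hs.1.trans hs.2)]
    exact uIcc_subset_Icc hs ht)

theorem continuousOn_of_eq_integral {x w : ℝ → X} {a b : ℝ} (hab : a ≤ b)
    (hw : IntervalIntegrable w volume a b)
    (hx : ∀ t ∈ Icc a b, x t = x a + ∫ r in a..t, w r) : ContinuousOn x (Icc a b) := by
  have h1 := intervalIntegral.continuousOn_primitive_interval' hw left_mem_uIcc
  rw [uIcc_of_le hab] at h1
  exact (continuousOn_const.add h1).congr hx

theorem norm_sub_le_integral_norm {x w : ℝ → X} {a b : ℝ} (hw : IntervalIntegrable w volume a b)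
    (hx : ∀ t ∈ Icc a b, x t = x a + ∫ r in a..t, w r) {s t : ℝ} (hs : s ∈ Icc a b)
    (ht : t ∈ Icc a b) (hst : s ≤ t) :
    ‖x t - x s‖ ≤ (∫ r in a..t, ‖w r‖) - ∫ r in a..s, ‖w r‖ := by
  have ha : a ∈ Icc a b := left_mem_Icc.2 (hs.1.trans hs.2)
  rw [sub_eq_integral hw hx hs ht, intervalIntegral.integral_interval_sub_left
    (intervalIntegrable_sub hw.norm ha ht) (intervalIntegrable_sub hw.norm ha hs)]
  exact intervalIntegral.norm_integral_le_integral_norm hst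

theorem intervalIntegrable_weight_mul {β : X →L[ℝ] X →L[ℝ] ℝ}
    {x w : ℝ → X} {q : ℝ → ℝ} {a b : ℝ} (hab : a ≤ b) (hw : IntervalIntegrable w volume a b)
    (hxc : ContinuousOn x (Icc a b))
    (hq : AntitoneOn q (Icc a b)) (hq0 : ∀ t ∈ Icc a b, 0 ≤ q t) :
    IntervalIntegrable (fun r => q r * β (x r) (w r)) volume a b := by
  obtain ⟨B, hB⟩ := isCompact_Icc.exists_bound_of_continuousOn hxc
  rw [intervalIntegrable_iff_integrableOn_Ioc_of_le hab] at hw ⊢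
  have hqm : AEStronglyMeasurable q (volume.restrict (Ioc a b)) := by
    have : IntervalIntegrable q volume a b :=
      AntitoneOn.intervalIntegrable (by rwa [uIcc_of_le hab])
    exact ((intervalIntegrable_iff_integrableOn_Ioc_of_le hab).1 this).aestronglyMeasurable
  have hxm : AEStronglyMeasurable x (volume.restrict (Ioc a b)) :=
    (hxc.mono Ioc_subset_Icc_self).aestronglyMeasurable measurableSet_Ioc
  refine (hw.norm.const_mul (q a * (‖β‖ * B))).mono'
    (hqm.mul (β.aestronglyMeasurable_comp₂ hxm hw.aestronglyMeasurable)) ?_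
  filter_upwards [ae_restrict_mem measurableSet_Ioc] with r hr
  have hr' := Ioc_subset_Icc_self hr
  have h1 : q r ≤ q a := hq (left_mem_Icc.2 hab) hr' hr'.1
  have h2 := β.le_opNorm₂ (x r) (w r)
  have h3 := hB r hr'
  have h4 := hq0 r hr'
  rw [norm_mul, Real.norm_of_nonneg h4, mul_assoc]
  refine mul_le_mul h1 (h2.trans ?_) (norm_nonneg _) (h4.trans h1)
  gcongr

/-- The product of a quadratic form along a curve with an integrable derivative, and of a
nonincreasing weight. -/
theorem quadratic_le [CompleteSpace X] {β : X →L[ℝ] X →L[ℝ] ℝ} (hsymm : ∀ x y, β x y = β y x)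
    (h0 : ∀ x, 0 ≤ β x x)
    {x w : ℝ → X} {q : ℝ → ℝ} {a b : ℝ} (hab : a ≤ b) (hw : IntervalIntegrable w volume a b)
    (hx : ∀ t ∈ Icc a b, x t = x a + ∫ r in a..t, w r)
    (hq : AntitoneOn q (Icc a b)) (hq0 : ∀ t ∈ Icc a b, 0 ≤ q t) :
    q b * β (x b) (x b) ≤ q a * β (x a) (x a) + 2 * ∫ r in a..b, q r * β (x r) (w r) := by
  have hxc := continuousOn_of_eq_integral hab hw hx
  obtain ⟨B, hB⟩ := isCompact_Icc.exists_bound_of_continuousOn hxc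
  have ha : a ∈ Icc a b := left_mem_Icc.2 hab
  have hB0 : 0 ≤ B := (norm_nonneg _).trans (hB a ha)
  have hF := intervalIntegrable_weight_mul (β := β) hab hw hxc hq hq0
  set W : ℝ → ℝ := fun t => ∫ r in a..t, ‖w r‖ with hW
  set F : ℝ → ℝ := fun r => q r * β (x r) (w r) with hFdef
  have hWd : ∀ s ∈ Icc a b, ∀ t ∈ Icc a b, W t - W s = ∫ r in s..t, ‖w r‖ := fun s hs t ht =>
    intervalIntegral.integral_interval_sub_left (intervalIntegrable_sub hw.norm ha ht)
      (intervalIntegrable_sub hw.norm ha hs)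
  have hWm : MonotoneOn W (Icc a b) := fun s hs t ht hst => by
    rw [← sub_nonneg, hWd s hs t ht]
    exact intervalIntegral.integral_nonneg hst fun r _ => norm_nonneg _
  have hWc : ContinuousOn W (Icc a b) := by
    have h1 := intervalIntegral.continuousOn_primitive_interval' hw.norm left_mem_uIcc
    rwa [uIcc_of_le hab] at h1
  have hqa : 0 ≤ q a := hq0 a ha
  have main := le_of_increment_le (Q := fun t => q t * β (x t) (x t) - 2 * ∫ r in a..t, F r)
    (θ := W) (p := fun t => 3 * (q a * ‖β‖) * W t - 2 * (‖β‖ * B) * q t) hab hWc ?_ ?_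
  · simp only [intervalIntegral.integral_same, mul_zero, sub_zero] at main
    linarith
  · intro s hs t ht hst
    have h1 := mul_le_mul_of_nonneg_left (hWm hs ht hst) (show 0 ≤ 3 * (q a * ‖β‖) by positivity)
    have h2 := mul_le_mul_of_nonneg_left (hq hs ht hst) (show 0 ≤ 2 * (‖β‖ * B) by positivity)
    simp only
    linarith
  · intro s hs t ht hst
    have hwst := intervalIntegrable_sub hw hs ht
    have hFst := intervalIntegrable_sub hF hs ht
    have d1 : (∫ r in a..t, F r) - ∫ r in a..s, F r = ∫ r in s..t, F r :=
      intervalIntegral.integral_interval_sub_left (intervalIntegrable_sub hF ha ht)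
        (intervalIntegrable_sub hF ha hs)
    set δ := W t - W s with hδ
    have hδ0 : 0 ≤ δ := sub_nonneg.2 (hWm hs ht hst)
    have hxd : ‖x t - x s‖ ≤ δ := norm_sub_le_integral_norm hw hx hs ht hst
    have hqs : 0 ≤ q s := hq0 s hs
    have hqsa : q s ≤ q a := hq ha hs hs.1
    have hqts : q t ≤ q s := hq hs ht hst
    have e1 : β (x t) (x t) - β (x s) (x s) =
        β (x t - x s) (x t - x s) + 2 * ∫ r in s..t, β (x s) (w r) := by
      rw [ContinuousLinearMap.intervalIntegral_comp_comm _ hwst, ← sub_eq_integral hw hx hs ht]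
      simp only [map_sub, sub_apply]
      rw [hsymm (x t) (x s)]
      ring
    have e2 : q s * (∫ r in s..t, β (x s) (w r)) - ∫ r in s..t, F r ≤
        (q a * ‖β‖ * δ + (q s - q t) * (‖β‖ * B)) * δ := by
      have i1 : IntervalIntegrable (fun r => β (x s) (w r)) volume s t :=
        ⟨(β (x s)).integrable_comp hwst.1, (β (x s)).integrable_comp hwst.2⟩
      rw [← intervalIntegral.integral_const_mul, ← intervalIntegral.integral_sub
        (i1.const_mul _) hFst, hδ, hWd s hs t ht, ← intervalIntegral.integral_const_mul]
      refine intervalIntegral.integral_mono_on hst ((i1.const_mul _).sub hFst)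
        (hwst.norm.const_mul _) fun r hr => ?_
      have hr' : r ∈ Icc a b := ⟨hs.1.trans hr.1, hr.2.trans ht.2⟩
      rw [← hWd s hs t ht, ← hδ]
      have f1 : q s * β (x s) (w r) - F r =
          q s * β (x s - x r) (w r) + (q s - q r) * β (x r) (w r) := by
        simp only [hFdef, map_sub, sub_apply]; ring
      have f2 : β (x s - x r) (w r) ≤ ‖β‖ * δ * ‖w r‖ := by
        refine (le_abs_self _).trans ((β.le_opNorm₂ _ _).trans ?_)
        gcongr
        rw [norm_sub_rev]
        refine (norm_sub_le_integral_norm hw hx hs hr' hr.1).trans ?_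
        exact sub_le_sub_right (hWm hr' ht hr.2) _
      have f3 : β (x r) (w r) ≤ ‖β‖ * B * ‖w r‖ := by
        refine (le_abs_self _).trans ((β.le_opNorm₂ _ _).trans ?_)
        gcongr
        exact hB r hr'
      have f4 : 0 ≤ q s - q r := sub_nonneg.2 (hq hs hr' hr.1)
      have f5 : q s - q r ≤ q s - q t := sub_le_sub_left (hq hr' ht hr.2) _
      rw [f1]
      have g1 := mul_le_mul_of_nonneg_left f2 hqs
      have g2 := mul_le_mul_of_nonneg_left f3 f4
      have g3 : q s * (‖β‖ * δ * ‖w r‖) ≤ q a * (‖β‖ * δ * ‖w r‖) := by gcongr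
      have g4 : (q s - q r) * (‖β‖ * B * ‖w r‖) ≤ (q s - q t) * (‖β‖ * B * ‖w r‖) := by gcongr
      linarith
    have e3 : β (x t - x s) (x t - x s) ≤ ‖β‖ * δ * δ := by
      refine (le_abs_self _).trans ((β.le_opNorm₂ _ _).trans ?_)
      gcongr
    have e4 : q t * β (x t) (x t) ≤ q s * β (x t) (x t) :=
      mul_le_mul_of_nonneg_right hqts (h0 _)
    have e5 : q s * β (x t - x s) (x t - x s) ≤ q a * (‖β‖ * δ * δ) :=
      mul_le_mul hqsa e3 (h0 _) hqa
    have e6 := congrArg (q s * ·) e1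
    nlinarith [e2, e4, e5, e6, d1]

end Quadratic

/-- The integral form of the Grönwall inequality. -/
theorem gronwall_integral {φ : ℝ → ℝ} {A B a b : ℝ} (hB : 0 ≤ B)
    (hφ : IntervalIntegrable φ volume a b)
    (h : ∀ t ∈ Icc a b, φ t ≤ A + B * ∫ r in a..t, φ r) :
    ∀ t ∈ Icc a b, φ t ≤ A * Real.exp (B * (t - a)) := by
  intro t ht
  have hab : a ≤ b := ht.1.trans ht.2
  have ha : a ∈ Icc a b := left_mem_Icc.2 hab
  set ψ : ℝ → ℝ := fun t => A + B * ∫ r in a..t, φ r with hψ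
  have hψc : ContinuousOn ψ (Icc a b) := by
    have h1 := intervalIntegral.continuousOn_primitive_interval' hφ left_mem_uIcc
    rw [uIcc_of_le hab] at h1
    exact continuousOn_const.add (continuousOn_const.mul h1)
  have hψi : IntervalIntegrable ψ volume a b :=
    ContinuousOn.intervalIntegrable (by rwa [uIcc_of_le hab])
  have hψ2 : ∀ t ∈ Icc a b, ψ t ≤ A + B * ∫ r in a..t, ψ r := by
    intro t ht
    simp only [hψ]
    gcongr
    exact intervalIntegral.integral_mono_on ht.1 (intervalIntegrable_sub hφ ha ht)
      (intervalIntegrable_sub hψi ha ht) fun r hr => h r ⟨hr.1, hr.2.trans ht.2⟩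
  have hd : ∀ t ∈ Ico a b, HasDerivWithinAt (fun t => A + B * ∫ r in a..t, ψ r) (B * ψ t)
      (Ici t) t := by
    intro t ht
    have ht' := Ico_subset_Icc_self ht
    refine (HasDerivWithinAt.const_mul B ?_).const_add A
    refine intervalIntegral.integral_hasDerivWithinAt_right (intervalIntegrable_sub hψi ha ht')
      (s := Ici t) (t := Ioi t) ?_ ?_
    · exact ⟨Ioc t b, Ioc_mem_nhdsGT ht.2,
        ((hψc.mono (Ioc_subset_Icc_self.trans (Icc_subset_Icc ht.1 le_rfl))).aestronglyMeasurable
          measurableSet_Ioc)⟩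
    · refine (hψc t ht').mono_of_mem_nhdsWithin ?_
      exact mem_of_superset (Ioc_mem_nhdsGT ht.2)
        (Ioc_subset_Icc_self.trans (Icc_subset_Icc ht.1 le_rfl))
  have hc : ContinuousOn (fun t => A + B * ∫ r in a..t, ψ r) (Icc a b) := by
    have h1 := intervalIntegral.continuousOn_primitive_interval' hψi left_mem_uIcc
    rw [uIcc_of_le hab] at h1
    exact continuousOn_const.add (continuousOn_const.mul h1)
  have := le_gronwallBound_of_liminf_deriv_right_le (δ := A) (K := B) (ε := 0) hc
    (f' := fun t => B * ψ t)
    (fun x hx r hr => (hd x hx).liminf_right_slope_le hr) (by simp)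
    (fun x hx => by
      rw [add_zero]
      exact mul_le_mul_of_nonneg_left (hψ2 x (Ico_subset_Icc_self hx)) hB) t ht
  rw [gronwallBound_ε0] at this
  exact ((h t ht).trans (hψ2 t ht)).trans this

end

/-! ### Weak time derivatives -/

section

section Weak

variable {X : Type*} [NormedAddCommGroup X] [NormedSpace ℝ X]

/-- A test function with zero mean is the derivative of a test function. -/
theorem exists_test_primitive {a b : ℝ} {θ : ℝ → ℝ} (h1 : ContDiff ℝ ∞ θ)
    (h2 : HasCompactSupport θ) (h3 : tsupport θ ⊆ Ioo a b) (h4 : ∫ t, θ t = 0) :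
    ∃ ζ : ℝ → ℝ, ContDiff ℝ ∞ ζ ∧ HasCompactSupport ζ ∧ tsupport ζ ⊆ Ioo a b ∧ deriv ζ = θ := by
  obtain ⟨c, d, hcd, hsub⟩ : ∃ c d, tsupport θ ⊆ Icc c d ∧ (Icc c d ⊆ Ioo a b) := by
    rcases (tsupport θ).eq_empty_or_nonempty with h | h
    · exact ⟨1, 0, by simp [h], by simp⟩
    · obtain ⟨c, hc⟩ := IsCompact.exists_isLeast h2 h
      obtain ⟨d, hd⟩ := IsCompact.exists_isGreatest h2 h
      exact ⟨c, d, fun x hx => ⟨hc.2 hx, hd.2 hx⟩, Icc_subset_Ioo (h3 hc.1).1 (h3 hd.1).2⟩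
  have hc : Continuous θ := h1.continuous
  have hd : ∀ t, HasDerivAt (fun t => ∫ r in c..t, θ r) (θ t) t := fun t =>
    intervalIntegral.integral_hasDerivAt_right (hc.intervalIntegrable _ _)
      (hc.stronglyMeasurableAtFilter _ _) hc.continuousAt
  have hderiv : deriv (fun t => ∫ r in c..t, θ r) = θ := funext fun t => (hd t).deriv
  have z : ∀ r, r ∉ Icc c d → θ r = 0 := fun r hr =>
    image_eq_zero_of_notMem_tsupport fun h => hr (hcd h)
  have hzero : ∀ t, t ∉ Icc c d → ∫ r in c..t, θ r = 0 := by
    intro t ht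
    rcases lt_or_ge t c with h | h
    · rw [intervalIntegral.integral_symm, intervalIntegral.integral_of_le h.le, neg_eq_zero]
      rw [← integral_Ico_eq_integral_Ioc]
      exact setIntegral_eq_zero_of_forall_eq_zero fun r hr => z r fun hr' => hr'.1.not_gt hr.2
    · have htd : d < t := by
        by_contra h'
        exact ht ⟨h, not_lt.1 h'⟩
      rw [intervalIntegral.integral_of_le h, ← h4, ← integral_Icc_eq_integral_Ioc]
      refine setIntegral_eq_integral_of_forall_compl_eq_zero fun r hr => z r fun hr' => ?_
      exact hr ⟨hr'.1, hr'.2.trans htd.le⟩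
  have hts : tsupport (fun t => ∫ r in c..t, θ r) ⊆ Icc c d := by
    refine closure_minimal (fun t ht => ?_) isClosed_Icc
    by_contra h
    exact ht (hzero t h)
  refine ⟨fun t => ∫ r in c..t, θ r, ?_, ?_, hts.trans hsub, hderiv⟩
  · rw [contDiff_infty_iff_deriv, hderiv]
    exact ⟨fun t => (hd t).differentiableAt, h1⟩
  · exact HasCompactSupport.of_support_subset_isCompact isCompact_Icc
      ((subset_tsupport _).trans hts)

theorem integral_deriv_smul_primitive [CompleteSpace X] {a b : ℝ} {w : ℝ → X}
    (hw : IntegrableOn w (Ioo a b)) {ζ : ℝ → ℝ} (h1 : ContDiff ℝ ∞ ζ)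
    (h3 : tsupport ζ ⊆ Ioo a b) :
    ∫ t in Ioo a b, deriv ζ t • ∫ r in a..t, w r = -∫ t in Ioo a b, ζ t • w t := by
  have hdc : Continuous (deriv ζ) := h1.continuous_deriv (by simp)
  have hζb : ζ b = 0 := image_eq_zero_of_notMem_tsupport fun h => (h3 h).2.false
  have hdi : IntegrableOn (deriv ζ) (Ioo a b) :=
    (hdc.continuousOn.integrableOn_compact isCompact_Icc).mono_set Ioo_subset_Icc_self
  have e1 : ∀ t ∈ Ioo a b, deriv ζ t • ∫ r in a..t, w r =
      ∫ r in Ioo a b, (if r ≤ t then deriv ζ t • w r else 0) := by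
    intro t ht
    rw [intervalIntegral.integral_of_le ht.1.le, ← integral_smul, ← integral_indicator
      measurableSet_Ioc, ← integral_indicator measurableSet_Ioo]
    congr 1
    funext r
    simp only [indicator, mem_Ioc, mem_Ioo]
    by_cases h1 : a < r <;> by_cases h2 : r ≤ t
    · have : r < b := h2.trans_lt ht.2
      simp [h1, h2, this]
    all_goals simp [h1, h2]
  have hint : Integrable (fun z : ℝ × ℝ => if z.2 ≤ z.1 then deriv ζ z.1 • w z.2 else 0)
      ((volume.restrict (Ioo a b)).prod (volume.restrict (Ioo a b))) := by
    have h := Integrable.smul_prod hdi hw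
    exact h.indicator (s := {z : ℝ × ℝ | z.2 ≤ z.1})
        (measurableSet_le measurable_snd measurable_fst)
  rw [setIntegral_congr_fun measurableSet_Ioo e1,
    integral_integral_swap (f := fun t r => if r ≤ t then deriv ζ t • w r else 0) hint,
    ← integral_neg]
  refine setIntegral_congr_fun measurableSet_Ioo fun r hr => ?_
  have e2 : ∫ t in Ioo a b, (if r ≤ t then deriv ζ t • w r else 0) =
      (∫ t in r..b, deriv ζ t) • w r := by
    have e3 : (∫ t in r..b, deriv ζ t) = ∫ t in Ico r b, deriv ζ t := by
      rw [intervalIntegral.integral_of_le hr.2.le, integral_Ico_eq_integral_Ioc]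
    rw [e3, ← integral_smul_const, ← integral_indicator measurableSet_Ioo,
      ← integral_indicator measurableSet_Ico]
    congr 1
    funext t
    simp only [indicator, mem_Ico, mem_Ioo]
    by_cases h1 : r ≤ t
    · have : a < t := hr.1.trans_le h1
      simp [h1, this]
    · simp [h1]
  rw [e2, intervalIntegral.integral_deriv_eq_sub (fun t _ => h1.differentiable (by simp) t)
    (hdc.intervalIntegrable _ _), hζb, zero_sub, neg_smul]

/-- A function with an integrable weak derivative is, up to a constant, the integral of it. -/
theorem HasWeakTimeDeriv.exists_ae_eq [CompleteSpace X] {a b : ℝ} (hab : a < b) {u w : ℝ → X}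
    (h : HasWeakTimeDeriv a b u w) :
    ∃ c : X, ∀ᵐ t ∂volume.restrict (Ioo a b), u t = c + ∫ r in a..t, w r := by
  obtain ⟨hu, hw, hd⟩ := h
  obtain ⟨ρ, hρ1, hρ2, hρ3, hρ4⟩ : ∃ ρ : ℝ → ℝ, ContDiff ℝ ∞ ρ ∧ HasCompactSupport ρ ∧
      tsupport ρ ⊆ Ioo a b ∧ ∫ t, ρ t = 1 := by
    let f : ContDiffBump ((a + b) / 2) := ⟨(b - a) / 8, (b - a) / 4, by linarith, by linarith⟩
    refine ⟨f.normed volume, f.contDiff_normed, f.hasCompactSupport_normed, ?_, f.integral_normed⟩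
    rw [f.tsupport_normed_eq, Real.closedBall_eq_Icc]
    exact Icc_subset_Ioo (by simp only [f]; linarith) (by simp only [f]; linarith)
  set W : ℝ → X := fun t => ∫ r in a..t, w r with hW
  have hwi : IntervalIntegrable w volume a b :=
    (intervalIntegrable_iff_integrableOn_Ioo_of_le hab.le).2 hw
  have hWc : ContinuousOn W (Icc a b) := by
    have h1 := intervalIntegral.continuousOn_primitive_interval' hwi left_mem_uIcc
    rwa [uIcc_of_le hab.le] at h1
  have hWi : IntegrableOn W (Ioo a b) :=
    (hWc.integrableOn_compact isCompact_Icc).mono_set Ioo_subset_Icc_self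
  set U : ℝ → X := fun t => u t - W t with hU
  have hUi : IntegrableOn U (Ioo a b) := hu.sub hWi
  have smul_int : ∀ {g : ℝ → ℝ} {V : ℝ → X}, Continuous g → HasCompactSupport g →
      IntegrableOn V (Ioo a b) → IntegrableOn (fun t => g t • V t) (Ioo a b) := by
    intro g V hg hgs hV
    obtain ⟨C, hC⟩ := hgs.exists_bound_of_continuous hg
    exact hV.bdd_smul C hg.aestronglyMeasurable (Eventually.of_forall hC)
  have hU0 : ∀ ζ : ℝ → ℝ, ContDiff ℝ ∞ ζ → HasCompactSupport ζ → tsupport ζ ⊆ Ioo a b →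
      ∫ t in Ioo a b, deriv ζ t • U t = 0 := by
    intro ζ h1 h2 h3
    have hdc : Continuous (deriv ζ) := h1.continuous_deriv (by simp)
    have hds : HasCompactSupport (deriv ζ) := h2.deriv
    simp only [hU, smul_sub]
    rw [integral_sub (smul_int hdc hds hu) (smul_int hdc hds hWi), hd ζ h1 h2 h3,
      integral_deriv_smul_primitive hw h1 h3, sub_self]
  set c : X := ∫ t in Ioo a b, ρ t • U t with hc
  refine ⟨c, ?_⟩
  have hfin : IntegrableOn (fun t => U t - c) (Ioo a b) :=
    hUi.sub (integrableOn_const (by simp))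
  have key : ∀ᵐ t ∂volume, t ∈ Ioo a b → U t - c = 0 := by
    refine isOpen_Ioo.ae_eq_zero_of_integral_contDiff_smul_eq_zero
      hfin.locallyIntegrableOn fun ψ h1 h2 h3 => ?_
    set k := ∫ t, ψ t with hk
    have hψi : Integrable ψ := h1.continuous.integrable_of_hasCompactSupport h2
    have hρi : Integrable ρ := hρ1.continuous.integrable_of_hasCompactSupport hρ2
    obtain ⟨ζ, g1, g2, g3, g4⟩ := exists_test_primitive (θ := fun t => ψ t - k * ρ t)
      (h1.sub (contDiff_const.mul hρ1)) (h2.sub hρ2.mul_left)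
      ((tsupport_sub _ _).trans (union_subset h3 ((tsupport_mul_subset_right).trans hρ3)))
      (by rw [integral_sub hψi (hρi.const_mul k), integral_const_mul, hρ4, mul_one, sub_self])
    have h5 := hU0 ζ g1 g2 g3
    rw [g4] at h5
    simp only [sub_smul, mul_smul] at h5
    rw [integral_sub (g := fun t => k • ρ t • U t) (smul_int h1.continuous h2 hUi)
      ((smul_int hρ1.continuous hρ2 hUi).smul k), integral_smul, ← hc] at h5
    rw [← setIntegral_eq_integral_of_forall_compl_eq_zero (s := Ioo a b)]
    · simp only [smul_sub]
      rw [integral_sub (smul_int h1.continuous h2 hUi)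
        (smul_int h1.continuous h2 (integrableOn_const (by simp))), integral_smul_const]
      have : ∫ t in Ioo a b, ψ t = k :=
        setIntegral_eq_integral_of_forall_compl_eq_zero fun t ht =>
          image_eq_zero_of_notMem_tsupport fun h => ht (h3 h)
      rw [this, h5]
    · intro t ht
      rw [image_eq_zero_of_notMem_tsupport fun h => ht (h3 h), zero_smul]
  rw [ae_restrict_iff' measurableSet_Ioo]
  filter_upwards [key] with t ht htm
  have := ht htm
  rw [sub_eq_zero] at this
  rw [← this]
  simp [hU, hW]

theorem HasWeakTimeDeriv.eq_integral [CompleteSpace X] {a b : ℝ} (hab : a < b) {u w : ℝ → X}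
    (h : HasWeakTimeDeriv a b u w) (hu : ContinuousOn u (Icc a b)) :
    IntervalIntegrable w volume a b ∧ ∀ t ∈ Icc a b, u t = u a + ∫ r in a..t, w r := by
  have hwi : IntervalIntegrable w volume a b :=
    (intervalIntegrable_iff_integrableOn_Ioo_of_le hab.le).2 h.2.1
  refine ⟨hwi, ?_⟩
  obtain ⟨c, hc⟩ := h.exists_ae_eq hab
  have hWc : ContinuousOn (fun t => c + ∫ r in a..t, w r) (Icc a b) := by
    have h1 := intervalIntegral.continuousOn_primitive_interval' hwi left_mem_uIcc
    rw [uIcc_of_le hab.le] at h1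
    exact continuousOn_const.add h1
  rw [Measure.restrict_congr_set Ioo_ae_eq_Icc] at hc
  have heq := Measure.eqOn_Icc_of_ae_eq volume hab.ne hc hu hWc
  intro t ht
  have h0 := heq (left_mem_Icc.2 hab.le)
  simp only [intervalIntegral.integral_same, add_zero] at h0
  rw [heq ht, h0]

end Weak

end

/-! ### Curves with memory -/

section

variable {μ : ℝ → ℝ → ℝ}

/-- The kernel `μ_t`, extended by zero to the nonpositive half-line. -/
def kernelExt (μ : ℝ → ℝ → ℝ) (t s : ℝ) : ℝ := (Ioi (0 : ℝ)).indicator (μ t) s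

theorem kernelExt_of_pos (t : ℝ) {s : ℝ} (hs : 0 < s) : kernelExt μ t s = μ t s :=
  indicator_of_mem (mem_Ioi.2 hs) _

theorem kernelExt_of_nonpos (t : ℝ) {s : ℝ} (hs : s ≤ 0) : kernelExt μ t s = 0 :=
  indicator_of_notMem (by simpa using hs) _

theorem IsMemoryKernel.kernelExt_nonneg (hμ : IsMemoryKernel μ) (t s : ℝ) :
    0 ≤ kernelExt μ t s := by
  rcases le_or_gt s 0 with h | h
  · rw [kernelExt_of_nonpos t h]
  · rw [kernelExt_of_pos t h]; exact (hμ.pos t s h).le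

theorem IsMemoryKernel.integrable_kernelExt (hμ : IsMemoryKernel μ) (t : ℝ) :
    Integrable (kernelExt μ t) :=
  (integrable_indicator_iff measurableSet_Ioi).2 (hμ.summable t)

theorem IsMemoryKernel.measurable_kernelExt (hμ : IsMemoryKernel μ) :
    Measurable (fun p : ℝ × ℝ => kernelExt μ p.1 p.2) := by
  have hs : MeasurableSet (univ ×ˢ Ioi (0 : ℝ) : Set (ℝ × ℝ)) :=
      MeasurableSet.univ.prod measurableSet_Ioi
  have h := hμ.continuousOn.measurable_piecewise (continuousOn_const (c := (0 : ℝ))) hs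
  convert h using 1
  ext p
  rcases le_or_gt p.2 0 with h | h
  · rw [kernelExt_of_nonpos _ h, piecewise_eq_of_notMem _ _ _ (by simpa using h)]
  · rw [kernelExt_of_pos _ h, piecewise_eq_of_mem _ _ _ (by simpa using h)]; rfl

theorem setIntegral_Ioi_kernel {E : Type*} [NormedAddCommGroup E] [NormedSpace ℝ E] (t : ℝ)
    (G : ℝ → E) : ∫ s in Ioi (0 : ℝ), μ t s • G s = ∫ s, kernelExt μ t s • G s := by
  rw [← integral_indicator measurableSet_Ioi]
  congr 1 with s
  rcases le_or_gt s 0 with h | h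
  · rw [kernelExt_of_nonpos _ h, indicator_of_notMem (by simpa using h), zero_smul]
  · rw [kernelExt_of_pos _ h, indicator_of_mem (mem_Ioi.2 h)]

theorem setIntegral_Ioi_kernel_sub (t : ℝ) (G : ℝ → ℝ) :
    ∫ s in Ioi (0 : ℝ), μ t s * G (t - s) = ∫ a, kernelExt μ t (t - a) * G a := by
  have h := setIntegral_Ioi_kernel (μ := μ) t (fun s => G (t - s))
  simp only [smul_eq_mul] at h
  rw [h, ← integral_sub_left_eq_self (fun a => kernelExt μ t (t - a) * G a) volume t]
  simp

theorem IsMemoryKernel.aemeasurable_density (hμ : IsMemoryKernel μ) (t : ℝ) :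
    AEMeasurable (fun s => ENNReal.ofReal (μ t s)) (volume.restrict (Ioi 0)) :=
  (hμ.summable t).aestronglyMeasurable.aemeasurable.ennreal_ofReal

theorem IsMemoryKernel.integrable_memMeasure_iff {E : Type*} [NormedAddCommGroup E]
    [NormedSpace ℝ E] (hμ : IsMemoryKernel μ) (t : ℝ) {G : ℝ → E} :
    Integrable G (memMeasure μ t) ↔ Integrable (fun s => kernelExt μ t s • G s) := by
  rw [memMeasure, integrable_withDensity_iff_integrable_smul₀' (hμ.aemeasurable_density t)
    (ae_of_all _ fun _ => ENNReal.ofReal_lt_top), ← IntegrableOn,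
    ← integrable_indicator_iff measurableSet_Ioi]
  refine integrable_congr (ae_of_all _ fun s => ?_)
  rcases le_or_gt s 0 with h | h
  · dsimp only
    rw [kernelExt_of_nonpos _ h, indicator_of_notMem (by simpa using h), zero_smul]
  · dsimp only
    rw [kernelExt_of_pos _ h, indicator_of_mem (mem_Ioi.2 h),
      ENNReal.toReal_ofReal (hμ.pos t s h).le]

theorem IsMemoryKernel.integral_memMeasure {E : Type*} [NormedAddCommGroup E]
    [NormedSpace ℝ E] (hμ : IsMemoryKernel μ) (t : ℝ) (G : ℝ → E) :
    ∫ s, G s ∂memMeasure μ t = ∫ s in Ioi (0 : ℝ), μ t s • G s := by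
  rw [memMeasure, integral_withDensity_eq_integral_toReal_smul₀ (hμ.aemeasurable_density t)
    (ae_of_all _ fun _ => ENNReal.ofReal_lt_top)]
  refine setIntegral_congr_fun measurableSet_Ioi fun s hs => ?_
  rw [ENNReal.toReal_ofReal (hμ.pos t s hs).le]

theorem IsMemoryKernel.isFiniteMeasure (hμ : IsMemoryKernel μ) (t : ℝ) :
    IsFiniteMeasure (memMeasure μ t) := by
  refine isFiniteMeasure_withDensity_ofReal ?_
  exact (hμ.summable t).2

theorem memMeasure_absolutelyContinuous (t : ℝ) :
    memMeasure μ t ≪ volume.restrict (Ioi 0) := withDensity_absolutelyContinuous _ _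

theorem IsMemoryKernel.absolutelyContinuous_memMeasure (hμ : IsMemoryKernel μ) (t : ℝ) :
    volume.restrict (Ioi 0) ≪ memMeasure μ t := by
  refine withDensity_absolutelyContinuous' (hμ.aemeasurable_density t) ?_
  filter_upwards [ae_restrict_mem measurableSet_Ioi] with s hs
  simpa using hμ.pos t s hs

/-- The kernel decays along the characteristics, up to the exponential factor of rate `M₀`. -/
def HasGrowth (μ : ℝ → ℝ → ℝ) (τ T M₀ : ℝ) : Prop :=
  0 ≤ M₀ ∧ ∀ t ∈ Icc τ T, ∀ h ≥ 0, t + h ≤ T → ∀ s > 0, μ (t + h) (s + h) ≤ Real.exp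
      (M₀ * h) * μ t s

theorem HasGrowth.antitoneOn {τ T M₀ a : ℝ} (h : HasGrowth μ τ T M₀) {r₀ r : ℝ}
    (h1 : r₀ ∈ Icc τ T) (h2 : r ∈ Icc τ T) (har : a < r₀) (hr : r₀ ≤ r) :
    Real.exp (-M₀ * (r - τ)) * kernelExt μ r (r - a) ≤
      Real.exp (-M₀ * (r₀ - τ)) * kernelExt μ r₀ (r₀ - a) := by
  rw [kernelExt_of_pos _ (by linarith), kernelExt_of_pos _ (by linarith)]
  have h3 := h.2 r₀ h1 (r - r₀) (by linarith) (by linarith [h2.2]) (r₀ - a) (by linarith)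
  rw [show r₀ + (r - r₀) = r by ring, show r₀ - a + (r - r₀) = r - a by ring] at h3
  have h4 := mul_le_mul_of_nonneg_left h3 (Real.exp_pos (-M₀ * (r - τ))).le
  rw [← mul_assoc, ← Real.exp_add] at h4
  rwa [show -M₀ * (r - τ) + M₀ * (r - r₀) = -M₀ * (r₀ - τ) by ring] at h4

variable {X : Type*} [NormedAddCommGroup X] [NormedSpace ℝ X]

/-- A curve, given for all times up to `T`, with bounded derivative `v` on `[τ, T]` and with past
increments of finite energy. -/
structure IsMemoryCurve (μ : ℝ → ℝ → ℝ) (τ T V : ℝ) (y v : ℝ → X) : Prop where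
  le : τ ≤ T
  meas : AEStronglyMeasurable y volume
  integrable : IntervalIntegrable v volume τ T
  bdd : ∀ᵐ r ∂volume.restrict (Icc τ T), ‖v r‖ ≤ V
  bdd_nonneg : 0 ≤ V
  eq_integral : ∀ t ∈ Icc τ T, y t = y τ + ∫ r in τ..t, v r
  past : MemLp (fun s => y τ - y (τ - s)) 2 (memMeasure μ τ)

namespace IsMemoryCurve

variable {τ T V M₀ : ℝ} {y v : ℝ → X}

theorem eq_integral_of_mem (h : IsMemoryCurve μ τ T V y v) {s : ℝ}
    (hs : s ∈ Icc τ T) : ∀ t ∈ Icc s T, y t = y s + ∫ r in s..t, v r := fun t ht => by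
  rw [← sub_eq_integral h.integrable h.eq_integral hs ⟨hs.1.trans ht.1, ht.2⟩]
  abel

theorem continuousOn (h : IsMemoryCurve μ τ T V y v) : ContinuousOn y (Icc τ T) :=
  continuousOn_of_eq_integral h.le h.integrable h.eq_integral

theorem norm_sub_le (h : IsMemoryCurve μ τ T V y v) {s t : ℝ} (hs : s ∈ Icc τ T) (ht : t ∈ Icc τ T)
    (hst : s ≤ t) : ‖y t - y s‖ ≤ V * (t - s) := by
  rw [sub_eq_integral h.integrable h.eq_integral hs ht]
  have h1 := intervalIntegral.norm_integral_le_of_norm_le_const_ae (f := v) (a := s) (b := t)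
    (C := V) ?_
  · rwa [abs_of_nonneg (sub_nonneg.2 hst)] at h1
  · have h2 := (ae_restrict_iff' measurableSet_Icc).1 h.bdd
    filter_upwards [h2] with r hr hr'
    rw [uIoc_of_le hst] at hr'
    exact hr ⟨hs.1.trans hr'.1.le, hr'.2.trans ht.2⟩

theorem exists_bound (h : IsMemoryCurve μ τ T V y v) : ∃ B ≥ 0, ∀ t ∈ Icc τ T, ‖y t‖ ≤ B := by
  obtain ⟨B, hB⟩ := isCompact_Icc.exists_bound_of_continuousOn h.continuousOn
  exact ⟨B, (norm_nonneg _).trans (hB τ (left_mem_Icc.2 h.le)), hB⟩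

theorem memLp (h : IsMemoryCurve μ τ T V y v) (hμ : IsMemoryKernel μ) (hM : HasGrowth μ τ T M₀)
    {t : ℝ} (ht : t ∈ Icc τ T) : MemLp (fun s => y t - y (t - s)) 2 (memMeasure μ t) := by
  have hm : AEStronglyMeasurable (fun s => y t - y (t - s)) volume :=
    aestronglyMeasurable_const.sub
      (h.meas.comp_quasiMeasurePreserving (quasiMeasurePreserving_sub_left volume t))
  have hm0 : AEStronglyMeasurable (fun s => y τ - y (τ - s)) volume :=
    aestronglyMeasurable_const.sub
      (h.meas.comp_quasiMeasurePreserving (quasiMeasurePreserving_sub_left volume τ))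
  rw [memLp_two_iff_integrable_sq_norm (hm.restrict.mono_ac (memMeasure_absolutelyContinuous t)),
    hμ.integrable_memMeasure_iff]
  obtain ⟨B, hB0, hB⟩ := h.exists_bound
  have h0 := h.past
  rw [memLp_two_iff_integrable_sq_norm (hm0.restrict.mono_ac (memMeasure_absolutelyContinuous τ)),
    hμ.integrable_memMeasure_iff] at h0
  have h1 : Integrable fun s => kernelExt μ τ (s - (t - τ)) • ‖y τ - y (τ - (s - (t - τ)))‖ ^ 2 :=
    h0.comp_sub_right (t - τ)
  have h2 : Integrable fun s => kernelExt μ τ (s - (t - τ)) :=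
    (hμ.integrable_kernelExt τ).comp_sub_right (t - τ)
  set E := Real.exp (M₀ * (t - τ))
  have hbd : Integrable fun s => (2 * B) ^ 2 * kernelExt μ t s +
      E * (2 * (kernelExt μ τ (s - (t - τ)) • ‖y τ - y (τ - (s - (t - τ)))‖ ^ 2) +
        2 * (2 * B) ^ 2 * kernelExt μ τ (s - (t - τ))) :=
    ((hμ.integrable_kernelExt t).const_mul _).add
      (((h1.const_mul 2).add (h2.const_mul _)).const_mul _)
  refine hbd.mono' ?_ (ae_of_all _ fun s => ?_)
  · exact (hμ.integrable_kernelExt t).aestronglyMeasurable.smul (hm.norm.pow 2)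
  have hk := hμ.kernelExt_nonneg t s
  have hk' := hμ.kernelExt_nonneg τ (s - (t - τ))
  have hE : 0 < E := Real.exp_pos _
  simp only [smul_eq_mul, norm_mul, Real.norm_eq_abs, abs_of_nonneg hk, abs_pow, abs_norm]
  rcases le_or_gt s 0 with hs | hs
  · rw [kernelExt_of_nonpos _ hs]
    simp only [zero_mul, mul_zero, zero_add]
    positivity
  rcases le_or_gt s (t - τ) with hst | hst
  · have h3 : t - s ∈ Icc τ T := ⟨by linarith, by linarith [ht.2]⟩
    have h4 : ‖y t - y (t - s)‖ ≤ 2 * B :=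
      (_root_.norm_sub_le _ _).trans (by linarith [hB _ h3, hB _ ht])
    have h5 : ‖y t - y (t - s)‖ ^ 2 ≤ (2 * B) ^ 2 := by gcongr
    have h6 : 0 ≤ E * (2 * (kernelExt μ τ (s - (t - τ)) * ‖y τ - y (τ - (s - (t - τ)))‖ ^ 2) +
        2 * (2 * B) ^ 2 * kernelExt μ τ (s - (t - τ))) := by positivity
    nlinarith [mul_le_mul_of_nonneg_left h5 hk]
  · have e : τ - (s - (t - τ)) = t - s := by ring
    rw [e, kernelExt_of_pos _ hs, kernelExt_of_pos _ (sub_pos.2 hst)]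
    have h3 := hM.2 τ (left_mem_Icc.2 h.le) (t - τ) (by linarith [ht.1]) (by linarith [ht.2])
      (s - (t - τ)) (sub_pos.2 hst)
    rw [show τ + (t - τ) = t by ring, sub_add_cancel] at h3
    have h4 : ‖y t - y τ‖ ≤ 2 * B :=
      (_root_.norm_sub_le _ _).trans (by linarith [hB _ ht, hB τ (left_mem_Icc.2 h.le)])
    have h5 : ‖y t - y (t - s)‖ ≤ ‖y τ - y (t - s)‖ + 2 * B := by
      have := norm_add_le (y τ - y (t - s)) (y t - y τ)
      rw [show y τ - y (t - s) + (y t - y τ) = y t - y (t - s) by abel] at this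
      linarith
    have h6 : ‖y t - y (t - s)‖ ^ 2 ≤ 2 * ‖y τ - y (t - s)‖ ^ 2 + 2 * (2 * B) ^ 2 := by
      have h7 : ‖y t - y (t - s)‖ ^ 2 ≤ (‖y τ - y (t - s)‖ + 2 * B) ^ 2 := by gcongr
      nlinarith [sq_nonneg (‖y τ - y (t - s)‖ - 2 * B)]
    have h8 := hμ.pos τ _ (sub_pos.2 hst)
    have h9 := hμ.pos t s hs
    calc μ t s * ‖y t - y (t - s)‖ ^ 2 ≤ E * μ τ (s - (t - τ)) *
          (2 * ‖y τ - y (t - s)‖ ^ 2 + 2 * (2 * B) ^ 2) := by gcongr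
      _ ≤ _ := by
        have : 0 ≤ (2 * B) ^ 2 * μ t s := by positivity
        linarith

end IsMemoryCurve

end

/-! ### The energy of the history -/

section

variable {μ : ℝ → ℝ → ℝ}

theorem IsMemoryKernel.mul_kernelExt_le (hμ : IsMemoryKernel μ) (t s : ℝ) :
    s * kernelExt μ t s ≤ ∫ a, kernelExt μ t a := by
  have h0 : 0 ≤ ∫ a, kernelExt μ t a := integral_nonneg fun a => hμ.kernelExt_nonneg t a
  rcases le_or_gt s 0 with hs | hs
  · rwa [kernelExt_of_nonpos _ hs, mul_zero]
  calc s * kernelExt μ t s = ∫ _a in Ioc 0 s, kernelExt μ t s := by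
        simp [hs.le]
    _ ≤ ∫ a in Ioc 0 s, kernelExt μ t a := by
        refine setIntegral_mono_on (by simp) (hμ.integrable_kernelExt t).integrableOn
          measurableSet_Ioc fun a ha => ?_
        rw [kernelExt_of_pos _ hs, kernelExt_of_pos _ ha.1]
        exact hμ.antitone t (mem_Ioi.2 ha.1) (mem_Ioi.2 hs) ha.2
    _ ≤ ∫ a, kernelExt μ t a :=
        setIntegral_le_integral (hμ.integrable_kernelExt t)
          (ae_of_all _ fun a => hμ.kernelExt_nonneg t a)

theorem IsMemoryKernel.exists_kernelExt_le (hμ : IsMemoryKernel μ) (τ T : ℝ) :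
    ∃ K : ℝ → ℝ, (∀ r ∈ Icc τ T, 0 < K r) ∧ IntegrableOn K (Icc τ T) ∧
      ∀ r ∈ Icc τ T, ∀ s, kernelExt μ r s ≤ K r * kernelExt μ τ s := by
  obtain ⟨K, hK0, hKi, hK⟩ := hμ.domination τ
  rcases le_or_gt τ T with hτ | hτ
  · refine ⟨K, fun r hr => hK0 r hr.1, hKi T hτ, fun r hr s => ?_⟩
    rcases le_or_gt s 0 with hs | hs
    · rw [kernelExt_of_nonpos _ hs, kernelExt_of_nonpos _ hs, mul_zero]
    · rw [kernelExt_of_pos _ hs, kernelExt_of_pos _ hs]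
      exact hK r hr.1 s hs
  · exact ⟨fun _ => 1, by simp [hτ], by simp [hτ], by simp [hτ]⟩

variable {X : Type*} [NormedAddCommGroup X] [NormedSpace ℝ X]

namespace IsMemoryCurve

variable {τ T V M₀ : ℝ} {y v : ℝ → X} {β : X →L[ℝ] X →L[ℝ] ℝ}

theorem quadratic_le_of_lt [CompleteSpace X] (h : IsMemoryCurve μ τ T V y v)
    (hμ : IsMemoryKernel μ) (hM : HasGrowth μ τ T M₀)
    (hsymm : ∀ x y, β x y = β y x) (h0 : ∀ x, 0 ≤ β x x) {t a : ℝ} (ht : t ∈ Icc τ T)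
    (ha : a < τ) :
    Real.exp (-M₀ * (t - τ)) * kernelExt μ t (t - a) * β (y t - y a) (y t - y a) ≤
      kernelExt μ τ (τ - a) * β (y τ - y a) (y τ - y a) +
        2 * ∫ r in Ioc τ t, Real.exp (-M₀ * (r - τ)) * kernelExt μ r (r - a) *
          β (y r - y a) (v r) := by
  have hτ : τ ∈ Icc τ T := left_mem_Icc.2 h.le
  have hsub : ∀ {r}, r ∈ Icc τ t → r ∈ Icc τ T := fun hr => ⟨hr.1, hr.2.trans ht.2⟩
  have h1 := AgingMemory.quadratic_le (x := fun r => y r - y a) (w := v)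
    (q := fun r => Real.exp (-M₀ * (r - τ)) * kernelExt μ r (r - a)) hsymm h0 ht.1
    (intervalIntegrable_sub h.integrable hτ ht)
    (fun r hr => by rw [h.eq_integral r (hsub hr)]; abel)
    (fun r hr r' hr' hrr => hM.antitoneOn (hsub hr) (hsub hr') (ha.trans_le hr.1) hrr)
    (fun r hr => mul_nonneg (Real.exp_pos _).le (hμ.kernelExt_nonneg _ _))
  rw [intervalIntegral.integral_of_le ht.1] at h1
  simpa using h1

theorem quadratic_le_of_mem [CompleteSpace X] (h : IsMemoryCurve μ τ T V y v)
    (hμ : IsMemoryKernel μ) (hM : HasGrowth μ τ T M₀)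
    (hsymm : ∀ x y, β x y = β y x) (h0 : ∀ x, 0 ≤ β x x) {t a : ℝ} (ht : t ∈ Icc τ T)
    (ha : a ∈ Ico τ t) :
    Real.exp (-M₀ * (t - τ)) * kernelExt μ t (t - a) * β (y t - y a) (y t - y a) ≤
        2 * ∫ r in Ioc a t, Real.exp (-M₀ * (r - τ)) * kernelExt μ r (r - a) *
          β (y r - y a) (v r) := by
  have haT : a ∈ Icc τ T := ⟨ha.1, ha.2.le.trans ht.2⟩
  have hat : a ≤ t := ha.2.le
  have hsub : ∀ {r}, r ∈ Icc a t → r ∈ Icc τ T := fun hr => ⟨ha.1.trans hr.1, hr.2.trans ht.2⟩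
  obtain ⟨K, hK0, hKi, hK⟩ := hμ.exists_kernelExt_le τ T
  set W : ℝ → ℝ := fun r => Real.exp (-M₀ * (r - τ)) * kernelExt μ r (r - a) with hW
  have hW0 : ∀ r, 0 ≤ W r := fun r => mul_nonneg (Real.exp_pos _).le (hμ.kernelExt_nonneg _ _)
  set q : ℕ → ℝ → ℝ := fun n r => if a < r then min (n : ℝ) (W r) else n with hq
  have hqW : ∀ n r, a < r → q n r ≤ W r := fun n r har => by simp [hq, har]
  have hq0 : ∀ n r, 0 ≤ q n r := fun n r => by
    simp only [hq]
    split_ifs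
    exacts [le_min n.cast_nonneg (hW0 r), n.cast_nonneg]
  have hqa : ∀ n, AntitoneOn (q n) (Icc a t) := fun n r hr r' hr' hrr => by
    simp only [hq]
    by_cases h1 : a < r
    · rw [if_pos h1, if_pos (h1.trans_le hrr)]
      exact min_le_min le_rfl (hM.antitoneOn (hsub hr) (hsub hr') h1 hrr)
    · rw [if_neg h1]
      split_ifs
      exacts [min_le_left _ _, le_rfl]
  have hvi := intervalIntegrable_sub h.integrable haT ht
  have hyc : ContinuousOn (fun r => y r - y a) (Icc a t) :=
    (h.continuousOn.mono fun r hr => hsub hr).sub continuousOn_const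
  have h1 : ∀ n, q n t * β (y t - y a) (y t - y a) ≤
      2 * ∫ r in a..t, q n r * β (y r - y a) (v r) := fun n => by
    have := AgingMemory.quadratic_le (x := fun r => y r - y a) (w := v) (q := q n) hsymm h0 hat hvi
      (fun r hr => by
        rw [h.eq_integral_of_mem haT r ⟨hr.1, hr.2.trans ht.2⟩]; abel) (hqa n) fun r _ => hq0 n r
    simpa using this
  have hev : ∀ r, a < r → ∀ᶠ n : ℕ in atTop, q n r = W r := fun r har => by
    filter_upwards [eventually_ge_atTop ⌈W r⌉₊] with n hn
    simp only [hq, if_pos har]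
    exact min_eq_right ((Nat.le_ceil _).trans (by exact_mod_cast hn))
  have hlim : Tendsto (fun n => ∫ r in a..t, q n r * β (y r - y a) (v r)) atTop
      (𝓝 (∫ r in a..t, W r * β (y r - y a) (v r))) := by
    refine intervalIntegral.tendsto_integral_filter_of_dominated_convergence
      (fun r => ‖β‖ * V ^ 2 * (∫ s, kernelExt μ τ s) * K r) (.of_forall fun n => ?_)
      (.of_forall fun n => ?_) ?_ (ae_of_all _ fun r hr => ?_)
    · have := intervalIntegrable_weight_mul (β := β) hat hvi hyc (hqa n) fun r _ => hq0 n r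
      exact this.aestronglyMeasurable_restrict_uIoc
    · have h2 := (ae_restrict_iff' measurableSet_Icc).1 h.bdd
      filter_upwards [h2] with r hr har
      rw [uIoc_of_le hat] at har
      have hr' := hsub (Ioc_subset_Icc_self har)
      have h3 := β.le_opNorm₂ (y r - y a) (v r)
      have h4 := h.norm_sub_le haT hr' har.1.le
      have h5 : W r ≤ K r * kernelExt μ τ (r - a) := by
        refine le_trans ?_ (hK r hr' (r - a))
        refine mul_le_of_le_one_left (hμ.kernelExt_nonneg _ _) (Real.exp_le_one_iff.2 ?_)
        nlinarith [hM.1, hr'.1]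
      have h6 := hμ.mul_kernelExt_le τ (r - a)
      have hV := h.bdd_nonneg
      have hra : 0 < r - a := sub_pos.2 har.1
      rw [norm_mul, Real.norm_of_nonneg (hq0 n r)]
      calc q n r * ‖β (y r - y a) (v r)‖ ≤ W r * (‖β‖ * (V * (r - a)) * V) := by
            refine mul_le_mul (hqW n r har.1) (h3.trans ?_) (norm_nonneg _) (hW0 r)
            gcongr
            exact hr hr'
        _ ≤ (K r * kernelExt μ τ (r - a)) * (‖β‖ * (V * (r - a)) * V) := by gcongr
        _ = ‖β‖ * V ^ 2 * K r * ((r - a) * kernelExt μ τ (r - a)) := by ring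
        _ ≤ ‖β‖ * V ^ 2 * K r * ∫ s, kernelExt μ τ s := by
            have := (hK0 r hr').le
            gcongr
        _ = _ := by ring
    · have : IntervalIntegrable K volume a t :=
        (intervalIntegrable_iff_integrableOn_Icc_of_le hat).2
          (hKi.mono_set fun r hr => hsub hr)
      exact this.const_mul _
    · rw [uIoc_of_le hat] at hr
      refine tendsto_const_nhds.congr' ?_
      filter_upwards [hev r hr.1] with n hn
      rw [hn]
  rw [← intervalIntegral.integral_of_le hat]
  refine ge_of_tendsto (hlim.const_mul 2) ?_
  filter_upwards [hev t ha.2] with n hn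
  have := h1 n
  rwa [hn] at this

/-- The evolution of a quadratic form of the increments of the curve along the characteristics. -/
theorem quadratic_le [CompleteSpace X] (h : IsMemoryCurve μ τ T V y v)
    (hμ : IsMemoryKernel μ) (hM : HasGrowth μ τ T M₀)
    (hsymm : ∀ x y, β x y = β y x) (h0 : ∀ x, 0 ≤ β x x) {t : ℝ} (ht : t ∈ Icc τ T) (a : ℝ) :
    Real.exp (-M₀ * (t - τ)) * kernelExt μ t (t - a) * β (y t - y a) (y t - y a) ≤
      kernelExt μ τ (τ - a) * β (y τ - y a) (y τ - y a) +
        2 * ∫ r in Ioc τ t, Real.exp (-M₀ * (r - τ)) * kernelExt μ r (r - a) *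
          β (y r - y a) (v r) := by
  rcases lt_or_ge a τ with ha | ha
  · exact h.quadratic_le_of_lt hμ hM hsymm h0 ht ha
  rw [kernelExt_of_nonpos τ (sub_nonpos.2 ha), zero_mul, zero_add]
  rcases lt_or_ge a t with hat | hat
  · refine (h.quadratic_le_of_mem hμ hM hsymm h0 ht ⟨ha, hat⟩).trans_eq ?_
    rw [setIntegral_eq_of_subset_of_forall_sdiff_eq_zero measurableSet_Ioc
      (Ioc_subset_Ioc_left ha)]
    intro r hr
    have : r ≤ a := by
      by_contra! h1
      exact hr.2 ⟨h1, hr.1.2⟩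
    rw [kernelExt_of_nonpos r (sub_nonpos.2 this), mul_zero, zero_mul]
  · rw [kernelExt_of_nonpos t (sub_nonpos.2 hat), mul_zero, zero_mul,
      setIntegral_eq_zero_of_forall_eq_zero, mul_zero]
    intro r hr
    rw [kernelExt_of_nonpos r (sub_nonpos.2 (hr.2.trans hat)), mul_zero, zero_mul]

theorem integrable_prod (h : IsMemoryCurve μ τ T V y v)
    (hμ : IsMemoryKernel μ) (hM : HasGrowth μ τ T M₀) {t : ℝ} (ht : t ∈ Icc τ T) :
    Integrable (fun p : ℝ × ℝ => Real.exp (-M₀ * (p.2 - τ)) * kernelExt μ p.2 (p.2 - p.1) *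
      β (y p.2 - y p.1) (v p.2)) (volume.prod (volume.restrict (Ioc τ t))) := by
  obtain ⟨K, hK0, hKi, hK⟩ := hμ.exists_kernelExt_le τ T
  obtain ⟨B, hB0, hB⟩ := h.exists_bound
  have hV := h.bdd_nonneg
  have hτ : τ ∈ Icc τ T := left_mem_Icc.2 h.le
  have hsub : Ioc τ t ⊆ Icc τ T := fun r hr => ⟨hr.1.le, hr.2.trans ht.2⟩
  have hpast : Integrable fun a => kernelExt μ τ (τ - a) * (‖y τ - y a‖ + 2 * B) := by
    have := hμ.isFiniteMeasure τ
    have h1 : Integrable (fun s => ‖y τ - y (τ - s)‖ + 2 * B) (memMeasure μ τ) :=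
      (h.past.integrable one_le_two).norm.add (integrable_const _)
    rw [hμ.integrable_memMeasure_iff] at h1
    simpa using h1.comp_sub_left τ
  have hp1 : Integrable (fun p : ℝ × ℝ => kernelExt μ τ (τ - p.1) * (‖y τ - y p.1‖ + 2 * B))
      (volume.prod (volume.restrict (Ioc τ t))) := by
    exact hpast.comp_fst _
  have hp2 : Integrable (fun p : ℝ × ℝ => K p.2 * kernelExt μ τ (p.2 - p.1))
      (volume.prod (volume.restrict (Ioc τ t))) := by
    have h1 := Integrable.convolution_integrand (ContinuousLinearMap.mul ℝ ℝ)
      (f := K) (g := fun s => kernelExt μ τ (-s)) (μ := volume) (ν := volume.restrict (Ioc τ t))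
      (hKi.mono_set hsub) (hμ.integrable_kernelExt τ).comp_neg
    simpa using h1
  refine (((hp1.add (hp2.const_mul (2 * B))).const_mul (‖β‖ * V))).mono' ?_ ?_
  · refine AEStronglyMeasurable.mul ?_ ?_
    · have h1 : Measurable fun p : ℝ × ℝ => Real.exp (-M₀ * (p.2 - τ)) *
          kernelExt μ p.2 (p.2 - p.1) :=
        (by fun_prop : Measurable fun p : ℝ × ℝ => Real.exp (-M₀ * (p.2 - τ))).mul
          (hμ.measurable_kernelExt.comp (f := fun p : ℝ × ℝ => (p.2, p.2 - p.1)) (by fun_prop))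
      exact h1.aestronglyMeasurable
    · refine β.aestronglyMeasurable_comp₂ (AEStronglyMeasurable.sub ?_ ?_) ?_
      · exact h.meas.restrict.comp_snd
      · exact h.meas.comp_fst
      · have := (intervalIntegrable_sub h.integrable hτ ht).1.aestronglyMeasurable
        exact this.comp_snd
  · have h2 : ∀ᵐ p : ℝ × ℝ ∂(volume.prod (volume.restrict (Ioc τ t))),
      p.2 ∈ Ioc τ t ∧ ‖v p.2‖ ≤ V := by
      refine Measure.quasiMeasurePreserving_snd.ae
        (p := fun r => r ∈ Ioc τ t ∧ ‖v r‖ ≤ V) ?_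
      filter_upwards [ae_restrict_mem measurableSet_Ioc,
          ae_restrict_of_ae_restrict_of_subset hsub h.bdd]
        with r h1 h2 using ⟨h1, h2⟩
    filter_upwards [h2] with ⟨a, r⟩ ⟨hr, hv⟩
    dsimp only at hr hv ⊢
    have hrT := hsub hr
    have hk0 := hμ.kernelExt_nonneg r (r - a)
    have hk1 := hμ.kernelExt_nonneg τ (r - a)
    have hk2 := hμ.kernelExt_nonneg τ (τ - a)
    have hKr := (hK0 r hrT).le
    have he : 0 ≤ Real.exp (-M₀ * (r - τ)) * kernelExt μ r (r - a) := by positivity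
    rw [norm_mul, Real.norm_of_nonneg he]
    have h3 : ‖β (y r - y a) (v r)‖ ≤ ‖β‖ * ‖y r - y a‖ * V :=
      (β.le_opNorm₂ _ _).trans (by gcongr)
    have key : Real.exp (-M₀ * (r - τ)) * kernelExt μ r (r - a) * ‖y r - y a‖ ≤
        kernelExt μ τ (τ - a) * (‖y τ - y a‖ + 2 * B) +
          2 * B * (K r * kernelExt μ τ (r - a)) := by
      rcases lt_or_ge a τ with ha | ha
      · have h4 := hM.antitoneOn hτ hrT ha hr.1.le
        rw [sub_self, mul_zero, Real.exp_zero, one_mul] at h4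
        have h5 : ‖y r - y a‖ ≤ ‖y τ - y a‖ + 2 * B := by
          have := norm_add_le (y τ - y a) (y r - y τ)
          rw [show y τ - y a + (y r - y τ) = y r - y a by abel] at this
          linarith [_root_.norm_sub_le (y r) (y τ), hB r hrT, hB τ hτ]
        have := mul_le_mul h4 h5 (norm_nonneg _) hk2
        have : 0 ≤ 2 * B * (K r * kernelExt μ τ (r - a)) := by positivity
        linarith
      · rw [kernelExt_of_nonpos τ (sub_nonpos.2 ha), zero_mul, zero_add]
        rcases lt_or_ge a r with har | har
        · have h5 : ‖y r - y a‖ ≤ 2 * B := (_root_.norm_sub_le _ _).trans (by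
            linarith [hB r hrT, hB a ⟨ha, har.le.trans hrT.2⟩])
          have h4 : Real.exp (-M₀ * (r - τ)) * kernelExt μ r (r - a) ≤
              K r * kernelExt μ τ (r - a) := by
            refine le_trans ?_ (hK r hrT (r - a))
            refine mul_le_of_le_one_left hk0 (Real.exp_le_one_iff.2 ?_)
            nlinarith [hM.1, hrT.1]
          have := mul_le_mul h4 h5 (norm_nonneg _) (by positivity)
          linarith
        · rw [kernelExt_of_nonpos r (sub_nonpos.2 har), mul_zero, zero_mul]
          positivity
    calc _ ≤ Real.exp (-M₀ * (r - τ)) * kernelExt μ r (r - a) * (‖β‖ * ‖y r - y a‖ * V) := by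
          gcongr
      _ = ‖β‖ * V * (Real.exp (-M₀ * (r - τ)) * kernelExt μ r (r - a) * ‖y r - y a‖) := by ring
      _ ≤ _ := by
        refine mul_le_mul_of_nonneg_left key ?_
        positivity

theorem integrable_quadratic (h : IsMemoryCurve μ τ T V y v)
    (hμ : IsMemoryKernel μ) (hM : HasGrowth μ τ T M₀) {t : ℝ} (ht : t ∈ Icc τ T) :
    Integrable fun a => kernelExt μ t (t - a) * β (y t - y a) (y t - y a) := by
  have h1 := h.memLp hμ hM ht
  have h2 := h1.integrable_norm_pow (p := 2) (by norm_num)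
  have h3 : Integrable (fun s => β (y t - y (t - s)) (y t - y (t - s))) (memMeasure μ t) := by
    refine (h2.const_mul ‖β‖).mono'
      (β.aestronglyMeasurable_comp₂ h1.aestronglyMeasurable h1.aestronglyMeasurable)
      (ae_of_all _ fun s => (β.le_opNorm₂ _ _).trans_eq ?_)
    rw [mul_assoc, ← sq]
  rw [hμ.integrable_memMeasure_iff] at h3
  simpa using h3.comp_sub_left t

theorem integrableOn_power (h : IsMemoryCurve μ τ T V y v)
    (hμ : IsMemoryKernel μ) (hM : HasGrowth μ τ T M₀) {t : ℝ} (ht : t ∈ Icc τ T) :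
    IntegrableOn (fun r => Real.exp (-M₀ * (r - τ)) *
      ∫ s in Ioi (0 : ℝ), μ r s * β (y r - y (r - s)) (v r)) (Ioc τ t) := by
  have h1 := (h.integrable_prod (β := β) hμ hM ht).integral_prod_right
  refine h1.congr (ae_of_all _ fun r => ?_)
  dsimp only
  rw [setIntegral_Ioi_kernel_sub r (fun a => β (y r - y a) (v r)), ← integral_const_mul]
  simp only [mul_assoc]

/-- The evolution of the energy of the history. -/
theorem energy_le [CompleteSpace X] (h : IsMemoryCurve μ τ T V y v)
    (hμ : IsMemoryKernel μ) (hM : HasGrowth μ τ T M₀)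
    (hsymm : ∀ x y, β x y = β y x) (h0 : ∀ x, 0 ≤ β x x) {t : ℝ} (ht : t ∈ Icc τ T) :
    Real.exp (-M₀ * (t - τ)) *
        ∫ s in Ioi (0 : ℝ), μ t s * β (y t - y (t - s)) (y t - y (t - s)) ≤
      (∫ s in Ioi (0 : ℝ), μ τ s * β (y τ - y (τ - s)) (y τ - y (τ - s))) +
        2 * ∫ r in Ioc τ t, Real.exp (-M₀ * (r - τ)) *
          ∫ s in Ioi (0 : ℝ), μ r s * β (y r - y (r - s)) (v r) := by
  have hτ : τ ∈ Icc τ T := left_mem_Icc.2 h.le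
  have hi := h.integrable_prod (β := β) hμ hM ht
  have h1 : ∀ r, ∫ s in Ioi (0 : ℝ), μ r s * β (y r - y (r - s)) (v r) =
      ∫ a, kernelExt μ r (r - a) * β (y r - y a) (v r) := fun r =>
    setIntegral_Ioi_kernel_sub r fun a => β (y r - y a) (v r)
  have h2 : ∀ r, ∫ s in Ioi (0 : ℝ), μ r s * β (y r - y (r - s)) (y r - y (r - s)) =
      ∫ a, kernelExt μ r (r - a) * β (y r - y a) (y r - y a) := fun r =>
    setIntegral_Ioi_kernel_sub r fun a => β (y r - y a) (y r - y a)
  simp only [h1, h2]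
  have h3 : ∫ r in Ioc τ t, Real.exp (-M₀ * (r - τ)) *
      ∫ a, kernelExt μ r (r - a) * β (y r - y a) (v r) =
      ∫ a, ∫ r in Ioc τ t, Real.exp (-M₀ * (r - τ)) * kernelExt μ r (r - a) *
        β (y r - y a) (v r) := by
    rw [integral_integral_swap (f := fun a r => Real.exp (-M₀ * (r - τ)) * kernelExt μ r (r - a) *
        β (y r - y a) (v r)) hi]
    simp only [mul_assoc, integral_const_mul]
  rw [h3, ← integral_const_mul, ← integral_const_mul, ← integral_add]
  · refine integral_mono ((h.integrable_quadratic hμ hM ht).const_mul _) ?_ fun a => ?_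
    · exact (h.integrable_quadratic hμ hM hτ).add (hi.integral_prod_left.const_mul 2)
    · have := h.quadratic_le hμ hM hsymm h0 ht a
      simpa only [mul_assoc] using this
  · exact h.integrable_quadratic hμ hM hτ
  · exact hi.integral_prod_left.const_mul 2

end IsMemoryCurve

end

/-! ### The linear equation with memory -/

section

variable {μ : ℝ → ℝ → ℝ} {Ω : Set E3}

theorem separableSpace_H10 (Ω : Set E3) : TopologicalSpace.SeparableSpace (H10 Ω) := by
  have : Fact ((2 : ℝ≥0∞) ≠ ⊤) := ⟨by norm_num⟩
  have h1 : SecondCountableTopology (L2 Ω) := inferInstance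
  have h2 : SecondCountableTopology (L2vec Ω) := inferInstance
  have h3 : SecondCountableTopology (L2 Ω × L2vec Ω) :=
    TopologicalSpace.instSecondCountableTopologyProd
  have : SecondCountableTopology (WithLp 2 (L2 Ω × L2vec Ω)) :=
    (WithLp.homeomorphProd 2 (L2 Ω) (L2vec Ω)).secondCountableTopology
  have : SecondCountableTopology ↥(testGraph Ω).topologicalClosure := inferInstance
  exact inferInstanceAs (TopologicalSpace.SeparableSpace ↥(testGraph Ω).topologicalClosure)

theorem IsMemoryKernel.integrable_innerOne (hμ : IsMemoryKernel μ) {t : ℝ} {η : ℝ → H10 Ω}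
    (h : MemLp η 2 (memMeasure μ t)) (φ : H10 Ω) :
    IntegrableOn (fun s => μ t s * innerOne (η s) φ) (Ioi 0) := by
  have := hμ.isFiniteMeasure t
  have h1 : Integrable (fun s => innerOneL.flip φ (η s)) (memMeasure μ t) :=
    (innerOneL.flip φ).integrable_comp (h.integrable one_le_two)
  rw [memMeasure, integrable_withDensity_iff_integrable_smul₀' (hμ.aemeasurable_density t)
    (ae_of_all _ fun _ => ENNReal.ofReal_lt_top), ← IntegrableOn] at h1
  refine h1.congr_fun (fun s hs => ?_) measurableSet_Ioi
  dsimp only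
  rw [ENNReal.toReal_ofReal (hμ.pos t s hs).le]
  rfl

theorem IsMemoryKernel.continuous_integral_innerOne (hμ : IsMemoryKernel μ) {t : ℝ}
    {η : ℝ → H10 Ω} (h : MemLp η 2 (memMeasure μ t)) :
    Continuous fun φ => ∫ s in Ioi (0 : ℝ), μ t s * innerOne (η s) φ := by
  have := hμ.isFiniteMeasure t
  have h1 : ∀ φ, ∫ s in Ioi (0 : ℝ), μ t s * innerOne (η s) φ =
      innerOneL (∫ s, η s ∂memMeasure μ t) φ := fun φ => by
    have h2 := (innerOneL.flip φ).integral_comp_comm (h.integrable one_le_two)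
    rw [hμ.integral_memMeasure] at h2
    exact h2
  simp only [h1]
  fun_prop

/-- Solutions `u` of the linear wave equation with memory `∂ₜₜu + A u + ∫ μ_t(s) A η^t(s) ds = h`,
where `v = ∂ₜu`, `w = ∂ₜₜu` and the curve `y` extends `u` to the past. -/
structure IsLinearSolution (μ : ℝ → ℝ → ℝ) (τ T V : ℝ) (y : ℝ → L2 Ω) (u : ℝ → H10 Ω)
    (v : ℝ → L2 Ω) (w : ℝ → Hneg Ω) (η : ℝ → ℝ → H10 Ω) (h : ℝ → L2 Ω) : Prop where
  curve : IsMemoryCurve μ τ T V y v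
  eq_toL2 : ∀ t ∈ Icc τ T, y t = toL2 (u t)
  eta : ∀ t ∈ Icc τ T, ∀ᵐ s ∂volume.restrict (Ioi (0 : ℝ)), toL2 (η t s) = y t - y (t - s)
  integrable : IntervalIntegrable w volume τ T
  eq_integral : ∀ t ∈ Icc τ T, toHnegL (v t) = toHnegL (v τ) + ∫ r in τ..t, w r
  memLp : ∀ᵐ t ∂volume.restrict (Icc τ T), MemLp (η t) 2 (memMeasure μ t)
  equation : ∀ᵐ t ∂volume.restrict (Icc τ T), ∀ φ : H10 Ω,
    w t φ + innerOne (u t) φ + (∫ s in Ioi (0 : ℝ), μ t s * innerOne (η t s) φ) = ⟪h t, toL2 φ⟫_ℝ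

/-- The energy of a state with respect to a pair of operators. -/
def pairEnergy (μ : ℝ → ℝ → ℝ) (J : Hneg Ω →L[ℝ] H10 Ω) (P : L2 Ω →L[ℝ] L2 Ω) (t : ℝ)
    (u : H10 Ω) (v : L2 Ω) (η : ℝ → H10 Ω) : ℝ :=
  toHnegL v (J (toHnegL v)) + ⟪P (toL2 u), toL2 u⟫_ℝ +
    ∫ s in Ioi (0 : ℝ), μ t s * ⟪P (toL2 (η s)), toL2 (η s)⟫_ℝ

namespace IsLinearSolution

variable {τ T V M₀ : ℝ} {y : ℝ → L2 Ω} {u : ℝ → H10 Ω} {v : ℝ → L2 Ω} {w : ℝ → Hneg Ω}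
  {η : ℝ → ℝ → H10 Ω} {h : ℝ → L2 Ω} {J : Hneg Ω →L[ℝ] H10 Ω} {P : L2 Ω →L[ℝ] L2 Ω}

theorem integral_kernel_congr (hs : IsLinearSolution μ τ T V y u v w η h) {t : ℝ}
    (ht : t ∈ Icc τ T) (G : L2 Ω → ℝ) :
    ∫ s in Ioi (0 : ℝ), μ t s * G (toL2 (η t s)) = ∫ s in Ioi (0 : ℝ), μ t s * G (y t - y
        (t - s)) := by
  refine integral_congr_ae ?_
  filter_upwards [hs.eta t ht] with s h1
  rw [h1]

/-- The energy inequality. -/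
theorem energy_le (hs : IsLinearSolution μ τ T V y u v w η h) (hμ : IsMemoryKernel μ)
    (hM : HasGrowth μ τ T M₀) (hJ : IsEnergyPair J P) {t : ℝ} (ht : t ∈ Icc τ T) :
    IntegrableOn (fun r => Real.exp (-M₀ * (r - τ)) * ⟪h r, toL2 (J (toHnegL (v r)))⟫_ℝ)
      (Ioc τ t) ∧
    Real.exp (-M₀ * (t - τ)) * pairEnergy μ J P t (u t) (v t) (η t) ≤
      pairEnergy μ J P τ (u τ) (v τ) (η τ) +
        2 * ∫ r in Ioc τ t, Real.exp (-M₀ * (r - τ)) * ⟪h r, toL2 (J (toHnegL (v r)))⟫_ℝ := by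
  have hτ : τ ∈ Icc τ T := left_mem_Icc.2 hs.curve.le
  have hsub : Icc τ t ⊆ Icc τ T := Icc_subset_Icc_right ht.2
  set q : ℝ → ℝ := fun r => Real.exp (-M₀ * (r - τ)) with hq
  have hqa : AntitoneOn q (Icc τ t) := fun r _ r' _ hr => by
    refine Real.exp_le_exp.2 ?_
    nlinarith [hM.1]
  have hq0 : ∀ r ∈ Icc τ t, 0 ≤ q r := fun r _ => (Real.exp_pos _).le
  have hqτ : q τ = 1 := by simp [hq]
  let β₁ : Hneg Ω →L[ℝ] Hneg Ω →L[ℝ] ℝ := (ContinuousLinearMap.apply ℝ ℝ).comp J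
  have hβ₁ : ∀ l m, β₁ l m = m (J l) := fun l m => rfl
  let β₂ : L2 Ω →L[ℝ] L2 Ω →L[ℝ] ℝ := (innerSL ℝ).comp P
  have hβ₂ : ∀ a b, β₂ a b = ⟪P a, b⟫_ℝ := fun a b => rfl
  have hwi := intervalIntegrable_sub hs.integrable hτ ht
  have hvi := intervalIntegrable_sub hs.curve.integrable hτ ht
  have hVc := continuousOn_of_eq_integral ht.1 hwi (x := fun r => toHnegL (v r))
    fun r hr => hs.eq_integral r (hsub hr)
  have k1 := AgingMemory.quadratic_le (β := β₁) (x := fun r => toHnegL (v r)) (w := w) (q := q)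
    (fun a b => by rw [hβ₁, hβ₁, hJ.symm]) (fun a => hJ.nonneg a) ht.1 hwi
    (fun r hr => hs.eq_integral r (hsub hr)) hqa hq0
  have i1 := intervalIntegrable_weight_mul (β := β₁) (x := fun r => toHnegL (v r)) ht.1 hwi hVc
    hqa hq0
  have k2 := AgingMemory.quadratic_le (β := β₂) (x := y) (w := v) (q := q)
    (fun a b => by rw [hβ₂, hβ₂, hJ.P_symm]) (fun a => hJ.P_nonneg a) ht.1 hvi
    (fun r hr => hs.curve.eq_integral r (hsub hr)) hqa hq0
  have i2 := intervalIntegrable_weight_mul (β := β₂) (x := y) ht.1 hvi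
    (hs.curve.continuousOn.mono hsub) hqa hq0
  have k3 := hs.curve.energy_le (β := β₂) hμ hM
    (fun a b => by rw [hβ₂, hβ₂, hJ.P_symm]) (fun a => hJ.P_nonneg a) ht
  have i3 := hs.curve.integrableOn_power (β := β₂) hμ hM ht
  simp only [hβ₁, hβ₂, hqτ, one_mul] at k1 i1 k2 i2 k3 i3
  rw [intervalIntegral.integral_of_le ht.1] at k1 k2
  rw [intervalIntegrable_iff_integrableOn_Ioc_of_le ht.1] at i1 i2
  have hae : ∀ᵐ r ∂volume.restrict (Ioc τ t),
      q r * (w r (J (toHnegL (v r)))) + q r * ⟪P (y r), v r⟫_ℝ +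
        q r * (∫ s in Ioi (0 : ℝ), μ r s * ⟪P (y r - y (r - s)), v r⟫_ℝ) =
      q r * ⟪h r, toL2 (J (toHnegL (v r)))⟫_ℝ := by
    have h1 := ae_restrict_of_ae_restrict_of_subset (Ioc_subset_Icc_self.trans hsub) hs.equation
    filter_upwards [h1, ae_restrict_mem measurableSet_Ioc] with r h2 hr
    have hr' := hsub (Ioc_subset_Icc_self hr)
    rw [← h2, ← hs.integral_kernel_congr hr' (fun a => ⟪P a, v r⟫_ℝ), hs.eq_toL2 r hr',
      hJ.P_eq]
    simp only [hJ.P_eq]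
    ring
  have i4 := (i1.add i2).add i3
  refine ⟨i4.congr hae, ?_⟩
  rw [← integral_congr_ae hae]
  have e := integral_add (f := fun r => q r * (w r (J (toHnegL (v r)))) + q r * ⟪P (y r), v r⟫_ℝ)
    (i1.add i2) i3
  have e' := integral_add i1 i2
  rw [e, e', pairEnergy, pairEnergy, hs.integral_kernel_congr ht (fun a => ⟪P a, a⟫_ℝ),
    hs.integral_kernel_congr hτ (fun a => ⟪P a, a⟫_ℝ), ← hs.eq_toL2 t ht, ← hs.eq_toL2 τ hτ]
  linarith

theorem sub (hμ : IsMemoryKernel μ) {V' : ℝ} {y' : ℝ → L2 Ω} {u' : ℝ → H10 Ω} {v' : ℝ → L2 Ω}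
    {w' : ℝ → Hneg Ω} {η' : ℝ → ℝ → H10 Ω} {h' : ℝ → L2 Ω}
    (h₁ : IsLinearSolution μ τ T V y u v w η h) (h₂ : IsLinearSolution μ τ T V' y' u' v' w' η' h') :
    IsLinearSolution μ τ T (V + V') (fun t => y t - y' t) (fun t => u t - u' t)
      (fun t => v t - v' t) (fun t => w t - w' t) (fun t s => η t s - η' t s)
      (fun t => h t - h' t) where
  curve :=
    { le := h₁.curve.le
      meas := h₁.curve.meas.sub h₂.curve.meas
      integrable := h₁.curve.integrable.sub h₂.curve.integrable
      bdd := by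
        filter_upwards [h₁.curve.bdd, h₂.curve.bdd] with r hr hr'
        exact (norm_sub_le _ _).trans (add_le_add hr hr')
      bdd_nonneg := add_nonneg h₁.curve.bdd_nonneg h₂.curve.bdd_nonneg
      eq_integral := fun t ht => by
        have hτ : τ ∈ Icc τ T := left_mem_Icc.2 h₁.curve.le
        rw [h₁.curve.eq_integral t ht, h₂.curve.eq_integral t ht, intervalIntegral.integral_sub
          (intervalIntegrable_sub h₁.curve.integrable hτ ht)
          (intervalIntegrable_sub h₂.curve.integrable hτ ht)]
        abel
      past := by
        have := h₁.curve.past.sub h₂.curve.past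
        refine this.ae_eq (ae_of_all _ fun s => ?_)
        simp only [Pi.sub_apply]
        abel }
  eq_toL2 t ht := by rw [h₁.eq_toL2 t ht, h₂.eq_toL2 t ht, map_sub]
  eta t ht := by
    filter_upwards [h₁.eta t ht, h₂.eta t ht] with s h3 h4
    rw [map_sub, h3, h4]
    abel
  integrable := h₁.integrable.sub h₂.integrable
  eq_integral t ht := by
    have hτ : τ ∈ Icc τ T := left_mem_Icc.2 h₁.curve.le
    rw [map_sub, h₁.eq_integral t ht, h₂.eq_integral t ht, intervalIntegral.integral_sub
      (intervalIntegrable_sub h₁.integrable hτ ht)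
      (intervalIntegrable_sub h₂.integrable hτ ht), map_sub]
    abel
  memLp := by
    filter_upwards [h₁.memLp, h₂.memLp] with t h3 h4
    exact h3.sub h4
  equation := by
    filter_upwards [h₁.memLp, h₂.memLp, h₁.equation, h₂.equation] with t h3 h4 h5 h6 φ
    have e : ∫ s in Ioi (0 : ℝ), μ t s * innerOne (η t s - η' t s) φ =
        (∫ s in Ioi (0 : ℝ), μ t s * innerOne (η t s) φ) -
          ∫ s in Ioi (0 : ℝ), μ t s * innerOne (η' t s) φ := by
      rw [← integral_sub (hμ.integrable_innerOne h3 φ) (hμ.integrable_innerOne h4 φ)]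
      congr 1 with s
      simp only [innerOne, map_sub, inner_sub_left]
      ring
    have e2 : innerOne (u t - u' t) φ = innerOne (u t) φ - innerOne (u' t) φ := by
      simp only [innerOne, map_sub, inner_sub_left]
    rw [e, e2, inner_sub_left, ← h5, ← h6, sub_apply]
    ring

end IsLinearSolution

end

/-! ### Superposition operators of cubic growth -/

section

variable {Ω : Set E3}

/-- Locally Lipschitz functions of cubic growth, vanishing at zero. -/
structure IsCubic (f : ℝ → ℝ) (c : ℝ) : Prop where
  nonneg : 0 ≤ c
  zero : f 0 = 0
  abs_sub_le : ∀ a b, |f a - f b| ≤ c * (1 + a ^ 2 + b ^ 2) * |a - b|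

theorem isCubic_of_deriv {f : ℝ → ℝ} (hf : ContDiff ℝ 1 f) (h0 : f 0 = 0) {c : ℝ} (hc : 0 ≤ c)
    (h : ∀ r, |deriv f r| ≤ c * (1 + |r| ^ 2)) : IsCubic f c where
  nonneg := hc
  zero := h0
  abs_sub_le a b := by
    have hd : ∀ x ∈ uIcc b a, DifferentiableAt ℝ f x := fun x _ =>
      (hf.differentiable (by simp)) x
    have hb : ∀ x ∈ uIcc b a, ‖deriv f x‖ ≤ c * (1 + a ^ 2 + b ^ 2) := fun x hx => by
      refine (h x).trans ?_
      rw [sq_abs]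
      have : x ^ 2 ≤ a ^ 2 + b ^ 2 := by
        rcases mem_uIcc.1 hx with ⟨h1, h2⟩ | ⟨h1, h2⟩ <;>
        rcases le_or_gt 0 x with h3 | h3 <;>
          nlinarith
      nlinarith
    have := (convex_uIcc b a).norm_image_sub_le_of_norm_deriv_le hd hb left_mem_uIcc right_mem_uIcc
    simpa [Real.norm_eq_abs] using this

namespace IsCubic

variable {f : ℝ → ℝ} {c : ℝ}

theorem abs_le (h : IsCubic f c) (r : ℝ) : |f r| ≤ c * (1 + r ^ 2) * |r| := by
  simpa [h.zero] using h.abs_sub_le r 0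

theorem continuous (h : IsCubic f c) : Continuous f := by
  rw [continuous_iff_continuousAt]
  intro b
  rw [ContinuousAt, tendsto_iff_norm_sub_tendsto_zero]
  refine squeeze_zero (fun _ => norm_nonneg _) (fun a => h.abs_sub_le a b) ?_
  have : Continuous fun a : ℝ => c * (1 + a ^ 2 + b ^ 2) * |a - b| := by fun_prop
  simpa using this.tendsto b

theorem sq_le (h : IsCubic f c) (r : ℝ) : f r ^ 2 ≤ 4 * c ^ 2 * (1 + r ^ 6) := by
  have h1 := h.abs_le r
  have h2 : f r ^ 2 ≤ (c * (1 + r ^ 2) * |r|) ^ 2 := sq_le_sq' (by linarith [neg_abs_le (f r)])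
    ((le_abs_self _).trans h1)
  refine h2.trans ?_
  rw [mul_pow, mul_pow, sq_abs]
  have hs := sq_nonneg r
  have h3 : (1 + r ^ 2) ^ 2 * r ^ 2 ≤ 4 * (1 + r ^ 6) := by
    have e : r ^ 6 = (r ^ 2) ^ 3 := by ring
    rw [e]
    generalize r ^ 2 = s at *
    nlinarith [mul_nonneg hs (sq_nonneg (s - 1)), sq_nonneg (s - 1), mul_nonneg hs hs]
  nlinarith [sq_nonneg c]

end IsCubic

theorem memLp_toL2_six (u : H10 Ω) : MemLp (toL2 u) 6 (volume.restrict Ω) := by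
  obtain ⟨C, _, h⟩ := exists_sobolev Ω
  exact ⟨(Lp.memLp _).1, (h u).trans_lt ENNReal.ofReal_lt_top⟩

theorem integrable_pow_six (u : H10 Ω) : Integrable (fun x => toL2 u x ^ 6) (volume.restrict Ω) :=
    by
  have := (memLp_toL2_six u).integrable_norm_pow (p := 6) (by norm_num)
  refine this.congr (ae_of_all _ fun x => ?_)
  dsimp only
  rw [Real.norm_eq_abs, show (6 : ℕ) = 2 * 3 from rfl, pow_mul, sq_abs, ← pow_mul]

theorem exists_integral_pow_six_le (Ω : Set E3) : ∃ C ≥ 0, ∀ u : H10 Ω,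
    ∫ x in Ω, toL2 u x ^ 6 ≤ C * normOne u ^ 6 := by
  obtain ⟨C, hC, h⟩ := exists_sobolev Ω
  refine ⟨C ^ 6, by positivity, fun u => ?_⟩
  have h1 := (memLp_toL2_six u).eLpNorm_eq_integral_rpow_norm (by norm_num) (by norm_num)
  have h2 := h u
  rw [h1] at h2
  have h3 := (ENNReal.ofReal_le_ofReal_iff (by have := normOne_nonneg u; positivity)).1 h2
  have e : ∀ x, ‖toL2 u x‖ ^ (6 : ℝ≥0∞).toReal = toL2 u x ^ 6 := fun x => by
    rw [show (6 : ℝ≥0∞).toReal = ((6 : ℕ) : ℝ) by norm_num, Real.rpow_natCast, Real.norm_eq_abs,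
      show (6 : ℕ) = 2 * 3 from rfl, pow_mul, sq_abs, ← pow_mul]
  simp only [e] at h3
  have h4 : 0 ≤ ∫ x in Ω, toL2 u x ^ 6 := integral_nonneg fun x => by positivity
  have h5 : ((∫ x in Ω, toL2 u x ^ 6) ^ ((6 : ℝ≥0∞).toReal⁻¹)) ^ 6 ≤ (C * normOne u) ^ 6 := by
    gcongr
  rw [← Real.rpow_natCast, ← Real.rpow_mul h4] at h5
  rw [← mul_pow]
  simpa using h5

/-- The superposition operator `u ↦ f ∘ u` with values in `L²(Ω)`. -/
def superpos (f : ℝ → ℝ) (u : L2 Ω) : L2 Ω :=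
  open Classical in
  if h : MemLp (fun x => f (u x)) 2 (volume.restrict Ω) then h.toLp _ else 0

theorem coeFn_superpos {f : ℝ → ℝ} {u : L2 Ω}
    (h : MemLp (fun x => f (u x)) 2 (volume.restrict Ω)) :
    superpos f u =ᵐ[volume.restrict Ω] fun x => f (u x) := by
  rw [superpos, dif_pos h]
  exact h.coeFn_toLp

theorem inner_superpos {f : ℝ → ℝ} {u : L2 Ω}
    (h : MemLp (fun x => f (u x)) 2 (volume.restrict Ω)) (v : L2 Ω) :
    ⟪superpos f u, v⟫_ℝ = ∫ x in Ω, f (u x) * v x := by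
  rw [L2.inner_def]
  refine integral_congr_ae ?_
  filter_upwards [coeFn_superpos h] with x hx
  rw [hx, real_inner_eq_re_inner, mul_comm]
  simp

namespace IsCubic

variable {f : ℝ → ℝ} {c : ℝ}

theorem memLp (hf : IsCubic f c) (hb : Bornology.IsBounded Ω) (u : H10 Ω) :
    MemLp (fun x => f (toL2 u x)) 2 (volume.restrict Ω) := by
  have : IsFiniteMeasure (volume.restrict Ω) := ⟨by simpa using hb.measure_lt_top⟩
  have hm : AEStronglyMeasurable (fun x => f (toL2 u x)) (volume.restrict Ω) :=
    hf.continuous.comp_aestronglyMeasurable (Lp.aestronglyMeasurable _)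
  rw [memLp_two_iff_integrable_sq hm]
  refine (((integrable_const 1).add (integrable_pow_six u)).const_mul (4 * c ^ 2)).mono'
    (hm.pow 2) (ae_of_all _ fun x => ?_)
  rw [Real.norm_of_nonneg (sq_nonneg _)]
  exact hf.sq_le _

theorem sq_norm_superpos_le (hf : IsCubic f c) (hb : Bornology.IsBounded Ω) (u : H10 Ω) :
    ‖superpos f (toL2 u)‖ ^ 2 ≤ 4 * c ^ 2 * (volume.real Ω + ∫ x in Ω, toL2 u x ^ 6) := by
  have : IsFiniteMeasure (volume.restrict Ω) := ⟨by simpa using hb.measure_lt_top⟩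
  rw [← real_inner_self_eq_norm_sq, inner_superpos (hf.memLp hb u)]
  have e : ∫ x in Ω, f (toL2 u x) * superpos f (toL2 u) x = ∫ x in Ω, f (toL2 u x) ^ 2 := by
    refine integral_congr_ae ?_
    filter_upwards [coeFn_superpos (hf.memLp hb u)] with x hx
    rw [hx, sq]
  rw [e]
  have e2 : 4 * c ^ 2 * (volume.real Ω + ∫ x in Ω, toL2 u x ^ 6) =
      ∫ x in Ω, 4 * c ^ 2 * (1 + toL2 u x ^ 6) := by
    rw [integral_const_mul, integral_add (integrable_const 1) (integrable_pow_six u)]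
    simp
  rw [e2]
  exact integral_mono ((memLp_two_iff_integrable_sq (hf.memLp hb u).1).1 (hf.memLp hb u))
    (((integrable_const 1).add (integrable_pow_six u)).const_mul _) fun x => hf.sq_le _

end IsCubic

theorem exists_eLpNorm_weight_le (hb : Bornology.IsBounded Ω) : ∃ C ≥ 0, ∀ u₁ u₂ φ : H10 Ω,
    eLpNorm (fun x => (1 + toL2 u₁ x ^ 2 + toL2 u₂ x ^ 2) * toL2 φ x) 2 (volume.restrict Ω) ≤
      ENNReal.ofReal (C * (1 + normOne u₁ ^ 2 + normOne u₂ ^ 2) * normOne φ) := by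
  have : IsFiniteMeasure (volume.restrict Ω) := ⟨by simpa using hb.measure_lt_top⟩
  obtain ⟨C, hC, hS⟩ := exists_sobolev Ω
  set m : ℝ := (eLpNorm (fun _ : E3 => (1 : ℝ)) 3 (volume.restrict Ω)).toReal with hm
  have hmt : eLpNorm (fun _ : E3 => (1 : ℝ)) 3 (volume.restrict Ω) = ENNReal.ofReal m :=
    (ENNReal.ofReal_toReal (memLp_const (1 : ℝ)).2.ne).symm
  have hm0 : 0 ≤ m := ENNReal.toReal_nonneg
  have hHT : ENNReal.HolderTriple 3 6 2 := ⟨by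
    rw [show (3 : ℝ≥0∞)⁻¹ = 2 * 6⁻¹ by
        rw [← ENNReal.toReal_eq_toReal_iff' (by simp)
          (ENNReal.mul_ne_top (by simp) (by simp))]
        norm_num,
      ← ENNReal.toReal_eq_toReal_iff' (by
        exact ENNReal.add_ne_top.2 ⟨ENNReal.mul_ne_top (by simp) (by simp), by simp⟩) (by simp),
      ENNReal.toReal_add (ENNReal.mul_ne_top (by simp) (by simp)) (by simp)]
    norm_num⟩
  have hsq : ∀ u : H10 Ω, eLpNorm (fun x => toL2 u x ^ 2) 3 (volume.restrict Ω) ≤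
      ENNReal.ofReal ((C * normOne u) ^ 2) := fun u => by
    have h1 := eLpNorm_norm_rpow (μ := volume.restrict Ω) (p := 3) (toL2 u) (q := 2) two_pos
    rw [show (3 : ℝ≥0∞) * ENNReal.ofReal 2 = 6 by norm_num] at h1
    have e : (fun x => toL2 u x ^ 2) = fun x => ‖toL2 u x‖ ^ (2 : ℝ) := by
      ext x; simp
    rw [e, h1, ENNReal.ofReal_pow (by have := normOne_nonneg u; positivity)]
    rw [show (2 : ℝ) = ((2 : ℕ) : ℝ) by norm_num, ENNReal.rpow_natCast]
    gcongr
    exact hS u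
  have hmeas : ∀ u : H10 Ω, AEStronglyMeasurable (fun x => toL2 u x ^ 2) (volume.restrict Ω) :=
    fun u => (Lp.aestronglyMeasurable _).pow 2
  refine ⟨(m + C ^ 2) * C, by positivity, fun u₁ u₂ φ => ?_⟩
  have n1 := normOne_nonneg u₁
  have n2 := normOne_nonneg u₂
  have n3 := normOne_nonneg φ
  have h3 : eLpNorm (fun x => 1 + toL2 u₁ x ^ 2 + toL2 u₂ x ^ 2) 3 (volume.restrict Ω) ≤
      ENNReal.ofReal (m + (C * normOne u₁) ^ 2 + (C * normOne u₂) ^ 2) := by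
    rw [ENNReal.ofReal_add (by positivity) (by positivity), ENNReal.ofReal_add hm0 (by positivity),
      ← hmt]
    refine (eLpNorm_add_le (aestronglyMeasurable_const.add (hmeas u₁)) (hmeas u₂)
      (by norm_num)).trans (add_le_add ((eLpNorm_add_le aestronglyMeasurable_const (hmeas u₁)
      (by norm_num)).trans (add_le_add le_rfl (hsq u₁))) (hsq u₂))
  refine (eLpNorm_smul_le_mul_eLpNorm (p := 3) (q := 6) (Lp.aestronglyMeasurable (toL2 φ))
    ((aestronglyMeasurable_const.add (hmeas u₁)).add (hmeas u₂))).trans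
    ((mul_le_mul' h3 (hS φ)).trans ?_)
  rw [← ENNReal.ofReal_mul (by positivity)]
  refine ENNReal.ofReal_le_ofReal ?_
  rw [← mul_assoc, show (m + C ^ 2) * C * (1 + normOne u₁ ^ 2 + normOne u₂ ^ 2) * normOne φ =
    (m + C ^ 2) * (1 + normOne u₁ ^ 2 + normOne u₂ ^ 2) * C * normOne φ by ring]
  gcongr
  nlinarith [mul_nonneg hm0 (sq_nonneg (normOne u₁)), mul_nonneg hm0 (sq_nonneg (normOne u₂)),
    sq_nonneg C]

theorem IsCubic.exists_inner_superpos_sub_le {f : ℝ → ℝ} {c : ℝ} (hf : IsCubic f c)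
    (hb : Bornology.IsBounded Ω) : ∃ C ≥ 0, ∀ u₁ u₂ φ : H10 Ω,
      |⟪superpos f (toL2 u₁) - superpos f (toL2 u₂), toL2 φ⟫_ℝ| ≤
        C * (1 + normOne u₁ ^ 2 + normOne u₂ ^ 2) * ‖toL2 u₁ - toL2 u₂‖ * normOne φ := by
  obtain ⟨C, hC, hw⟩ := exists_eLpNorm_weight_le hb
  refine ⟨c * C, mul_nonneg hf.nonneg hC, fun u₁ u₂ φ => ?_⟩
  have hc := hf.nonneg
  have n1 := normOne_nonneg u₁
  have n2 := normOne_nonneg u₂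
  have n3 := normOne_nonneg φ
  set G : E3 → ℝ := fun x => (1 + toL2 u₁ x ^ 2 + toL2 u₂ x ^ 2) * toL2 φ x
  have hG : MemLp G 2 (volume.restrict Ω) := by
    refine ⟨((aestronglyMeasurable_const.add ((Lp.aestronglyMeasurable _).pow 2)).add
      ((Lp.aestronglyMeasurable _).pow 2)).mul (Lp.aestronglyMeasurable _),
      (hw u₁ u₂ φ).trans_lt ENNReal.ofReal_lt_top⟩
  have hd := Lp.memLp (toL2 u₁ - toL2 u₂)
  have h1 : ⟪hd.norm.toLp _, hG.norm.toLp _⟫_ℝ ≤ ‖toL2 u₁ - toL2 u₂‖ *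
      (C * (1 + normOne u₁ ^ 2 + normOne u₂ ^ 2) * normOne φ) := by
    refine (real_inner_le_norm _ _).trans (mul_le_mul ?_ ?_ (norm_nonneg _) (norm_nonneg _))
    · rw [Lp.norm_toLp, eLpNorm_norm, Lp.norm_def]
    · rw [Lp.norm_toLp, eLpNorm_norm]
      exact ENNReal.toReal_le_of_le_ofReal (by positivity) (hw u₁ u₂ φ)
  have h2 : |⟪superpos f (toL2 u₁) - superpos f (toL2 u₂), toL2 φ⟫_ℝ| ≤
      c * ⟪hd.norm.toLp _, hG.norm.toLp _⟫_ℝ := by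
    rw [L2.inner_def, L2.inner_def, ← integral_const_mul, ← Real.norm_eq_abs]
    refine norm_integral_le_of_norm_le ((L2.integrable_inner _ _).const_mul c) ?_
    filter_upwards [Lp.coeFn_sub (superpos f (toL2 u₁)) (superpos f (toL2 u₂)),
      Lp.coeFn_sub (toL2 u₁) (toL2 u₂), coeFn_superpos (hf.memLp hb u₁),
      coeFn_superpos (hf.memLp hb u₂), hd.norm.coeFn_toLp, hG.norm.coeFn_toLp]
      with x e1 e2 e3 e4 e5 e6
    rw [e1, e5, e6, e2]
    simp only [Pi.sub_apply, e3, e4, RCLike.inner_apply, conj_trivial,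
      Real.norm_eq_abs, abs_mul, G]
    have h3 := hf.abs_sub_le (toL2 u₁ x) (toL2 u₂ x)
    rw [abs_of_nonneg (show 0 ≤ 1 + toL2 u₁ x ^ 2 + toL2 u₂ x ^ 2 by positivity)]
    have := mul_le_mul_of_nonneg_left h3 (abs_nonneg (toL2 φ x))
    nlinarith
  refine h2.trans ((mul_le_mul_of_nonneg_left h1 hc).trans_eq (by ring))

end

/-! ### The potential energy -/

section

variable {Ω : Set E3}

/-- The truncation of `f` outside `[-k, k]`. -/
def truncate (f : ℝ → ℝ) (k : ℕ) (r : ℝ) : ℝ := f (max (-k) (min k r))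

theorem abs_clamp_sub_le (k a b : ℝ) :
    |max (-k) (min k a) - max (-k) (min k b)| ≤ |a - b| :=
  (abs_max_sub_max_le_max _ _ _ _).trans (by
    rw [sub_self, abs_zero]
    exact max_le (abs_nonneg _) ((abs_min_sub_min_le_max _ _ _ _).trans (by simp)))

theorem abs_clamp_le {k : ℝ} (hk : 0 ≤ k) (a : ℝ) : |max (-k) (min k a)| ≤ min k |a| := by
  refine le_min (abs_le.2 ⟨le_max_left _ _, max_le (by linarith) (min_le_left _ _)⟩) ?_
  have := abs_clamp_sub_le k a 0
  simpa [hk] using this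

theorem truncate_of_abs_le (f : ℝ → ℝ) {k : ℕ} {r : ℝ} (h : |r| ≤ k) : truncate f k r = f r := by
  have := abs_le.1 h
  rw [truncate, min_eq_right this.2, max_eq_right this.1]

/-- The primitive of `f` that vanishes at zero. -/
def primitive (f : ℝ → ℝ) (r : ℝ) : ℝ := ∫ s in (0 : ℝ)..r, f s

/-- The functional `u ↦ ∫_Ω F(u)`, where `F' = f`. -/
def potential (f : ℝ → ℝ) (u : L2 Ω) : ℝ := ∫ x in Ω, primitive f (u x)

theorem primitive_truncate (f : ℝ → ℝ) {k : ℕ} {r : ℝ} (h : |r| ≤ k) :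
    primitive (truncate f k) r = primitive f r := by
  refine intervalIntegral.integral_congr fun s hs => truncate_of_abs_le f ?_
  have : |s - 0| ≤ |r - 0| := abs_sub_left_of_mem_uIcc hs
  simp only [sub_zero] at this
  exact this.trans h

namespace IsCubic

variable {f : ℝ → ℝ} {c : ℝ}

theorem truncate (hf : IsCubic f c) (k : ℕ) : IsCubic (truncate f k) c where
  nonneg := hf.nonneg
  zero := by
    rw [truncate_of_abs_le f (by simp)]
    exact hf.zero
  abs_sub_le a b := by
    have h : ∀ a : ℝ, max (-k : ℝ) (min k a) ^ 2 ≤ a ^ 2 := fun a =>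
      sq_le_sq.2 ((abs_clamp_le k.cast_nonneg a).trans (min_le_right _ _))
    refine (hf.abs_sub_le _ _).trans ?_
    have := hf.nonneg
    refine mul_le_mul (mul_le_mul_of_nonneg_left ?_ this) (abs_clamp_sub_le _ _ _) (abs_nonneg _)
      (by positivity)
    linarith [h a, h b]

theorem abs_truncate_sub_le (hf : IsCubic f c) (k : ℕ) (a b : ℝ) :
    |AgingMemory.truncate f k a - AgingMemory.truncate f k b| ≤ c * (1 + 2 * k ^ 2) * |a - b| := by
  have h : ∀ a : ℝ, max (-k : ℝ) (min k a) ^ 2 ≤ k ^ 2 := fun a =>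
      sq_le_sq.2 (by simpa using (abs_clamp_le k.cast_nonneg a).trans (min_le_left _ _))
  refine (hf.abs_sub_le _ _).trans ?_
  have := hf.nonneg
  refine mul_le_mul (mul_le_mul_of_nonneg_left ?_ this) (abs_clamp_sub_le _ _ _) (abs_nonneg _)
      (by positivity)
  linarith [h a, h b]

theorem primitive_sub (hf : IsCubic f c) (a b : ℝ) :
    primitive f b - primitive f a = ∫ s in a..b, f s :=
  intervalIntegral.integral_interval_sub_left (hf.continuous.intervalIntegrable _ _)
    (hf.continuous.intervalIntegrable _ _)

theorem continuous_primitive (hf : IsCubic f c) : Continuous (primitive f) :=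
  intervalIntegral.continuous_primitive (fun a b => hf.continuous.intervalIntegrable a b) 0

theorem abs_primitive_le (hf : IsCubic f c) (r : ℝ) : |primitive f r| ≤ 2 * c * (1 + r ^ 6) := by
  have h1 : |primitive f r| ≤ c * (1 + r ^ 2) * |r| * |r - 0| := by
    rw [primitive, ← Real.norm_eq_abs (∫ s in (0 : ℝ)..r, f s)]
    refine intervalIntegral.norm_integral_le_of_norm_le_const fun s hs => ?_
    have h2 : |s - 0| ≤ |r - 0| := abs_sub_left_of_mem_uIcc (uIoc_subset_uIcc hs)
    simp only [sub_zero] at h2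
    have := hf.nonneg
    rw [Real.norm_eq_abs]
    refine (hf.abs_le s).trans ?_
    gcongr c * (1 + ?_) * ?_
    exact sq_le_sq.2 h2
  refine h1.trans ?_
  rw [sub_zero, mul_assoc, ← sq, sq_abs]
  have h3 : (1 + r ^ 2) * r ^ 2 ≤ 2 * (1 + r ^ 6) := by
    have hs := sq_nonneg r
    have e : r ^ 6 = (r ^ 2) ^ 3 := by ring
    rw [e]
    generalize r ^ 2 = s at *
    nlinarith [mul_nonneg hs (sq_nonneg (s - 1)), sq_nonneg (s - 1), mul_nonneg hs hs]
  nlinarith [hf.nonneg]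

theorem integrable_primitive (hf : IsCubic f c) (hb : Bornology.IsBounded Ω) (u : H10 Ω) :
    Integrable (fun x => primitive f (toL2 u x)) (volume.restrict Ω) := by
  have : IsFiniteMeasure (volume.restrict Ω) := ⟨by simpa using hb.measure_lt_top⟩
  exact (((integrable_const 1).add (integrable_pow_six u)).const_mul (2 * c)).mono'
    (hf.continuous_primitive.comp_aestronglyMeasurable (Lp.aestronglyMeasurable _))
    (ae_of_all _ fun x => hf.abs_primitive_le _)

theorem abs_potential_le (hf : IsCubic f c) (hb : Bornology.IsBounded Ω) (u : H10 Ω) :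
    |potential f (toL2 u)| ≤ 2 * c * (volume.real Ω + ∫ x in Ω, toL2 u x ^ 6) := by
  have : IsFiniteMeasure (volume.restrict Ω) := ⟨by simpa using hb.measure_lt_top⟩
  have e2 : 2 * c * (volume.real Ω + ∫ x in Ω, toL2 u x ^ 6) =
      ∫ x in Ω, 2 * c * (1 + toL2 u x ^ 6) := by
    rw [integral_const_mul, integral_add (integrable_const 1) (integrable_pow_six u)]
    simp
  rw [e2, potential, ← Real.norm_eq_abs]
  exact norm_integral_le_of_norm_le (((integrable_const 1).add (integrable_pow_six u)).const_mul _)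
    (ae_of_all _ fun x => hf.abs_primitive_le _)

section Lipschitz

variable {L : ℝ}

theorem abs_primitive_sub_le (hf : IsCubic f c) (hL : ∀ a b, |f a - f b| ≤ L * |a - b|)
    (hL0 : 0 ≤ L) (a b : ℝ) :
    |primitive f b - primitive f a - f a * (b - a)| ≤ L * (b - a) ^ 2 := by
  have e : primitive f b - primitive f a - f a * (b - a) = ∫ s in a..b, (f s - f a) := by
    rw [hf.primitive_sub, intervalIntegral.integral_sub (hf.continuous.intervalIntegrable _ _)
      intervalIntegrable_const]
    simp [mul_comm]
  rw [e, ← sq_abs (b - a), sq, ← mul_assoc, ← Real.norm_eq_abs (∫ s in a..b, (f s - f a))]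
  refine intervalIntegral.norm_integral_le_of_norm_le_const fun s hs => ?_
  rw [Real.norm_eq_abs]
  exact (hL s a).trans (mul_le_mul_of_nonneg_left
    (abs_sub_left_of_mem_uIcc (uIoc_subset_uIcc hs)) hL0)

theorem memLp_of_lipschitz (hf : IsCubic f c) (hL : ∀ a b, |f a - f b| ≤ L * |a - b|) (u : L2 Ω) :
    MemLp (fun x => f (u x)) 2 (volume.restrict Ω) := by
  refine (Lp.memLp u).of_le_mul (c := L)
    (hf.continuous.comp_aestronglyMeasurable (Lp.aestronglyMeasurable _)) (ae_of_all _ fun x => ?_)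
  simpa [hf.zero] using hL (u x) 0

theorem integrable_primitive_of_lipschitz (hf : IsCubic f c)
    (hL : ∀ a b, |f a - f b| ≤ L * |a - b|) (hL0 : 0 ≤ L) (u : L2 Ω) :
    Integrable (fun x => primitive f (u x)) (volume.restrict Ω) := by
  refine ((Lp.memLp u).integrable_sq.const_mul L).mono'
    (hf.continuous_primitive.comp_aestronglyMeasurable (Lp.aestronglyMeasurable _))
    (ae_of_all _ fun x => ?_)
  simpa [hf.zero, primitive] using hf.abs_primitive_sub_le hL hL0 0 (u x)

theorem norm_superpos_sub_le (hf : IsCubic f c) (hL : ∀ a b, |f a - f b| ≤ L * |a - b|)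
    (u v : L2 Ω) : ‖superpos f u - superpos f v‖ ≤ L * ‖u - v‖ := by
  refine Lp.norm_le_mul_norm_of_ae_le_mul ?_
  filter_upwards [Lp.coeFn_sub (superpos f u) (superpos f v), Lp.coeFn_sub u v,
    coeFn_superpos (hf.memLp_of_lipschitz hL u), coeFn_superpos (hf.memLp_of_lipschitz hL v)]
    with x h1 h2 h3 h4
  rw [h1, h2, Pi.sub_apply, Pi.sub_apply, h3, h4]
  exact hL _ _

theorem abs_potential_sub_le (hf : IsCubic f c) (hL : ∀ a b, |f a - f b| ≤ L * |a - b|)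
    (hL0 : 0 ≤ L) (u v : L2 Ω) :
    |potential f v - potential f u - ⟪superpos f u, v - u⟫_ℝ| ≤ L * ‖v - u‖ ^ 2 := by
  have hm := hf.memLp_of_lipschitz hL u
  have i1 := hf.integrable_primitive_of_lipschitz hL hL0 v
  have i2 := hf.integrable_primitive_of_lipschitz hL hL0 u
  have i3 : Integrable (fun x => f (u x) * (v - u : L2 Ω) x) (volume.restrict Ω) :=
    hm.integrable_mul (Lp.memLp _)
  rw [inner_superpos hm, potential, potential, ← integral_sub i1 i2,
    ← integral_sub (f := fun x => primitive f (v x) - primitive f (u x)) (i1.sub i2) i3,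
    ← real_inner_self_eq_norm_sq, L2.inner_def, ← integral_const_mul, ← Real.norm_eq_abs]
  refine norm_integral_le_of_norm_le ((L2.integrable_inner _ _).const_mul L) ?_
  filter_upwards [Lp.coeFn_sub v u] with x hx
  rw [real_inner_self_eq_norm_sq, hx, Pi.sub_apply, Real.norm_eq_abs, Real.norm_eq_abs, sq_abs]
  exact hf.abs_primitive_sub_le hL hL0 _ _

end Lipschitz

end IsCubic

end

/-! ### The chain rule for the potential energy -/

section

variable {Ω : Set E3} {μ : ℝ → ℝ → ℝ} {τ T V : ℝ} {f : ℝ → ℝ} {c L : ℝ}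

/-- A function with increments of the second order is constant. -/
theorem eq_of_abs_increment_le {Q : ℝ → ℝ} {a b C : ℝ} (hab : a ≤ b)
    (h : ∀ s ∈ Icc a b, ∀ t ∈ Icc a b, s ≤ t → |Q t - Q s| ≤ C * (t - s) ^ 2) : Q b = Q a := by
  have hθ : ContinuousOn (fun t => C * t) (Icc a b) := by fun_prop
  have hp : MonotoneOn (fun t : ℝ => t) (Icc a b) := fun _ _ _ _ h => h
  refine le_antisymm (le_of_increment_le hab hθ hp fun s hs t ht hst => ?_) (neg_le_neg_iff.1
    (le_of_increment_le (Q := fun t => -Q t) hab hθ hp fun s hs t ht hst => ?_))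
  · have := (abs_le.1 (h s hs t ht hst)).2
    nlinarith
  · have := (abs_le.1 (h s hs t ht hst)).1
    nlinarith

namespace IsMemoryCurve

variable {y v : ℝ → L2 Ω}

theorem intervalIntegrable_power_of_lipschitz (h : IsMemoryCurve μ τ T V y v) (hf : IsCubic f c)
    (hL : ∀ a b, |f a - f b| ≤ L * |a - b|) (hL0 : 0 ≤ L) :
    IntervalIntegrable (fun r => ⟪superpos f (y r), v r⟫_ℝ) volume τ T := by
  have hc : ContinuousOn (fun r => superpos f (y r)) (Icc τ T) := by
    have h1 : LipschitzWith L.toNNReal (superpos f : L2 Ω → L2 Ω) :=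
      LipschitzWith.of_dist_le_mul fun a b => by
        rw [dist_eq_norm, dist_eq_norm, Real.coe_toNNReal L hL0]
        exact hf.norm_superpos_sub_le hL a b
    exact h1.continuous.comp_continuousOn h.continuousOn
  have h2 := intervalIntegrable_weight_mul (β := innerSL ℝ) (q := fun _ => 1) h.le h.integrable hc
    antitoneOn_const fun _ _ => zero_le_one
  simp only [one_mul] at h2
  exact h2

theorem potential_eq_of_lipschitz (h : IsMemoryCurve μ τ T V y v) (hf : IsCubic f c)
    (hL : ∀ a b, |f a - f b| ≤ L * |a - b|) (hL0 : 0 ≤ L) {t : ℝ} (ht : t ∈ Icc τ T) :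
    potential f (y t) = potential f (y τ) + ∫ r in τ..t, ⟪superpos f (y r), v r⟫_ℝ := by
  have hi := h.intervalIntegrable_power_of_lipschitz hf hL hL0
  have hτ : τ ∈ Icc τ T := left_mem_Icc.2 h.le
  have hV := h.bdd_nonneg
  have key := eq_of_abs_increment_le (C := 2 * L * V ^ 2) ht.1
    (Q := fun t => potential f (y t) - ∫ r in τ..t, ⟪superpos f (y r), v r⟫_ℝ) ?_
  · simp only [intervalIntegral.integral_same, sub_zero] at key
    linarith
  intro a ha b hb hab
  have ha' : a ∈ Icc τ T := ⟨ha.1, ha.2.trans ht.2⟩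
  have hb' : b ∈ Icc τ T := ⟨hb.1, hb.2.trans ht.2⟩
  have hvi := intervalIntegrable_sub h.integrable ha' hb'
  have h1 := hf.abs_potential_sub_le hL hL0 (y a) (y b)
  have h2 := h.norm_sub_le ha' hb' hab
  have h3 : ⟪superpos f (y a), y b - y a⟫_ℝ = ∫ r in a..b, ⟪superpos f (y a), v r⟫_ℝ := by
    rw [sub_eq_integral h.integrable h.eq_integral ha' hb']
    exact ((innerSL ℝ (superpos f (y a))).intervalIntegral_comp_comm hvi).symm
  have hi1 : IntervalIntegrable (fun r => ⟪superpos f (y a), v r⟫_ℝ) volume a b := by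
    rw [intervalIntegrable_iff] at hvi ⊢
    exact (innerSL ℝ (superpos f (y a))).integrable_comp hvi
  have h4 : |(∫ r in a..b, ⟪superpos f (y r), v r⟫_ℝ) - ∫ r in a..b, ⟪superpos f (y a), v r⟫_ℝ| ≤
      L * (V * (b - a)) * V * |b - a| := by
    rw [← intervalIntegral.integral_sub (intervalIntegrable_sub hi ha' hb') hi1,
      ← Real.norm_eq_abs (∫ r in a..b, _)]
    refine intervalIntegral.norm_integral_le_of_norm_le_const_ae ?_
    filter_upwards [(ae_restrict_iff' measurableSet_Icc).1 h.bdd] with r hr hr'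
    rw [uIoc_of_le hab] at hr'
    have hrT : r ∈ Icc τ T := ⟨ha'.1.trans hr'.1.le, hr'.2.trans hb'.2⟩
    rw [← inner_sub_left]
    refine (norm_inner_le_norm _ _).trans (mul_le_mul ?_ (hr hrT) (norm_nonneg _) ?_)
    · refine (hf.norm_superpos_sub_le hL _ _).trans (mul_le_mul_of_nonneg_left ?_ hL0)
      exact (h.norm_sub_le ha' hrT hr'.1.le).trans (by gcongr; exact hr'.2)
    · have := sub_nonneg.2 hab
      positivity
  have h5 : L * ‖y b - y a‖ ^ 2 ≤ L * (V * (b - a)) ^ 2 := by gcongr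
  have e : (∫ r in τ..b, ⟪superpos f (y r), v r⟫_ℝ) - ∫ r in τ..a, ⟪superpos f (y r), v r⟫_ℝ =
      ∫ r in a..b, ⟪superpos f (y r), v r⟫_ℝ :=
    intervalIntegral.integral_interval_sub_left (intervalIntegrable_sub hi hτ hb')
      (intervalIntegrable_sub hi hτ ha')
  rw [abs_of_nonneg (sub_nonneg.2 hab)] at h4
  rw [h3] at h1
  rw [abs_le] at *
  constructor <;> nlinarith [h1.1, h1.2, h4.1, h4.2]

end IsMemoryCurve

theorem tendsto_inner_superpos_truncate (hf : IsCubic f c) (hb : Bornology.IsBounded Ω)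
    (u : H10 Ω) (v : L2 Ω) :
    Tendsto (fun k => ⟪superpos (truncate f k) (toL2 u), v⟫_ℝ) atTop
      (𝓝 ⟪superpos f (toL2 u), v⟫_ℝ) := by
  have : IsFiniteMeasure (volume.restrict Ω) := ⟨by simpa using hb.measure_lt_top⟩
  simp only [inner_superpos (hf.memLp hb u), fun k => inner_superpos ((hf.truncate k).memLp hb u)]
  refine tendsto_integral_of_dominated_convergence
    (fun x => 4 * c ^ 2 * (1 + toL2 u x ^ 6) + v x ^ 2) (fun k => ?_) ?_ (fun k => ?_) ?_
  · exact ((hf.truncate k).memLp hb u).1.mul (Lp.aestronglyMeasurable _)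
  · exact (((integrable_const 1).add (integrable_pow_six u)).const_mul _).add
      (Lp.memLp v).integrable_sq
  · refine ae_of_all _ fun x => ?_
    have h1 := (hf.truncate k).sq_le (toL2 u x)
    rw [Real.norm_eq_abs, abs_mul]
    nlinarith [sq_nonneg (|truncate f k (toL2 u x)| - |v x|), sq_abs (truncate f k (toL2 u x)),
      sq_abs (v x), sq_nonneg (v x), sq_nonneg (truncate f k (toL2 u x))]
  · refine ae_of_all _ fun x => tendsto_const_nhds.congr' ?_
    filter_upwards [eventually_ge_atTop ⌈|toL2 u x|⌉₊] with k hk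
    rw [truncate_of_abs_le f ((Nat.le_ceil _).trans (by exact_mod_cast hk))]

theorem tendsto_potential_truncate (hf : IsCubic f c) (hb : Bornology.IsBounded Ω) (u : H10 Ω) :
    Tendsto (fun k => potential (truncate f k) (toL2 u)) atTop (𝓝 (potential f (toL2 u))) := by
  have : IsFiniteMeasure (volume.restrict Ω) := ⟨by simpa using hb.measure_lt_top⟩
  refine tendsto_integral_of_dominated_convergence (fun x => 2 * c * (1 + toL2 u x ^ 6))
    (fun k => ?_) ?_ (fun k => ?_) ?_
  · exact ((hf.truncate k).integrable_primitive hb u).1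
  · exact ((integrable_const 1).add (integrable_pow_six u)).const_mul _
  · exact ae_of_all _ fun x => (hf.truncate k).abs_primitive_le _
  · refine ae_of_all _ fun x => tendsto_const_nhds.congr' ?_
    filter_upwards [eventually_ge_atTop ⌈|toL2 u x|⌉₊] with k hk
    rw [primitive_truncate f ((Nat.le_ceil _).trans (by exact_mod_cast hk))]

theorem IsCubic.exists_norm_superpos_le (hf : IsCubic f c) (hb : Bornology.IsBounded Ω) (B : ℝ) :
    ∃ D ≥ 0, ∀ u : H10 Ω, normOne u ≤ B → ‖superpos f (toL2 u)‖ ≤ D ∧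
      ∀ k, ‖superpos (AgingMemory.truncate f k) (toL2 u)‖ ≤ D := by
  obtain ⟨C, hC, hS⟩ := exists_integral_pow_six_le Ω
  have key : ∀ f, IsCubic f c → ∀ u : H10 Ω, normOne u ≤ B → ‖superpos f (toL2 u)‖ ≤
      √(4 * c ^ 2 * (volume.real Ω + C * B ^ 6)) := fun f hf u hu => by
    refine Real.le_sqrt_of_sq_le ((hf.sq_norm_superpos_le hb u).trans ?_)
    have := normOne_nonneg u
    gcongr
    refine (hS u).trans ?_
    gcongr
  exact ⟨_, Real.sqrt_nonneg _, fun u hu => ⟨key f hf u hu, fun k => key _ (hf.truncate k) u hu⟩⟩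

/-- The chain rule for the potential along a curve that is bounded in `H¹₀(Ω)`. -/
theorem IsMemoryCurve.potential_eq {y v : ℝ → L2 Ω} {u : ℝ → H10 Ω} {B : ℝ}
    (h : IsMemoryCurve μ τ T V y v)
    (hu : ∀ t ∈ Icc τ T, y t = toL2 (u t)) (hf : IsCubic f c) (hb : Bornology.IsBounded Ω)
    (hB : ∀ᵐ t ∂volume.restrict (Icc τ T), normOne (u t) ≤ B) :
    (∃ D, ∀ᵐ r ∂volume.restrict (Icc τ T), |⟪superpos f (y r), v r⟫_ℝ| ≤ D) ∧
    IntervalIntegrable (fun r => ⟪superpos f (y r), v r⟫_ℝ) volume τ T ∧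
    ∀ t ∈ Icc τ T, potential f (y t) =
      potential f (y τ) + ∫ r in τ..t, ⟪superpos f (y r), v r⟫_ℝ := by
  obtain ⟨D, hD0, hD⟩ := hf.exists_norm_superpos_le hb B
  have hτ : τ ∈ Icc τ T := left_mem_Icc.2 h.le
  have hlip : ∀ k, (0 : ℝ) ≤ c * (1 + 2 * k ^ 2) := fun k => by have := hf.nonneg; positivity
  have hik : ∀ k, IntervalIntegrable (fun r => ⟪superpos (truncate f k) (y r), v r⟫_ℝ) volume τ T :=
    fun k => h.intervalIntegrable_power_of_lipschitz (hf.truncate k) (hf.abs_truncate_sub_le k)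
        (hlip k)
  have hlim : ∀ r ∈ Icc τ T, Tendsto (fun k => ⟪superpos (truncate f k) (y r), v r⟫_ℝ) atTop
      (𝓝 ⟪superpos f (y r), v r⟫_ℝ) := fun r hr => by
    rw [hu r hr]
    exact tendsto_inner_superpos_truncate hf hb _ _
  have hbd : ∀ᵐ r ∂volume.restrict (Icc τ T), |⟪superpos f (y r), v r⟫_ℝ| ≤ D * V ∧
      ∀ k, |⟪superpos (truncate f k) (y r), v r⟫_ℝ| ≤ D * V := by
    filter_upwards [hB, h.bdd, ae_restrict_mem measurableSet_Icc] with r h1 h2 hr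
    have h3 := hD _ h1
    rw [← hu r hr] at h3
    exact ⟨(abs_real_inner_le_norm _ _).trans (mul_le_mul h3.1 h2 (norm_nonneg _) hD0),
      fun k => (abs_real_inner_le_norm _ _).trans (mul_le_mul (h3.2 k) h2 (norm_nonneg _) hD0)⟩
  have hii : IntervalIntegrable (fun r => ⟪superpos f (y r), v r⟫_ℝ) volume τ T := by
    rw [intervalIntegrable_iff_integrableOn_Icc_of_le h.le]
    refine Integrable.mono' (integrable_const (D * V)) ?_ (hbd.mono fun r hr => hr.1)
    refine aestronglyMeasurable_of_tendsto_ae atTop (fun k => ?_)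
      ((ae_restrict_mem measurableSet_Icc).mono hlim)
    exact ((intervalIntegrable_iff_integrableOn_Icc_of_le h.le).1 (hik k)).1
  refine ⟨⟨_, hbd.mono fun r hr => hr.1⟩, hii, fun t ht => ?_⟩
  have h1 : Tendsto (fun k => ∫ r in τ..t, ⟪superpos (truncate f k) (y r), v r⟫_ℝ) atTop
      (𝓝 (∫ r in τ..t, ⟪superpos f (y r), v r⟫_ℝ)) := by
    have hsub : uIoc τ t ⊆ Icc τ T := by
      rw [uIoc_of_le ht.1]
      exact Ioc_subset_Icc_self.trans (Icc_subset_Icc_right ht.2)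
    refine intervalIntegral.tendsto_integral_filter_of_dominated_convergence (fun _ => D * V)
      (.of_forall fun k => ?_) (.of_forall fun k => ?_) intervalIntegrable_const
      (ae_of_all _ fun r hr => hlim r (hsub hr))
    · exact (intervalIntegrable_sub (hik k) hτ ht).aestronglyMeasurable_restrict_uIoc
    · filter_upwards [(ae_restrict_iff' measurableSet_Icc).1 hbd] with r hr hr'
      exact (hr (hsub hr')).2 k
  have h2 := tendsto_potential_truncate hf hb (u t)
  have h3 := tendsto_potential_truncate hf hb (u τ)
  rw [← hu t ht] at h2
  rw [← hu τ hτ] at h3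
  refine tendsto_nhds_unique h2 ((h3.add h1).congr fun k => ?_)
  exact (h.potential_eq_of_lipschitz (hf.truncate k) (hf.abs_truncate_sub_le k) (hlip k) ht).symm

end

/-! ### Coercivity of the potential energy -/

section

variable {Ω : Set E3} {f : ℝ → ℝ} {c : ℝ}

theorem IsCubic.exists_le_primitive (hf : IsCubic f c) {m : ℝ}
    (h : (m : EReal) < liminf (fun r : ℝ => ((f r / r : ℝ) : EReal)) (cocompact ℝ)) :
    ∃ C ≥ 0, ∀ r, m / 2 * r ^ 2 - C * |r| ≤ primitive f r := by
  have h1 := eventually_lt_of_lt_liminf h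
  rw [cocompact_eq_atBot_atTop, eventually_sup] at h1
  obtain ⟨R₁, hR₁⟩ := eventually_atBot.1 h1.1
  obtain ⟨R₂, hR₂⟩ := eventually_atTop.1 h1.2
  set R : ℝ := max 1 (max (-R₁) R₂) with hR
  have hR1 : 1 ≤ R := le_max_left _ _
  have hR0 : 0 ≤ R := by linarith
  have hc := hf.nonneg
  have hpos : ∀ s ≥ R, m * s ≤ f s := fun s hs => by
    have h2 := hR₂ s ((le_max_right _ _).trans ((le_max_right _ _).trans hs))
    rw [EReal.coe_lt_coe_iff, lt_div_iff₀ (by linarith)] at h2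
    exact h2.le
  have hneg : ∀ s ≤ -R, f s ≤ m * s := fun s hs => by
    have h3 : -R₁ ≤ R := (le_max_left _ _).trans (le_max_right _ _)
    have h2 := hR₁ s (by linarith)
    rw [EReal.coe_lt_coe_iff, lt_div_iff_of_neg (by linarith)] at h2
    exact h2.le
  set C := c * (1 + R ^ 2) * R + |m| * R with hC
  have hC0 : 0 ≤ C := by positivity
  have hmid : ∀ s, |s| ≤ R → |f s - m * s| ≤ C := fun s hs => by
    have h2 : |f s| ≤ c * (1 + R ^ 2) * R := by
      refine (hf.abs_le s).trans ?_
      have : s ^ 2 ≤ R ^ 2 := sq_le_sq.2 (by rwa [abs_of_nonneg hR0])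
      gcongr
    have h3 : |m * s| ≤ |m| * R := by rw [abs_mul]; gcongr
    exact (abs_sub _ _).trans (add_le_add h2 h3)
  have hpos' : ∀ s ≥ 0, m * s - C ≤ f s := fun s hs => by
    rcases le_total R s with h2 | h2
    · linarith [hpos s h2]
    · linarith [(_root_.abs_le.1 (hmid s (by rwa [abs_of_nonneg hs]))).1]
  have hneg' : ∀ s ≤ 0, f s ≤ m * s + C := fun s hs => by
    rcases le_total s (-R) with h2 | h2
    · linarith [hneg s h2]
    · linarith [(_root_.abs_le.1 (hmid s (by rw [abs_of_nonpos hs]; linarith))).2]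
  refine ⟨C, hC0, fun r => ?_⟩
  have hi : ∀ a b, IntervalIntegrable f volume a b :=
      fun a b => hf.continuous.intervalIntegrable _ _
  rcases le_total 0 r with hr | hr
  · have h2 := intervalIntegral.integral_mono_on hr (f := fun s => m * s - C) (g := f)
      (by apply Continuous.intervalIntegrable; fun_prop) (hi _ _) fun s hs => hpos' s hs.1
    rw [intervalIntegral.integral_sub (by apply Continuous.intervalIntegrable; fun_prop)
      (by simp), intervalIntegral.integral_const_mul, integral_id, intervalIntegral.integral_const]
      at h2
    rw [abs_of_nonneg hr]
    simp only [primitive, smul_eq_mul] at h2 ⊢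
    linarith
  · have h2 := intervalIntegral.integral_mono_on hr (g := fun s => m * s + C) (f := f)
      (hi _ _) (by apply Continuous.intervalIntegrable; fun_prop) fun s hs => hneg' s hs.2
    rw [intervalIntegral.integral_add (by apply Continuous.intervalIntegrable; fun_prop)
      (by simp), intervalIntegral.integral_const_mul, integral_id, intervalIntegral.integral_const]
      at h2
    rw [abs_of_nonpos hr, primitive, intervalIntegral.integral_symm]
    simp only [smul_eq_mul] at h2
    linarith

/-- The dissipation condition makes the potential energy coercive. -/
theorem IsCubic.exists_coercive (hf : IsCubic f c) (hΩ : IsOpen Ω) (hb : Bornology.IsBounded Ω)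
    (hd : ((-firstEigenvalue Ω : ℝ) : EReal) <
      liminf (fun r : ℝ => ((f r / r : ℝ) : EReal)) (cocompact ℝ)) (g : L2 Ω) :
    ∃ θ ∈ Ico (0 : ℝ) 1, ∃ C ≥ 0, ∀ u : H10 Ω,
      -(θ / 2 * normOne u ^ 2) - C ≤ potential f (toL2 u) - ⟪g, toL2 u⟫_ℝ := by
  have : IsFiniteMeasure (volume.restrict Ω) := ⟨by simpa using hb.measure_lt_top⟩
  obtain ⟨m, hm1, hm2⟩ := EReal.lt_iff_exists_real_btwn.1 hd
  rw [EReal.coe_lt_coe_iff] at hm1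
  obtain ⟨C, hC, hF⟩ := hf.exists_le_primitive hm2
  set δ := (m + firstEigenvalue Ω) / 4 with hδ
  have hδ0 : 0 < δ := by rw [hδ]; linarith
  set lam := firstEigenvalue Ω with hlam
  have hquad : ∀ a x : ℝ, a * x ≤ δ / 2 * x ^ 2 + a ^ 2 / (2 * δ) := fun a x => by
    have h : 0 ≤ (δ * x - a) ^ 2 / (2 * δ) := by positivity
    have e : (δ * x - a) ^ 2 / (2 * δ) = δ / 2 * x ^ 2 - a * x + a ^ 2 / (2 * δ) := by
      field_simp
      ring
    linarith
  set C' := C ^ 2 / (2 * δ) * volume.real Ω + ‖g‖ ^ 2 / (2 * δ) with hC'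
  have hlow : ∀ u : H10 Ω, (m - 2 * δ) / 2 * ‖toL2 u‖ ^ 2 - C' ≤
      potential f (toL2 u) - ⟪g, toL2 u⟫_ℝ := fun u => by
    have h1 : (m - δ) / 2 * ‖toL2 u‖ ^ 2 - C ^ 2 / (2 * δ) * volume.real Ω ≤
        potential f (toL2 u) := by
      have hi := (Lp.memLp (toL2 u)).integrable_sq
      have e : (m - δ) / 2 * ‖toL2 u‖ ^ 2 - C ^ 2 / (2 * δ) * volume.real Ω =
          ∫ x in Ω, ((m - δ) / 2 * toL2 u x ^ 2 - C ^ 2 / (2 * δ)) := by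
        rw [integral_sub (hi.const_mul _) (integrable_const _), integral_const_mul,
          ← real_inner_self_eq_norm_sq, L2.inner_def]
        simp [sq, mul_comm]
      rw [e]
      refine integral_mono ((hi.const_mul _).sub (integrable_const _))
        (hf.integrable_primitive hb u) fun x => ?_
      have h2 := hF (toL2 u x)
      have h3 := hquad C |toL2 u x|
      rw [sq_abs] at h3
      dsimp only
      linarith
    have h2 := hquad ‖g‖ ‖toL2 u‖
    have h3 := real_inner_le_norm g (toL2 u)
    rw [hC']
    linarith
  have hC'0 : 0 ≤ C' := by positivity
  rcases le_or_gt 0 (m - 2 * δ) with hcase | hcase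
  · refine ⟨0, by simp, C', hC'0, fun u => ?_⟩
    have : 0 ≤ (m - 2 * δ) / 2 * ‖toL2 u‖ ^ 2 := by positivity
    linarith [hlow u]
  · have hlam0 : 0 < lam := by linarith
    refine ⟨-(m - 2 * δ) / lam, ⟨div_nonneg (by linarith) hlam0.le, ?_⟩, C', hC'0, fun u => ?_⟩
    · rw [div_lt_one hlam0]
      linarith
    · have h1 := firstEigenvalue_mul_le hΩ hb u
      have h2 : -(m - 2 * δ) / lam * (lam * ‖toL2 u‖ ^ 2) ≤ -(m - 2 * δ) / lam * normOne u ^ 2 :=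
        mul_le_mul_of_nonneg_left h1 (div_nonneg (by linarith) hlam0.le)
      have e : -(m - 2 * δ) / lam * (lam * ‖toL2 u‖ ^ 2) = -(m - 2 * δ) * ‖toL2 u‖ ^ 2 := by
        field_simp
      rw [e] at h2
      linarith [hlow u]

/-- Integration by parts against an exponential weight. -/
theorem integral_exp_mul {p w : ℝ → ℝ} {a b M : ℝ} (hab : a ≤ b)
    (hw : IntervalIntegrable w volume a b)
    (hp : ∀ t ∈ Icc a b, p t = p a + ∫ r in a..t, w r) :
    ∫ r in a..b, Real.exp (-M * (r - a)) * w r =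
      Real.exp (-M * (b - a)) * p b - p a + M * ∫ r in a..b, Real.exp (-M * (r - a)) * p r := by
  set P : ℝ → ℝ := fun t => p a + ∫ r in a..t, w r with hP
  have hPp : ∀ t ∈ Icc a b, p t = P t := hp
  have h1 : AbsolutelyContinuousOnInterval P a b := by
    have := hw.absolutelyContinuousOnInterval_intervalIntegral (c := a) left_mem_uIcc
    have h2 : AbsolutelyContinuousOnInterval (fun _ : ℝ => p a) a b :=
      ((LipschitzWith.const (p a)).lipschitzOnWith).absolutelyContinuousOnInterval
    exact h2.fun_add this
  have hd : ∀ r, HasDerivAt (fun r => Real.exp (-M * (r - a)))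
      (-M * Real.exp (-M * (r - a))) r := fun r => by
    have := (((hasDerivAt_id r).sub_const a).const_mul (-M)).exp
    simpa [mul_comm] using this
  have h2 : AbsolutelyContinuousOnInterval (fun r => Real.exp (-M * (r - a))) a b := by
    have hc : ContDiff ℝ 1 (fun r => Real.exp (-M * (r - a))) := by fun_prop
    exact hc.contDiffOn.absolutelyContinuousOnInterval
  have h3 := h2.integral_mul_deriv_eq_deriv_mul h1
  have h4 : ∫ r in a..b, Real.exp (-M * (r - a)) * deriv P r =
      ∫ r in a..b, Real.exp (-M * (r - a)) * w r := by
    refine intervalIntegral.integral_congr_ae ?_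
    filter_upwards [hw.ae_hasDerivAt_integral] with r hr hr'
    rw [((hr (uIoc_subset_uIcc hr') a left_mem_uIcc).const_add (p a)).deriv]
  have h5 : ∫ r in a..b, deriv (fun r => Real.exp (-M * (r - a))) r * P r =
      -M * ∫ r in a..b, Real.exp (-M * (r - a)) * p r := by
    rw [← intervalIntegral.integral_const_mul]
    refine intervalIntegral.integral_congr fun r hr => ?_
    rw [uIcc_of_le hab] at hr
    simp only [(hd r).deriv, hPp r hr]
    ring
  rw [← h4, h3, h5, ← hPp b (right_mem_Icc.2 hab), ← hPp a (left_mem_Icc.2 hab)]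
  simp

end

/-! ### The a priori bound -/

section

variable {μ : ℝ → ℝ → ℝ} {Ω : Set E3} {τ T V M₀ : ℝ}

theorem exists_norm_le_of_memLp_top {α E : Type*} [MeasurableSpace α] [NormedAddCommGroup E]
    {ν : Measure α} {f : α → E} (h : MemLp f ⊤ ν) : ∃ B ≥ 0, ∀ᵐ x ∂ν, ‖f x‖ ≤ B := by
  refine ⟨(eLpNorm f ⊤ ν).toReal, ENNReal.toReal_nonneg, ?_⟩
  filter_upwards [ae_le_eLpNormEssSup (f := f) (μ := ν)] with x hx
  rw [← toReal_enorm]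
  exact ENNReal.toReal_mono h.2.ne (by rwa [eLpNorm_exponent_top])

theorem IsMemoryKernel.integrable_sq_normOne (hμ : IsMemoryKernel μ) {t : ℝ} {η : ℝ → H10 Ω}
    (h : MemLp η 2 (memMeasure μ t)) :
    IntegrableOn (fun s => μ t s * normOne (η s) ^ 2) (Ioi 0) := by
  have h1 : Integrable (fun s => normOne (η s) ^ 2) (memMeasure μ t) :=
    (grad.comp_memLp' h).integrable_norm_pow (p := 2) (by norm_num)
  rw [memMeasure, integrable_withDensity_iff_integrable_smul₀' (hμ.aemeasurable_density t)
    (ae_of_all _ fun _ => ENNReal.ofReal_lt_top), ← IntegrableOn] at h1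
  refine h1.congr_fun (fun s hs => ?_) measurableSet_Ioi
  dsimp only
  rw [ENNReal.toReal_ofReal (hμ.pos t s hs).le, smul_eq_mul]

/-- The square of the norm of `𝓗_t`. -/
theorem IsMemoryKernel.sq_normH (hμ : IsMemoryKernel μ) (t : ℝ) (z : State Ω) :
    normH μ t z ^ 2 =
      normOne z.1 ^ 2 + ‖z.2.1‖ ^ 2 + ∫ s in Ioi (0 : ℝ), μ t s * normOne (z.2.2 s) ^ 2 := by
  refine Real.sq_sqrt (add_nonneg (by positivity) ?_)
  exact setIntegral_nonneg measurableSet_Ioi fun s hs =>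
    mul_nonneg (hμ.pos t s hs).le (sq_nonneg _)

namespace IsResolvent

variable {ε : ℝ} {J : Hneg Ω →L[ℝ] H10 Ω}

theorem pairEnergy_le (h : IsResolvent 1 ε J) (hε : 0 < ε) (hμ : IsMemoryKernel μ) {t : ℝ}
    {u : H10 Ω} {v : L2 Ω} {η : ℝ → H10 Ω} (hη : MemLp η 2 (memMeasure μ t)) :
    pairEnergy μ J (yosida 1 ε J) t u v η ≤ normH μ t (u, v, η) ^ 2 := by
  rw [hμ.sq_normH, pairEnergy, add_comm (normOne _ ^ 2)]
  refine add_le_add (add_le_add (h.apply_le hε v) (h.yosida_le hε u)) ?_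
  refine integral_mono_of_nonneg ?_ (hμ.integrable_sq_normOne hη) ?_
  · filter_upwards [ae_restrict_mem measurableSet_Ioi] with s hs
    exact mul_nonneg (hμ.pos t s hs).le ((h.isEnergyPair zero_le_one hε).P_nonneg _)
  · filter_upwards [ae_restrict_mem measurableSet_Ioi] with s hs
    exact mul_le_mul_of_nonneg_left (h.yosida_le hε _) (hμ.pos t s hs).le

theorem sq_normOne_le_pairEnergy (h : IsResolvent 1 ε J) (hε : 0 < ε) (hμ : IsMemoryKernel μ)
    (t : ℝ) (u : H10 Ω) (v : L2 Ω) (η : ℝ → H10 Ω) :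
    normOne (J (toHnegL (toL2 u))) ^ 2 ≤ pairEnergy μ J (yosida 1 ε J) t u v η := by
  have hJ := h.isEnergyPair zero_le_one hε
  have h1 := h.sq_normOne_le hε u
  have h2 := hJ.nonneg (toHnegL v)
  have h3 : 0 ≤ ∫ s in Ioi (0 : ℝ), μ t s * ⟪yosida 1 ε J (toL2 (η s)), toL2 (η s)⟫_ℝ :=
    setIntegral_nonneg measurableSet_Ioi fun s hs =>
      mul_nonneg (hμ.pos t s hs).le (hJ.P_nonneg _)
  rw [pairEnergy]
  linarith

end IsResolvent

namespace IsLinearSolution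

variable {y : ℝ → L2 Ω} {u : ℝ → H10 Ω} {v : ℝ → L2 Ω} {w : ℝ → Hneg Ω}
  {η : ℝ → ℝ → H10 Ω} {h : ℝ → L2 Ω}

/-- The energy inequality for the gradient norm, with the work done by the force `h`. -/
theorem sq_normOne_le (hs : IsLinearSolution μ τ T V y u v w η h) (hμ : IsMemoryKernel μ)
    (hM : HasGrowth μ τ T M₀) (hΩ : IsOpen Ω) (hb : Bornology.IsBounded Ω)
    (hη : MemLp (η τ) 2 (memMeasure μ τ)) {D : ℝ}
    (hh : ∀ᵐ r ∂volume.restrict (Icc τ T), ‖h r‖ ≤ D) {t : ℝ} (ht : t ∈ Icc τ T) :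
    Real.exp (-M₀ * (t - τ)) * normOne (u t) ^ 2 ≤ normH μ τ (u τ, v τ, η τ) ^ 2 +
      2 * ∫ r in Ioc τ t, Real.exp (-M₀ * (r - τ)) * ⟪h r, v r⟫_ℝ := by
  have hsub : Ioc τ t ⊆ Icc τ T := Ioc_subset_Icc_self.trans (Icc_subset_Icc_right ht.2)
  let ε : ℕ → ℝ := fun n => 1 / ((n : ℝ) + 1)
  have hε : ∀ n, 0 < ε n := fun n => Nat.one_div_pos_of_nat
  have hε0 : Tendsto ε atTop (𝓝 0) := tendsto_one_div_add_atTop_nhds_zero_nat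
  choose J hJ using fun n => exists_resolvent hb zero_le_one (hε n)
  set I : ℝ := ∫ r in Ioc τ t, Real.exp (-M₀ * (r - τ)) * ⟪h r, v r⟫_ℝ with hI
  set q := Real.exp (-M₀ * (t - τ)) with hq
  have hq0 : 0 < q := Real.exp_pos _
  have hen := fun n => hs.energy_le hμ hM ((hJ n).isEnergyPair zero_le_one (hε n)) ht
  have hlim : Tendsto (fun n => ∫ r in Ioc τ t, Real.exp (-M₀ * (r - τ)) *
      ⟪h r, toL2 (J n (toHnegL (v r)))⟫_ℝ) atTop (𝓝 I) := by
    refine tendsto_integral_of_dominated_convergence (fun _ => D * V) (fun n => (hen n).1.1)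
      (integrable_const _) (fun n => ?_) (ae_of_all _ fun r => ?_)
    · filter_upwards [ae_restrict_of_ae_restrict_of_subset hsub hh,
        ae_restrict_of_ae_restrict_of_subset hsub hs.curve.bdd, ae_restrict_mem measurableSet_Ioc]
        with r h1 h2 hr
      have h3 : Real.exp (-M₀ * (r - τ)) ≤ 1 := by
        refine Real.exp_le_one_iff.2 ?_
        nlinarith [hM.1, hr.1]
      have h4 : ‖⟪h r, toL2 (J n (toHnegL (v r)))⟫_ℝ‖ ≤ D * V :=
        (norm_inner_le_norm _ _).trans (mul_le_mul h1 (((hJ n).norm_le (hε n) _).trans h2)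
          (norm_nonneg _) ((norm_nonneg _).trans h1))
      rw [norm_mul, Real.norm_of_nonneg (Real.exp_pos _).le]
      exact (mul_le_of_le_one_left (norm_nonneg _) h3).trans h4
    · exact (tendsto_const_nhds.inner (tendsto_resolvent hΩ hε hε0 hJ (v r))).const_mul _
  refine le_of_forall_pos_le_add fun δ hδ => ?_
  have hev := hlim.eventually_lt_const (u := I + δ / 2) (by linarith)
  obtain ⟨N, hN⟩ := eventually_atTop.1 hev
  have h5 : normOne (u t) ^ 2 ≤ (normH μ τ (u τ, v τ, η τ) ^ 2 + 2 * (I + δ / 2)) / q := by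
    refine sq_normOne_le_of_tendsto hΩ (y := fun n => J (n + N) (toHnegL (toL2 (u t))))
      (fun n => ?_) ((tendsto_resolvent hΩ hε hε0 hJ _).comp (tendsto_add_atTop_nat N))
    rw [le_div_iff₀ hq0, mul_comm]
    have h6 := (hJ (n + N)).sq_normOne_le_pairEnergy (hε _) hμ t (u t) (v t) (η t)
    have h7 := (hJ (n + N)).pairEnergy_le (hε _) hμ (u := u τ) (v := v τ) hη
    have h8 := (hen (n + N)).2
    have h9 := hN (n + N) (by omega)
    have := mul_le_mul_of_nonneg_left h6 hq0.le
    linarith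
  rw [le_div_iff₀ hq0] at h5
  linarith

/-- The a priori bound for the solutions of the semilinear equation. -/
theorem exists_bound (hμ : IsMemoryKernel μ) (hM : HasGrowth μ τ T M₀) (hΩ : IsOpen Ω)
    (hb : Bornology.IsBounded Ω) {f : ℝ → ℝ} {c : ℝ} (hf : IsCubic f c)
    (hd : ((-firstEigenvalue Ω : ℝ) : EReal) <
      liminf (fun r : ℝ => ((f r / r : ℝ) : EReal)) (cocompact ℝ)) (g : L2 Ω) (R : ℝ) :
    ∃ B, ∀ {V : ℝ} {y : ℝ → L2 Ω} {u : ℝ → H10 Ω} {v : ℝ → L2 Ω} {w : ℝ → Hneg Ω}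
      {η : ℝ → ℝ → H10 Ω},
      IsLinearSolution μ τ T V y u v w η (fun t => g - superpos f (toL2 (u t))) →
      MemLp u ⊤ (volume.restrict (Icc τ T)) → MemLp (η τ) 2 (memMeasure μ τ) →
      normH μ τ (u τ, v τ, η τ) ≤ R → ∀ t ∈ Icc τ T, normOne (u t) ≤ B := by
  obtain ⟨θ, ⟨hθ0, hθ1⟩, C, hC, hco⟩ := hf.exists_coercive hΩ hb hd g
  obtain ⟨C₆, hC₆, hS⟩ := exists_integral_pow_six_le Ω
  obtain ⟨Cp, hCp, hP⟩ := exists_poincare hb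
  have hM0 := hM.1
  have hc := hf.nonneg
  have h1θ : 0 < 1 - θ := by linarith
  set p₀ : ℝ := 2 * c * (volume.real Ω + C₆ * R ^ 6) + ‖g‖ * (Cp * R) with hp₀
  set A : ℝ := (R ^ 2 + 2 * p₀ + 2 * C + 2 * C * M₀ * (T - τ)) / (1 - θ) with hA
  set K : ℝ := M₀ * θ / (1 - θ) with hK
  have hK0 : 0 ≤ K := by positivity
  refine ⟨√(Real.exp (M₀ * (T - τ)) * (A * Real.exp (K * (T - τ)))), ?_⟩
  intro V y u v w η hs hu hη hR t ht
  have hτ : τ ∈ Icc τ T := left_mem_Icc.2 hs.curve.le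
  have hR0 : 0 ≤ R := (Real.sqrt_nonneg _).trans hR
  have hgr : MemLp (fun t => grad (u t)) ⊤ (volume.restrict (Icc τ T)) := grad.comp_memLp' hu
  obtain ⟨Bu, hBu0, hBu⟩ := exists_norm_le_of_memLp_top hgr
  obtain ⟨D, hD0, hD⟩ := hf.exists_norm_superpos_le hb Bu
  obtain ⟨-, hwi, hpot⟩ := hs.curve.potential_eq hs.eq_toL2 hf hb hBu
  have hgi : IntervalIntegrable (fun r => ⟪g, v r⟫_ℝ) volume τ T := by
    have hvi := hs.curve.integrable
    rw [intervalIntegrable_iff] at hvi ⊢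
    exact (innerSL ℝ g).integrable_comp hvi
  set p : ℝ → ℝ := fun t => potential f (y t) - ⟪g, y t⟫_ℝ with hp
  set W : ℝ → ℝ := fun r => ⟪superpos f (y r), v r⟫_ℝ - ⟪g, v r⟫_ℝ with hW
  have hWi : IntervalIntegrable W volume τ T := hwi.sub hgi
  have hpW : ∀ t ∈ Icc τ T, p t = p τ + ∫ r in τ..t, W r := fun t ht => by
    have h1 : ⟪g, y t⟫_ℝ = ⟪g, y τ⟫_ℝ + ∫ r in τ..t, ⟪g, v r⟫_ℝ := by
      rw [hs.curve.eq_integral t ht, inner_add_right]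
      congr 1
      exact ((innerSL ℝ g).intervalIntegral_comp_comm
        (intervalIntegrable_sub hs.curve.integrable hτ ht)).symm
    rw [intervalIntegral.integral_sub (intervalIntegrable_sub hwi hτ ht)
      (intervalIntegrable_sub hgi hτ ht)]
    simp only [hp]
    rw [hpot t ht, h1]
    ring
  have hpc : ContinuousOn p (Icc τ T) := continuousOn_of_eq_integral hs.curve.le hWi hpW
  have hplow : ∀ t ∈ Icc τ T, -(θ / 2 * normOne (u t) ^ 2) - C ≤ p t := fun t ht => by
    simp only [hp, hs.eq_toL2 t ht]
    exact hco (u t)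
  have hN0 : normOne (u τ) ≤ R := by
    refine le_trans (Real.le_sqrt_of_sq_le ?_) hR
    have : 0 ≤ ∫ s in Ioi (0 : ℝ), μ τ s * normOne (η τ s) ^ 2 :=
      setIntegral_nonneg measurableSet_Ioi fun s hs =>
        mul_nonneg (hμ.pos τ s hs).le (sq_nonneg _)
    nlinarith [sq_nonneg ‖v τ‖]
  have hpτ : p τ ≤ p₀ := by
    simp only [hp, hs.eq_toL2 τ hτ, hp₀]
    have h0 := normOne_nonneg (u τ)
    have h1 := (abs_le.1 (hf.abs_potential_le hb (u τ))).2
    have h2 := (abs_le.1 (abs_real_inner_le_norm g (toL2 (u τ)))).1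
    have h3 : ∫ x in Ω, toL2 (u τ) x ^ 6 ≤ C₆ * R ^ 6 := (hS _).trans (by gcongr)
    have h4 : ‖toL2 (u τ)‖ ≤ Cp * R := (hP _).trans (by gcongr)
    have h5 : ‖g‖ * ‖toL2 (u τ)‖ ≤ ‖g‖ * (Cp * R) := by gcongr
    have h6 : 2 * c * (volume.real Ω + ∫ x in Ω, toL2 (u τ) x ^ 6) ≤
      2 * c * (volume.real Ω + C₆ * R ^ 6) := by gcongr
    linarith
  set q : ℝ → ℝ := fun r => Real.exp (-M₀ * (r - τ)) with hq
  have hqc : Continuous q := by fun_prop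
  have hq0 : ∀ r, 0 < q r := fun r => Real.exp_pos _
  have hq1 : ∀ r, τ ≤ r → q r ≤ 1 := fun r hr => by
    refine Real.exp_le_one_iff.2 ?_
    nlinarith
  set φ : ℝ → ℝ := fun r => q r * normOne (u r) ^ 2 with hφ
  have hφi : IntervalIntegrable φ volume τ T := by
    rw [intervalIntegrable_iff_integrableOn_Icc_of_le hs.curve.le]
    refine Integrable.mono' (integrable_const (Bu ^ 2))
      (hqc.aestronglyMeasurable.mul (hgr.1.norm.pow 2)) ?_
    filter_upwards [hBu, ae_restrict_mem measurableSet_Icc] with r hr hr'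
    rw [Real.norm_of_nonneg (by have := hq0 r; positivity)]
    have : normOne (u r) ^ 2 ≤ Bu ^ 2 := pow_le_pow_left₀ (normOne_nonneg _) hr 2
    exact (mul_le_of_le_one_left (sq_nonneg _) (hq1 r hr'.1)).trans this
  have hh : ∀ᵐ r ∂volume.restrict (Icc τ T), ‖g - superpos f (toL2 (u r))‖ ≤ ‖g‖ + D := by
    filter_upwards [hBu] with r hr
    exact (norm_sub_le _ _).trans (add_le_add le_rfl (hD _ hr).1)
  have hmain : ∀ t ∈ Icc τ T, φ t ≤ A + K * ∫ r in τ..t, φ r := fun t ht => by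
    have h1 := hs.sq_normOne_le hμ hM hΩ hb hη hh ht
    have h2 : ∫ r in Ioc τ t, q r * ⟪g - superpos f (toL2 (u r)), v r⟫_ℝ =
        -∫ r in τ..t, q r * W r := by
      rw [intervalIntegral.integral_of_le ht.1, ← integral_neg]
      refine setIntegral_congr_fun measurableSet_Ioc fun r hr => ?_
      simp only [hW, hs.eq_toL2 r ⟨hr.1.le, hr.2.trans ht.2⟩, inner_sub_left]
      ring
    have h3 := integral_exp_mul (M := M₀) ht.1 (intervalIntegrable_sub hWi hτ ht)
      fun r hr => hpW r ⟨hr.1, hr.2.trans ht.2⟩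
    have h4 : -∫ r in τ..t, q r * p r ≤ ∫ r in τ..t, (θ / 2 * φ r + C) := by
      rw [← intervalIntegral.integral_neg]
      refine intervalIntegral.integral_mono_on ht.1 ?_ ?_ fun r hr => ?_
      · refine (ContinuousOn.intervalIntegrable ?_).neg
        rw [uIcc_of_le ht.1]
        exact hqc.continuousOn.mul (hpc.mono (Icc_subset_Icc_right ht.2))
      · exact ((intervalIntegrable_sub hφi hτ ht).const_mul _).add intervalIntegrable_const
      · have h5 := mul_le_mul_of_nonneg_left (hplow r ⟨hr.1, hr.2.trans ht.2⟩) (hq0 r).le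
        have h6 := mul_le_of_le_one_left hC (hq1 r hr.1)
        simp only [hφ]
        linarith
    rw [intervalIntegral.integral_add ((intervalIntegrable_sub hφi hτ ht).const_mul _)
      intervalIntegrable_const, intervalIntegral.integral_const_mul,
      intervalIntegral.integral_const, smul_eq_mul] at h4
    have h5 := mul_le_mul_of_nonneg_left (hplow t ht) (hq0 t).le
    have h6 := mul_le_of_le_one_left hC (hq1 t ht.1)
    have h7 : normH μ τ (u τ, v τ, η τ) ^ 2 ≤ R ^ 2 :=
      pow_le_pow_left₀ (Real.sqrt_nonneg _) hR 2
    have h8 := mul_le_mul_of_nonneg_left h4 hM0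
    have h9 : M₀ * ((t - τ) * C) ≤ M₀ * ((T - τ) * C) := by
      have := ht.2
      gcongr
    change q t * normOne (u t) ^ 2 ≤ _ at h1
    change ∫ r in τ..t, q r * W r = q t * p t - p τ + M₀ * ∫ r in τ..t, q r * p r at h3
    rw [h2, h3] at h1
    have e : A + K * ∫ r in τ..t, φ r = (R ^ 2 + 2 * p₀ + 2 * C + 2 * C * M₀ * (T - τ) +
        M₀ * θ * ∫ r in τ..t, φ r) / (1 - θ) := by
      rw [hA, hK]
      ring
    rw [e, le_div_iff₀ h1θ]
    change φ t ≤ _ at h1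
    have e2 : q t * (-(θ / 2 * normOne (u t) ^ 2) - C) = -(θ / 2 * φ t) - q t * C := by
      simp only [hφ]
      ring
    rw [e2] at h5
    linarith
  have hgr2 := gronwall_integral hK0 hφi hmain t ht
  refine Real.le_sqrt_of_sq_le ?_
  have hA0 : 0 ≤ A := by
    have := hmain τ hτ
    rw [intervalIntegral.integral_same, mul_zero, add_zero] at this
    exact le_trans (mul_nonneg (hq0 τ).le (sq_nonneg _)) this
  have h1 : φ t ≤ A * Real.exp (K * (T - τ)) := hgr2.trans (by
    have := ht.2
    gcongr)
  have h2 : normOne (u t) ^ 2 = Real.exp (M₀ * (t - τ)) * φ t := by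
    simp only [hφ, hq]
    rw [← mul_assoc, ← Real.exp_add]
    simp
  rw [h2]
  have h3 : Real.exp (M₀ * (t - τ)) ≤ Real.exp (M₀ * (T - τ)) := by
    have := ht.2
    gcongr
  have h4 : 0 ≤ φ t := mul_nonneg (hq0 t).le (sq_nonneg _)
  exact mul_le_mul h3 h1 h4 (Real.exp_pos _).le

end IsLinearSolution

end

/-! ### Solutions -/

section

variable {μ : ℝ → ℝ → ℝ} {Ω : Set E3} {τ T : ℝ} {f : ℝ → ℝ} {c : ℝ} {g : L2 Ω} {a : State Ω}
  {z : ℝ → State Ω}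

/-- The curve in `L²(Ω)` formed by a function on `[τ, T]` and by its past before `τ`. -/
def fullCurve (τ T : ℝ) (a : State Ω) (u : ℝ → H10 Ω) (r : ℝ) : L2 Ω :=
  if r < τ then toL2 a.1 - toL2 (a.2.2 (τ - r)) else toL2 (u (min r T))

theorem fullCurve_of_lt (a : State Ω) (u : ℝ → H10 Ω) {r : ℝ} (hr : r < τ) :
    fullCurve τ T a u r = toL2 a.1 - toL2 (a.2.2 (τ - r)) := if_pos hr

theorem fullCurve_of_mem (a : State Ω) (u : ℝ → H10 Ω) {r : ℝ} (hr : r ∈ Icc τ T) :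
    fullCurve τ T a u r = toL2 (u r) := by
  rw [fullCurve, if_neg (not_lt.2 hr.1), min_eq_left hr.2]

theorem toL2_history (a : State Ω) (u : ℝ → H10 Ω) {t s : ℝ} (ht : t ∈ Icc τ T) (hs : 0 < s) :
    toL2 (history τ a u t s) = fullCurve τ T a u t - fullCurve τ T a u (t - s) := by
  rw [fullCurve_of_mem a u ht, history]
  split_ifs with h
  · rw [fullCurve_of_mem a u ⟨by linarith, by linarith [ht.2]⟩, map_sub]
  · rw [fullCurve_of_lt a u (by linarith), show τ - (t - s) = s - t + τ by ring, map_sub, map_add]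
    abel

theorem aestronglyMeasurable_fullCurve (hμ : IsMemoryKernel μ) (hτT : τ < T) (ha : MemH μ τ a)
    {u : ℝ → H10 Ω} (hu : ContinuousOn (fun t => toL2 (u t)) (Icc τ T)) :
    AEStronglyMeasurable (fullCurve τ T a u) volume := by
  have h1 : AEStronglyMeasurable ((Ioi (0 : ℝ)).indicator fun s => toL2 (a.2.2 s)) volume := by
    rw [aestronglyMeasurable_indicator_iff measurableSet_Ioi]
    exact (toL2.continuous.comp_aestronglyMeasurable ha.1).mono_ac
      (hμ.absolutelyContinuous_memMeasure τ)
  have h2 : AEStronglyMeasurable (fun r => toL2 a.1 -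
      (Ioi (0 : ℝ)).indicator (fun s => toL2 (a.2.2 s)) (τ - r)) volume :=
    aestronglyMeasurable_const.sub
      (h1.comp_quasiMeasurePreserving (quasiMeasurePreserving_sub_left volume τ))
  have h3 : AEStronglyMeasurable (fun r => toL2 (u (min r T))) (volume.restrict (Iio τ)ᶜ) := by
    rw [compl_Iio]
    refine ContinuousOn.aestronglyMeasurable ?_ measurableSet_Ici
    exact hu.comp (f := fun r => min r T) (by fun_prop)
      fun r hr => ⟨le_min hr hτT.le, min_le_right _ _⟩
  refine (AEStronglyMeasurable.piecewise (s := Iio τ) measurableSet_Iio h2.restrict h3).congr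
    (ae_of_all _ fun r => ?_)
  by_cases hr : r < τ
  · rw [piecewise_eq_of_mem _ _ _ (mem_Iio.2 hr), fullCurve_of_lt a u hr,
      indicator_of_mem (mem_Ioi.2 (sub_pos.2 hr))]
  · rw [piecewise_eq_of_notMem _ _ _ (by simpa using hr), fullCurve, if_neg hr]

namespace IsSolution

theorem eta_init (hz : IsSolution μ f g τ T a z) (hτT : τ < T) :
    ∀ᵐ s ∂volume.restrict (Ioi (0 : ℝ)), (z τ).2.2 s = a.2.2 s := by
  filter_upwards [hz.eta_repr τ (left_mem_Icc.2 hτT.le), ae_restrict_mem measurableSet_Ioi]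
    with s h1 hs
  rw [h1, history, if_neg (by simpa using hs), hz.u_init]
  simp

theorem memH_init (hz : IsSolution μ f g τ T a z) (hτT : τ < T) (ha : MemH μ τ a) :
    MemH μ τ (z τ) :=
  ha.ae_eq ((memMeasure_absolutelyContinuous τ).ae_le ((hz.eta_init hτT).mono fun _ h => h.symm))

theorem normH_init (hz : IsSolution μ f g τ T a z) (hτT : τ < T) :
    normH μ τ (z τ) = normH μ τ a := by
  have h : ∫ s in Ioi (0 : ℝ), μ τ s * normOne ((z τ).2.2 s) ^ 2 =
      ∫ s in Ioi (0 : ℝ), μ τ s * normOne (a.2.2 s) ^ 2 := by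
    refine integral_congr_ae ?_
    filter_upwards [hz.eta_init hτT] with s hs
    rw [hs]
  rw [normH, normH, hz.u_init, hz.v_init, h]

/-- A solution solves the linear equation with the force `g - f(u)`. -/
theorem exists_isLinearSolution (hz : IsSolution μ f g τ T a z) (hμ : IsMemoryKernel μ)
    (hτT : τ < T) (hb : Bornology.IsBounded Ω) (hf : IsCubic f c) (ha : MemH μ τ a) :
    ∃ V w, IsLinearSolution μ τ T V (fullCurve τ T a fun t => (z t).1) (fun t => (z t).1)
      (fun t => (z t).2.1) w (fun t => (z t).2.2) (fun t => g - superpos f (toL2 (z t).1)) := by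
  obtain ⟨V, hV0, hV⟩ := exists_norm_le_of_memLp_top hz.v_bdd
  obtain ⟨w, -, hw2, hw3⟩ := hz.equation
  obtain ⟨hv1, hv2⟩ := HasWeakTimeDeriv.eq_integral hτT hz.u_deriv hz.u_cont
  obtain ⟨hw4, hw5⟩ := HasWeakTimeDeriv.eq_integral hτT hw2 hz.v_cont
  have hτ : τ ∈ Icc τ T := left_mem_Icc.2 hτT.le
  refine ⟨V, w, ⟨⟨hτT.le, aestronglyMeasurable_fullCurve hμ hτT ha hz.u_cont, hv1, hV, hV0,
    fun t ht => ?_, ?_⟩, fun t ht => fullCurve_of_mem _ _ ht, fun t ht => ?_, hw4, hw5, hz.memH,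
        ?_⟩⟩
  · rw [fullCurve_of_mem _ _ ht, fullCurve_of_mem _ _ hτ]
    exact hv2 t ht
  · have h1 : MemLp (fun s => toL2 (a.2.2 s)) 2 (memMeasure μ τ) := toL2.comp_memLp' ha
    refine h1.ae_eq ((memMeasure_absolutelyContinuous τ).ae_le ?_)
    filter_upwards [ae_restrict_mem measurableSet_Ioi] with s hs
    rw [fullCurve_of_mem _ _ hτ, fullCurve_of_lt _ _ (by linarith [mem_Ioi.1 hs]), hz.u_init]
    simp
  · filter_upwards [hz.eta_repr t ht, ae_restrict_mem measurableSet_Ioi] with s h1 hs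
    rw [h1, toL2_history _ _ ht hs]
  · have := separableSpace_H10 Ω
    have h1 : ∀ᵐ t ∂volume.restrict (Icc τ T), ∀ n : ℕ, _ :=
      ae_all_iff.2 fun n => hw3 (TopologicalSpace.denseSeq (H10 Ω) n)
    filter_upwards [h1, hz.memH] with t h2 h3
    have h4 : ∀ φ : H10 Ω, ⟪g - superpos f (toL2 (z t).1), toL2 φ⟫_ℝ =
        ⟪g, toL2 φ⟫_ℝ - ∫ x in Ω, f (toL2 (z t).1 x) * toL2 φ x := fun φ => by
      rw [inner_sub_left, inner_superpos (hf.memLp hb _)]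
    refine congrFun (Continuous.ext_on (TopologicalSpace.denseRange_denseSeq (H10 Ω)) ?_ ?_ ?_)
    · refine Continuous.add (by unfold innerOne; fun_prop) (hμ.continuous_integral_innerOne h3)
    · fun_prop
    · rintro φ ⟨n, rfl⟩
      dsimp only
      rw [h4, ← h2 n]
      ring

end IsSolution

end

/-! ### Continuous dependence and uniqueness -/

section

variable {μ : ℝ → ℝ → ℝ} {Ω : Set E3} {τ T V M₀ : ℝ}

namespace IsResolvent

variable {J : Hneg Ω →L[ℝ] H10 Ω}

theorem apply_self_eq_sq (h : IsResolvent 0 1 J) (l : Hneg Ω) : l (J l) = normOne (J l) ^ 2 := by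
  simpa using h.apply_self l

theorem normNegOne_le (h : IsResolvent 0 1 J) (l : Hneg Ω) : normNegOne l ≤ normOne (J l) := by
  refine Real.sSup_le ?_ (normOne_nonneg _)
  rintro r ⟨φ, hφ, rfl⟩
  have h1 := h l φ
  rw [zero_mul, one_mul, zero_add] at h1
  rw [← h1]
  exact (abs_real_inner_le_norm _ _).trans (mul_le_of_le_one_right (norm_nonneg _) hφ)

theorem sq_normHneg_le (h : IsResolvent 0 1 J) (hμ : IsMemoryKernel μ) (t : ℝ) (z : State Ω) :
    normHneg μ t z ^ 2 ≤ pairEnergy μ J (yosida 0 1 J) t z.1 z.2.1 z.2.2 := by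
  have h1 : 0 ≤ ∫ s in Ioi (0 : ℝ), μ t s * ‖toL2 (z.2.2 s)‖ ^ 2 :=
    setIntegral_nonneg measurableSet_Ioi fun s hs => mul_nonneg (hμ.pos t s hs).le (sq_nonneg _)
  rw [normHneg, Real.sq_sqrt (add_nonneg (by positivity) h1), pairEnergy, yosida_zero_one,
    h.apply_self_eq_sq]
  simp only [ContinuousLinearMap.id_apply, real_inner_self_eq_norm_sq]
  have h2 : 0 ≤ normNegOne (toHneg z.2.1) := Real.sSup_nonneg (by
    rintro r ⟨φ, -, rfl⟩; exact abs_nonneg _)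
  have h3 : normNegOne (toHneg z.2.1) ^ 2 ≤ normOne (J (toHnegL z.2.1)) ^ 2 :=
    pow_le_pow_left₀ h2 (h.normNegOne_le _) 2
  linarith

theorem exists_pairEnergy_zero_one_le (hb : Bornology.IsBounded Ω) (hμ : IsMemoryKernel μ) :
    ∃ C > 0, ∀ {J : Hneg Ω →L[ℝ] H10 Ω}, IsResolvent 0 1 J → ∀ (t : ℝ) (z : State Ω), MemH μ t z →
      pairEnergy μ J (yosida 0 1 J) t z.1 z.2.1 z.2.2 ≤ C * normH μ t z ^ 2 := by
  obtain ⟨C, hC, hP⟩ := exists_poincare hb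
  refine ⟨C ^ 2, by positivity, fun {J} h t z hz => ?_⟩
  have hP2 : ∀ u : H10 Ω, ‖toL2 u‖ ^ 2 ≤ C ^ 2 * normOne u ^ 2 := fun u => by
    rw [← mul_pow]
    exact pow_le_pow_left₀ (norm_nonneg _) (hP u) 2
  rw [hμ.sq_normH, pairEnergy, yosida_zero_one]
  simp only [ContinuousLinearMap.id_apply, real_inner_self_eq_norm_sq]
  have h1 : toHnegL z.2.1 (J (toHnegL z.2.1)) ≤ C ^ 2 * ‖z.2.1‖ ^ 2 := by
    have h2 := h.apply_self_eq_sq (toHnegL z.2.1)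
    have h3 := real_inner_le_norm z.2.1 (toL2 (J (toHnegL z.2.1)))
    have h4 := hP (J (toHnegL z.2.1))
    rw [toHnegL_apply] at h2 ⊢
    set n := normOne (J (toHnegL z.2.1))
    have h5 : 0 ≤ n := normOne_nonneg _
    have h6 : n ^ 2 ≤ ‖z.2.1‖ * (C * n) := by
      rw [← h2]
      exact h3.trans (by gcongr)
    have h7 : n ≤ C * ‖z.2.1‖ := by
      by_contra! h8
      have : 0 ≤ C * ‖z.2.1‖ := by positivity
      nlinarith
    rw [h2, ← mul_pow]
    gcongr
  have h2 : ∫ s in Ioi (0 : ℝ), μ t s * ‖toL2 (z.2.2 s)‖ ^ 2 ≤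
      C ^ 2 * ∫ s in Ioi (0 : ℝ), μ t s * normOne (z.2.2 s) ^ 2 := by
    rw [← integral_const_mul]
    refine integral_mono_of_nonneg ?_ ((hμ.integrable_sq_normOne hz).const_mul _) ?_
    · filter_upwards [ae_restrict_mem measurableSet_Ioi] with s hs
      exact mul_nonneg (hμ.pos t s hs).le (sq_nonneg _)
    · filter_upwards [ae_restrict_mem measurableSet_Ioi] with s hs
      have := mul_le_mul_of_nonneg_left (hP2 (z.2.2 s)) (hμ.pos t s hs).le
      linarith
  linarith [hP2 z.1]

end IsResolvent

namespace IsLinearSolution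

variable {y : ℝ → L2 Ω} {u : ℝ → H10 Ω} {v : ℝ → L2 Ω} {w : ℝ → Hneg Ω}
  {η : ℝ → ℝ → H10 Ω} {h : ℝ → L2 Ω} {J : Hneg Ω →L[ℝ] H10 Ω}

/-- The stability estimate in the weak energy norm. -/
theorem pairEnergy_le (hs : IsLinearSolution μ τ T V y u v w η h) (hμ : IsMemoryKernel μ)
    (hM : HasGrowth μ τ T M₀) (hJ : IsResolvent 0 1 J) {B : ℝ} (hB : 0 ≤ B)
    (hh : ∀ t ∈ Icc τ T, ∀ φ : H10 Ω, |⟪h t, toL2 φ⟫_ℝ| ≤ B * ‖toL2 (u t)‖ * normOne φ)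
    {t : ℝ} (ht : t ∈ Icc τ T) :
    pairEnergy μ J (IsResolvent.yosida 0 1 J) t (u t) (v t) (η t) ≤
      Real.exp (M₀ * (T - τ)) * (1 + B * (T - τ) * Real.exp (B * (T - τ))) *
        pairEnergy μ J (IsResolvent.yosida 0 1 J) τ (u τ) (v τ) (η τ) := by
  have hτ : τ ∈ Icc τ T := left_mem_Icc.2 hs.curve.le
  have hJP := hJ.isEnergyPair le_rfl one_pos
  set N : ℝ → ℝ := fun t => pairEnergy μ J (IsResolvent.yosida 0 1 J) t (u t) (v t) (η t) with hN
  set q : ℝ → ℝ := fun r => Real.exp (-M₀ * (r - τ)) with hq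
  have hqc : Continuous q := by fun_prop
  have hq0 : ∀ r, 0 < q r := fun r => Real.exp_pos _
  set E : ℝ → ℝ := fun r => toHnegL (v r) (J (toHnegL (v r))) + ⟪y r, y r⟫_ℝ with hE
  have hE0 : ∀ r, 0 ≤ E r := fun r => add_nonneg (hJP.nonneg _) real_inner_self_nonneg
  have hEN : ∀ r ∈ Icc τ T, E r ≤ N r := fun r hr => by
    have h1 : 0 ≤ ∫ s in Ioi (0 : ℝ), μ r s * ⟪IsResolvent.yosida 0 1 J (toL2 (η r s)), toL2
        (η r s)⟫_ℝ :=
      setIntegral_nonneg measurableSet_Ioi fun s hs => mul_nonneg (hμ.pos r s hs).le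
          (hJP.P_nonneg _)
    simp only [hN, hE, pairEnergy]
    rw [hs.eq_toL2 r hr]
    simp only [IsResolvent.yosida_zero_one, ContinuousLinearMap.id_apply] at h1 ⊢
    linarith
  have hEc : ContinuousOn E (Icc τ T) := by
    have h1 : ContinuousOn (fun r => toHnegL (v r)) (Icc τ T) :=
      continuousOn_of_eq_integral hs.curve.le hs.integrable hs.eq_integral
    exact (h1.clm_apply (J.continuous.comp_continuousOn h1)).add
      (hs.curve.continuousOn.inner hs.curve.continuousOn)
  have hφc : ContinuousOn (fun r => q r * E r) (Icc τ T) := hqc.continuousOn.mul hEc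
  have hφi : IntervalIntegrable (fun r => q r * E r) volume τ T :=
    ContinuousOn.intervalIntegrable (by rwa [uIcc_of_le hs.curve.le])
  have hwork : ∀ r ∈ Icc τ T, 2 * ⟪h r, toL2 (J (toHnegL (v r)))⟫_ℝ ≤ B * E r := fun r hr => by
    have h1 := (abs_le.1 (hh r hr (J (toHnegL (v r))))).2
    simp only [hE]
    rw [hJ.apply_self_eq_sq, hs.eq_toL2 r hr, real_inner_self_eq_norm_sq]
    nlinarith [mul_nonneg hB (sq_nonneg (‖toL2 (u r)‖ - normOne (J (toHnegL (v r)))))]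
  have hmain : ∀ t ∈ Icc τ T, q t * N t ≤ N τ + B * ∫ r in τ..t, q r * E r := fun t ht => by
    have h1 := hs.energy_le hμ hM hJP ht
    refine h1.2.trans (add_le_add le_rfl ?_)
    rw [intervalIntegral.integral_of_le ht.1, ← integral_const_mul, ← integral_const_mul]
    refine setIntegral_mono_on (h1.1.const_mul 2)
      ((intervalIntegrable_iff_integrableOn_Ioc_of_le ht.1).1
        ((intervalIntegrable_sub hφi hτ ht).const_mul B)) measurableSet_Ioc fun r hr => ?_
    have h2 := mul_le_mul_of_nonneg_left (hwork r ⟨hr.1.le, hr.2.trans ht.2⟩) (hq0 r).le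
    simp only [hq] at h2 ⊢
    linarith
  have hN0 : 0 ≤ N τ := (hE0 τ).trans (hEN τ hτ)
  have hgr := gronwall_integral hB hφi (A := N τ) fun t ht =>
    (mul_le_mul_of_nonneg_left (hEN t ht) (hq0 t).le).trans (hmain t ht)
  have hTτ : 0 ≤ T - τ := sub_nonneg.2 hs.curve.le
  have hint : ∫ r in τ..t, q r * E r ≤ (T - τ) * (N τ * Real.exp (B * (T - τ))) := by
    have h1 : ∫ r in τ..t, q r * E r ≤ ∫ _r in τ..t, N τ * Real.exp (B * (T - τ)) := by
      refine intervalIntegral.integral_mono_on ht.1 (intervalIntegrable_sub hφi hτ ht)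
        intervalIntegrable_const fun r hr => ?_
      have hr2 : r ≤ T := hr.2.trans ht.2
      exact (hgr r ⟨hr.1, hr2⟩).trans (by gcongr)
    rw [intervalIntegral.integral_const, smul_eq_mul] at h1
    refine h1.trans ?_
    have := ht.2
    gcongr
  have h1 := hmain t ht
  have h2 : q t * N t ≤ (1 + B * (T - τ) * Real.exp (B * (T - τ))) * N τ := by
    have := mul_le_mul_of_nonneg_left hint hB
    linarith
  have h3 : N t = Real.exp (M₀ * (t - τ)) * (q t * N t) := by
    simp only [hq]
    rw [← mul_assoc, ← Real.exp_add]
    simp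
  change N t ≤ _
  rw [h3, mul_assoc]
  have h4 : Real.exp (M₀ * (t - τ)) ≤ Real.exp (M₀ * (T - τ)) := by
    have := ht.2
    have := hM.1
    gcongr
  have h5 : 0 ≤ q t * N t := mul_nonneg (hq0 t).le ((hE0 t).trans (hEN t ht))
  exact mul_le_mul h4 h2 h5 (Real.exp_pos _).le

end IsLinearSolution

/-- Continuous dependence of the solutions on the initial data. -/
theorem exists_normHneg_sub_le (hΩ : IsOpen Ω) (hb : Bornology.IsBounded Ω)
    (hμ : IsMemoryKernel μ) (g : L2 Ω) {f : ℝ → ℝ} {c : ℝ} (hf : IsCubic f c)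
    (hd : ((-firstEigenvalue Ω : ℝ) : EReal) <
      liminf (fun r : ℝ => ((f r / r : ℝ) : EReal)) (cocompact ℝ)) (hτT : τ < T) (R : ℝ) :
    ∃ C > 0, ∀ (a₁ a₂ : State Ω) (z₁ z₂ : ℝ → State Ω),
      MemH μ τ a₁ → MemH μ τ a₂ → normH μ τ a₁ ≤ R → normH μ τ a₂ ≤ R →
      IsSolution μ f g τ T a₁ z₁ → IsSolution μ f g τ T a₂ z₂ → ∀ t ∈ Icc τ T,
        MemHneg μ t (z₁ t - z₂ t) ∧
        normHneg μ t (z₁ t - z₂ t) ≤ C * normH μ τ (z₁ τ - z₂ τ) := by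
  obtain ⟨M₀, hM0, hM⟩ := hμ.exists_growth τ T
  have hM : HasGrowth μ τ T M₀ := ⟨hM0, hM⟩
  obtain ⟨B, hB⟩ := IsLinearSolution.exists_bound hμ hM hΩ hb hf hd g R
  obtain ⟨C₁, hC₁, hlip⟩ := hf.exists_inner_superpos_sub_le hb
  obtain ⟨J, hJ⟩ := exists_resolvent hb le_rfl (zero_lt_one' ℝ)
  obtain ⟨C₂, hC₂, hinit⟩ := IsResolvent.exists_pairEnergy_zero_one_le hb hμ
  set L : ℝ := C₁ * (1 + B ^ 2 + B ^ 2) with hL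
  have hL0 : 0 ≤ L := by positivity
  have hTτ : 0 < T - τ := sub_pos.2 hτT
  set Q : ℝ := Real.exp (M₀ * (T - τ)) * (1 + L * (T - τ) * Real.exp (L * (T - τ))) with hQ
  have hQ0 : 0 < Q := by positivity
  refine ⟨√(Q * C₂), Real.sqrt_pos.2 (by positivity), ?_⟩
  intro a₁ a₂ z₁ z₂ ha₁ ha₂ hR₁ hR₂ hz₁ hz₂ t ht
  have hτ : τ ∈ Icc τ T := left_mem_Icc.2 hτT.le
  obtain ⟨V₁, w₁, hs₁⟩ := hz₁.exists_isLinearSolution hμ hτT hb hf ha₁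
  obtain ⟨V₂, w₂, hs₂⟩ := hz₂.exists_isLinearSolution hμ hτT hb hf ha₂
  have hB₁ := hB hs₁ hz₁.u_bdd (hz₁.memH_init hτT ha₁) ((hz₁.normH_init hτT).trans_le hR₁)
  have hB₂ := hB hs₂ hz₂.u_bdd (hz₂.memH_init hτT ha₂) ((hz₂.normH_init hτT).trans_le hR₂)
  have hs := hs₁.sub hμ hs₂
  refine ⟨?_, ?_⟩
  · refine (hs.curve.memLp hμ hM ht).ae_eq ((memMeasure_absolutelyContinuous t).ae_le ?_)
    filter_upwards [hs.eta t ht] with s h1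
    exact h1.symm
  have hkey := hs.pairEnergy_le hμ hM hJ hL0 (fun r hr φ => ?_) ht
  · have h1 := hJ.sq_normHneg_le hμ t (z₁ t - z₂ t)
    have h2 := hinit hJ τ (z₁ τ - z₂ τ)
      ((hz₁.memH_init hτT ha₁).sub (hz₂.memH_init hτT ha₂))
    refine le_of_sq_le_sq ?_ (mul_nonneg (Real.sqrt_nonneg _) (Real.sqrt_nonneg _))
    rw [mul_pow, Real.sq_sqrt (by positivity)]
    refine h1.trans (le_trans hkey ?_)
    rw [mul_assoc Q]
    exact mul_le_mul_of_nonneg_left h2 hQ0.le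
  · have h1 := hlip (z₁ r).1 (z₂ r).1 φ
    rw [show g - superpos f (toL2 (z₁ r).1) - (g - superpos f (toL2 (z₂ r).1)) =
      -(superpos f (toL2 (z₁ r).1) - superpos f (toL2 (z₂ r).1)) by abel, inner_neg_left, abs_neg,
      map_sub]
    refine h1.trans ?_
    have e1 := hB₁ r hr
    have e2 := hB₂ r hr
    have n1 := normOne_nonneg (z₁ r).1
    have n2 := normOne_nonneg (z₂ r).1
    have n3 := normOne_nonneg φ
    rw [hL]
    gcongr

theorem normHneg_eq_zero (hΩ : IsOpen Ω) (hb : Bornology.IsBounded Ω) (hμ : IsMemoryKernel μ)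
    {t : ℝ} {z : State Ω} (h : normHneg μ t z ≤ 0) : z.1 = 0 ∧ z.2.1 = 0 := by
  have h1 : 0 ≤ ∫ s in Ioi (0 : ℝ), μ t s * ‖toL2 (z.2.2 s)‖ ^ 2 :=
    setIntegral_nonneg measurableSet_Ioi fun s hs => mul_nonneg (hμ.pos t s hs).le (sq_nonneg _)
  have h2 := Real.sqrt_eq_zero'.1 (le_antisymm h (Real.sqrt_nonneg _))
  have h3 : ‖toL2 z.1‖ ^ 2 = 0 := by
    nlinarith [sq_nonneg ‖toL2 z.1‖, sq_nonneg (normNegOne (toHneg z.2.1))]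
  have h4 : normNegOne (toHneg z.2.1) ^ 2 = 0 := by
    nlinarith [sq_nonneg ‖toL2 z.1‖, sq_nonneg (normNegOne (toHneg z.2.1))]
  refine ⟨toL2_injective hΩ (by simpa using h3), eq_zero_of_toHneg_eq_zero hΩ fun φ => ?_⟩
  obtain ⟨C, hC, hP⟩ := exists_poincare hb
  have hbd : BddAbove {r | ∃ φ : H10 Ω, normOne φ ≤ 1 ∧ r = |toHneg z.2.1 φ|} := by
    refine ⟨‖z.2.1‖ * (C * 1), ?_⟩
    rintro r ⟨φ, hφ, rfl⟩
    rw [toHneg_apply]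
    refine (abs_real_inner_le_norm _ _).trans ?_
    gcongr
    exact (hP φ).trans (by gcongr)
  set k : ℝ := (normOne φ + 1)⁻¹ with hk
  have hk0 : 0 < k := inv_pos.2 (by linarith [normOne_nonneg φ])
  have h5 : |toHneg z.2.1 (k • φ)| ≤ normNegOne (toHneg z.2.1) := by
    refine le_csSup hbd ⟨k • φ, ?_, rfl⟩
    rw [normOne_smul, abs_of_pos hk0, hk, inv_mul_le_one₀ (by linarith [normOne_nonneg φ])]
    linarith
  rw [pow_eq_zero_iff two_ne_zero] at h4
  rw [h4, map_smul, smul_eq_mul] at h5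
  have h6 := abs_eq_zero.1 (le_antisymm h5 (abs_nonneg _))
  exact (mul_eq_zero.1 h6).resolve_left hk0.ne'

/-- Two solutions with the same initial datum coincide. -/
theorem IsSolution.unique (hΩ : IsOpen Ω) (hb : Bornology.IsBounded Ω)
    (hμ : IsMemoryKernel μ) {g : L2 Ω} {f : ℝ → ℝ} {c : ℝ} (hf : IsCubic f c)
    (hd : ((-firstEigenvalue Ω : ℝ) : EReal) <
      liminf (fun r : ℝ => ((f r / r : ℝ) : EReal)) (cocompact ℝ)) (hτT : τ < T)
    {a : State Ω} {z₁ z₂ : ℝ → State Ω} (ha : MemH μ τ a)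
    (hz₁ : IsSolution μ f g τ T a z₁) (hz₂ : IsSolution μ f g τ T a z₂) :
    ∀ t ∈ Icc τ T, (z₁ t).1 = (z₂ t).1 ∧ (z₁ t).2.1 = (z₂ t).2.1 ∧
      (z₁ t).2.2 =ᵐ[volume.restrict (Ioi 0)] (z₂ t).2.2 := by
  obtain ⟨C, hC, h⟩ := exists_normHneg_sub_le hΩ hb hμ g hf hd hτT (normH μ τ a)
  have h0 : normH μ τ (z₁ τ - z₂ τ) = 0 := by
    have h1 : ∫ s in Ioi (0 : ℝ), μ τ s * normOne ((z₁ τ - z₂ τ).2.2 s) ^ 2 = 0 := by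
      refine integral_eq_zero_of_ae ?_
      filter_upwards [hz₁.eta_init hτT, hz₂.eta_init hτT] with s e1 e2
      simp [e1, e2, normOne]
    rw [normH, h1]
    simp [hz₁.u_init, hz₂.u_init, hz₁.v_init, hz₂.v_init, normOne]
  have key : ∀ t ∈ Icc τ T, (z₁ t).1 = (z₂ t).1 ∧ (z₁ t).2.1 = (z₂ t).2.1 := fun t ht => by
    have h1 := (h a a z₁ z₂ ha ha le_rfl le_rfl hz₁ hz₂ t ht).2
    rw [h0, mul_zero] at h1
    obtain ⟨h2, h3⟩ := normHneg_eq_zero hΩ hb hμ h1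
    exact ⟨sub_eq_zero.1 h2, sub_eq_zero.1 h3⟩
  refine fun t ht => ⟨(key t ht).1, (key t ht).2, ?_⟩
  filter_upwards [hz₁.eta_repr t ht, hz₂.eta_repr t ht, ae_restrict_mem measurableSet_Ioi]
    with s e1 e2 hs
  rw [e1, e2, history, history, (key t ht).1]
  split_ifs with hst
  · rw [(key (t - s) ⟨by linarith, by linarith [ht.2, mem_Ioi.1 hs]⟩).1]
  · rfl

end

end AgingMemory

end

theorem proposition7p1
    (Ω : Set AgingMemory.E3) (hΩo : IsOpen Ω) (hΩc : IsConnected Ω)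
    (hΩb : Bornology.IsBounded Ω) (hΩs : AgingMemory.HasSmoothBoundary Ω)
    (μ : ℝ → ℝ → ℝ) (hμ : AgingMemory.IsMemoryKernel μ)
    (g : AgingMemory.L2 Ω)
    (f : ℝ → ℝ) (hf : ContDiff ℝ 1 f) (hf0 : f 0 = 0)
    (hf_growth : ∃ c ≥ 0, ∀ r : ℝ, |deriv f r| ≤ c * (1 + |r| ^ 2))
    (hf_diss : ((-AgingMemory.firstEigenvalue Ω : ℝ) : EReal) <
      liminf (fun r : ℝ => ((f r / r : ℝ) : EReal)) (cocompact ℝ))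
    (τ T : ℝ) (hτT : τ < T) :
    (∀ R : ℝ, ∃ C > 0, ∀ (a₁ a₂ : AgingMemory.State Ω) (z₁ z₂ : ℝ → AgingMemory.State Ω),
      AgingMemory.MemH μ τ a₁ → AgingMemory.MemH μ τ a₂ →
      AgingMemory.normH μ τ a₁ ≤ R → AgingMemory.normH μ τ a₂ ≤ R →
      AgingMemory.IsSolution μ f g τ T a₁ z₁ → AgingMemory.IsSolution μ f g τ T a₂ z₂ →
      ∀ t ∈ Icc τ T,
        AgingMemory.MemHneg μ t (z₁ t - z₂ t) ∧
        AgingMemory.normHneg μ t (z₁ t - z₂ t) ≤ C * AgingMemory.normH μ τ (z₁ τ - z₂ τ)) ∧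
    (∀ (a : AgingMemory.State Ω) (z₁ z₂ : ℝ → AgingMemory.State Ω),
      AgingMemory.MemH μ τ a →
      AgingMemory.IsSolution μ f g τ T a z₁ → AgingMemory.IsSolution μ f g τ T a z₂ →
      ∀ t ∈ Icc τ T,
        (z₁ t).1 = (z₂ t).1 ∧ (z₁ t).2.1 = (z₂ t).2.1 ∧
        (z₁ t).2.2 =ᵐ[volume.restrict (Ioi 0)] (z₂ t).2.2) := by
  obtain ⟨c, hc, hgr⟩ := hf_growth
  have hcub := AgingMemory.isCubic_of_deriv hf hf0 hc hgr
  exact ⟨fun R => AgingMemory.exists_normHneg_sub_le hΩo hΩb hμ g hcub hf_diss hτT R,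
    fun a z₁ z₂ ha hz₁ hz₂ => AgingMemory.IsSolution.unique hΩo hΩb hμ hcub hf_diss hτT ha hz₁ hz₂⟩
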